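/- Let $(M,0)$ be a germ of a complex manifold of dimension $m$, let $D\subset M$ be a normal crossing divisor germ, $D=\{x_1\cdots x_r=0\}$ in suitable local coordinates $x_1,\dots,x_m$ at $0$ (with $0\le r\le m$), let $\mathcal O_{M,0}$ be the ring of holomorphic function germs and $\mathrm{Der}_M(\log D)$ the $\mathcal O_{M,0}$-module of vector fields preserving the ideal of $D$. Let $w\in\mathbb Z$, and let $z$ be a coordinate on $\mathbb P^1$. **Frobenius type structures.** A *Frobenius type structure with logarithmic pole along $D$* is a tuple $(K,\nabla^r,\mathcal C,\mathcal U,\mathcal V,g)$ where $K$ is (the $\mathcal O_{M,0}$-module of sections of) a germ of a holomorphic vector bundle on $(M,0)$, $\nabla^r$ is a flat connection on $K$ with logarithmic pole along $D$, $\mathcal C:K\to K\otimes\Omega^1_M(\log D)$ is $\mathcal O_{M,0}$-linear with $[\mathcal C_X,\mathcal C_Y]=0$, $\mathcal U,\mathcal V:K\to K$ are $\mathcal O_{M,0}$-linear with $[\mathcal U,\mathcal C_X]=0$ and $\nabla^r(\mathcal V)=0$, and $g:K\times K\to\mathcal O_{M,0}$ is $\mathcal O_{M,0}$-bilinear, symmetric,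 nondegenerate (at every point, i.e. $K\to K^\vee$ is an isomorphism) and $\nabla^r$-flat, such that for all $X,Y\in \mathrm{Der}_M(\log D)$ and $a,b\in K$ $$\nabla^r_X(\mathcal C_Y)-\nabla^r_Y(\mathcal C_X)-\mathcal C_{[X,Y]}=0,\qquad \nabla^r_X(\mathcal U)-[\mathcal C_X,\mathcal V]+\mathcal C_X=0,$$ $$g(\mathcal C_Xa,b)=g(a,\mathcal C_Xb),\quad g(\mathcal Ua,b)=g(a,\mathcal Ub),\quad g(\mathcal Va,b)=-g(a,\mathcal Vb).$$ **$(\log D\text{-}trTLEP(w))$-structures.** A *$(\log D\text{-}trTLEP(w))$-structure* is a tuple $(H,\nabla,P)$ where $H\to\mathbb P^1\times(M,0)$ is a trivial holomorphic vector bundle; $\nabla$ is a flat connection on $H|_{\mathbb C^*\times(M\setminus D,0)}$ which has a logarithmic pole along $\{\infty\}\times M\,\cup\,(\mathbb P^1\setminus\{0\})\times D$ and maps sections of $H$ near $z=0$ to sections of $\frac1z\Omega^1(\log(\{0\}\times M\cup\mathbb C\times D))\otimes H$; and $P:H_{(z,t)}\times H_{(-z,t)}\to\mathbb C$, for $(z,t)\in\mathbb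 C^*\times (M\setminus D,0)$, is a $(-1)^w$-symmetric, nondegenerate, $\nabla$-flat pairing which extends to a $z$-sesquilinear pairing $P:\mathcal O(H)\times\mathcal O(H)\to z^w\mathcal O_{\mathbb P^1\times (M,0)}$ such that $z^{-w}P$ is nondegenerate everywhere on $\mathbb P^1\times(M,0)$. Isomorphisms of either kind of structure are isomorphisms of bundles (over the identity of $(M,0)$, respectively of $\mathbb P^1\times(M,0)$) compatible with all the data. **Proposition.** There is a one-to-one correspondence between $(\log D\text{-}trTLEP(w))$-structures and Frobenius type structures with logarithmic pole along $D$. In detail: 1. Let $(K,\nabla^r,\mathcal C,\mathcal U,\mathcal V,g)$ be a Frobenius type structure with logarithmic pole along $D$. On $H:=\pi^*K$, with $\pi:\mathbb P^1\times(M,0)\to(M,0)$ the projection and with the data on $K$ extended canonically to $H$, $$\nabla:=\nabla^r+\frac1z\,\mathcal C+\Big(\frac1z\,\mathcal U-\mathcal V+\frac w2\,\mathrm{id}\Big)\frac{dz}{z},\qquad P(a,b):=z^w g(a,b)\ \text{ for } a\in H_{(z,t)}\cong K_t,\ b\in H_{(-z,t)}\cong K_t,$$ define a $(\log D\text{-}trTLEP(w))$-structure.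 2. Let $(H,\nabla,P)$ be a $(\log D\text{-}trTLEP(w))$-structure and $K:=H|_{\{0\}\times(M,0)}$. There is a unique isomorphism $H|_{\{\infty\}\times(M,0)}\cong K$ under which the restrictions of every global section of $H$ correspond to each other. With this identification, $$\mathcal C_X[a]:=[z\nabla_Xa],\qquad \mathcal U[a]:=[z\nabla_{z\partial_z}a],\qquad g([a],[b]):=z^{-w}P(a,b)\bmod z$$ for sections $a,b$ of $H$ near $z=0$, together with the residual connection $\nabla^r_X[a]:=[\nabla_Xa]$ and $\mathcal V[a]:=[\nabla_{\tilde z\partial_{\tilde z}}a]+\frac w2[a]$ for sections $a$ of $H$ near $z=\infty$, $\tilde z=1/z$, define a Frobenius type structure with logarithmic pole along $D$ on $K$. 3. The constructions 1 and 2 are inverse to each other up to canonical isomorphism: a Frobenius type structure on $K$ is isomorphic to the one obtained by 1 followed by 2 via the canonical isomorphism $K\cong(\pi^*K)|_{\{0\}\times(M,0)}$, and a structure on $H$ is isomorphic to the one obtained by 2 followed by 1 via the isomorphism $\pi^*(H|_{\{0\}\times(M,0)})\cong H$ that extends the values at $z=0$ of global sections. Pullback $e\mapsto\pi^*e$ is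 a bijection from the isomorphisms between two Frobenius type structures to the isomorphisms between the associated $(\log D\text{-}trTLEP(w))$-structures. Hence 1 and 2 induce mutually inverse bijections between the sets of isomorphism classes. -/

import Mathlib

open Set Filter Topology
open scoped TensorProduct

noncomputable section

namespace LogFrob

/-! ### Germs of holomorphic functions along a set -/

section HolGerm

variable {E F : Type} [NormedAddCommGroup E] [NormedSpace ℂ E]
  [NormedAddCommGroup F] [NormedSpace ℂ F]

/-- Functions that are holomorphic on a neighbourhood of every point of `S`. -/
def holFun (S : Set E) : Subalgebra ℂ (E → ℂ) where
  carrier := {f | AnalyticOnNhd ℂ f S}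
  mul_mem' hf hg := AnalyticOnNhd.mul hf hg
  add_mem' hf hg := AnalyticOnNhd.add hf hg
  algebraMap_mem' c := analyticOnNhd_const (v := c)

/-- Functions that vanish on a neighbourhood of `S`. -/
def nullFun (S : Set E) : Ideal (holFun S) where
  carrier := {f | (f : E → ℂ) =ᶠ[𝓝ˢ S] 0}
  zero_mem' := EventuallyEq.refl (𝓝ˢ S) (0 : E → ℂ)
  add_mem' {f g} hf hg := by
    filter_upwards [show (f : E → ℂ) =ᶠ[𝓝ˢ S] 0 from hf,
      show (g : E → ℂ) =ᶠ[𝓝ˢ S] 0 from hg] with x hx hy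
    change (f : E → ℂ) x + (g : E → ℂ) x = 0
    rw [hx, hy]; simp
  smul_mem' c f hf := by
    filter_upwards [show (f : E → ℂ) =ᶠ[𝓝ˢ S] 0 from hf] with x hx
    change (c : E → ℂ) x * (f : E → ℂ) x = 0
    rw [hx]; simp

/-- The ring of germs along `S` of holomorphic functions: two functions that are holomorphic near
`S` are identified if they agree on a neighbourhood of `S`. -/
def HolGerm (S : Set E) : Type := holFun S ⧸ nullFun S

instance (S : Set E) : CommRing (HolGerm S) := inferInstanceAs (CommRing (holFun S ⧸ nullFun S))

instance (S : Set E) : Algebra ℂ (HolGerm S) :=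
  inferInstanceAs (Algebra ℂ (holFun S ⧸ nullFun S))

/-- The germ along `S` of a function that is holomorphic near `S`. -/
def HolGerm.mk (S : Set E) : holFun S →ₐ[ℂ] HolGerm S := Ideal.Quotient.mkₐ ℂ (nullFun S)

/-- The germ along `S` of a function that is holomorphic near `S`. -/
def HolGerm.of {S : Set E} (f : E → ℂ) (hf : AnalyticOnNhd ℂ f S) : HolGerm S :=
  HolGerm.mk S ⟨f, hf⟩

theorem HolGerm.mk_surjective (S : Set E) : Function.Surjective (HolGerm.mk S) :=
  Ideal.Quotient.mk_surjective

theorem HolGerm.mk_eq_mk_iff {S : Set E} {f g : holFun S} :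
    HolGerm.mk S f = HolGerm.mk S g ↔ (f : E → ℂ) =ᶠ[𝓝ˢ S] g := by
  refine (Ideal.Quotient.eq (I := nullFun S)).trans ?_
  change ((f - g : holFun S) : E → ℂ) =ᶠ[𝓝ˢ S] 0 ↔ _
  constructor
  · intro h
    filter_upwards [h] with x hx
    exact sub_eq_zero.1 hx
  · intro h
    filter_upwards [h] with x hx
    exact sub_eq_zero.2 hx

/-- Composition with a holomorphic map `φ`, on functions. -/
def holFunComap {S : Set E} {T : Set F} (φ : E → F) (hφ : AnalyticOnNhd ℂ φ S)
    (hm : MapsTo φ S T) : holFun T →ₐ[ℂ] holFun S where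
  toFun f := ⟨(f : F → ℂ) ∘ φ, AnalyticOnNhd.comp f.2 hφ hm⟩
  map_one' := rfl
  map_mul' _ _ := rfl
  map_zero' := rfl
  map_add' _ _ := rfl
  commutes' _ := rfl

theorem tendsto_nhdsSet_of_analytic {S : Set E} {T : Set F} {φ : E → F}
    (hφ : AnalyticOnNhd ℂ φ S) (hm : MapsTo φ S T) : Tendsto φ (𝓝ˢ S) (𝓝ˢ T) := by
  rw [Tendsto, map_le_iff_le_comap, nhdsSet_le]
  intro x hx
  exact map_le_iff_le_comap.1 (((hφ x hx).continuousAt).mono_right (nhds_le_nhdsSet (hm hx)))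

/-- Composition with a holomorphic map `φ`, on germs. -/
def HolGerm.comap {S : Set E} {T : Set F} (φ : E → F) (hφ : AnalyticOnNhd ℂ φ S)
    (hm : MapsTo φ S T) : HolGerm T →ₐ[ℂ] HolGerm S :=
  Ideal.Quotient.liftₐ (nullFun T) ((HolGerm.mk S).comp (holFunComap φ hφ hm)) (by
    intro f hf
    have h0 : HolGerm.mk S (holFunComap φ hφ hm f) = HolGerm.mk S 0 := by
      rw [HolGerm.mk_eq_mk_iff]
      exact (tendsto_nhdsSet_of_analytic hφ hm).eventually hf
    simpa using h0)

theorem HolGerm.comap_of {S : Set E} {T : Set F} (φ : E → F) (hφ : AnalyticOnNhd ℂ φ S)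
    (hm : MapsTo φ S T) (f : F → ℂ) (hf : AnalyticOnNhd ℂ f T) :
    HolGerm.comap φ hφ hm (HolGerm.of f hf) = HolGerm.of (f ∘ φ) (hf.comp hφ hm) := rfl

theorem analyticOnNhd_fderiv_apply {S : Set E} (v : E) {f : E → ℂ} (hf : AnalyticOnNhd ℂ f S) :
    AnalyticOnNhd ℂ (fun x => fderiv ℂ f x v) S := fun x hx =>
  ((ContinuousLinearMap.apply ℂ ℂ v).analyticAt _).comp (hf x hx).fderiv

theorem eventually_analyticAt_nhdsSet {S : Set E} (f : holFun S) :
    ∀ᶠ x in 𝓝ˢ S, AnalyticAt ℂ (f : E → ℂ) x :=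
  eventually_nhdsSet_iff_forall.2 fun x hx => (f.2 x hx).eventually_analyticAt

theorem fderiv_eventuallyEq_nhdsSet {S : Set E} {f g : E → ℂ} (h : f =ᶠ[𝓝ˢ S] g) :
    fderiv ℂ f =ᶠ[𝓝ˢ S] fderiv ℂ g :=
  eventually_nhdsSet_iff_forall.2 fun x hx =>
    EventuallyEq.fderiv (show f =ᶠ[𝓝 x] g from eventually_nhdsSet_iff_forall.1 h x hx)

/-- The derivative in the constant direction `v`, on functions. -/
def holFunDeriv {S : Set E} (v : E) (f : holFun S) : holFun S :=
  ⟨fun x => fderiv ℂ (f : E → ℂ) x v, analyticOnNhd_fderiv_apply v f.2⟩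

/-- The derivative in the constant direction `v`, as a map of germs. -/
def HolGerm.dirFun {S : Set E} (v : E) (f : HolGerm S) : HolGerm S :=
  Quotient.liftOn' f (fun g => HolGerm.mk S (holFunDeriv v g)) (by
    intro a b hab
    have h : HolGerm.mk S a = HolGerm.mk S b := Quotient.sound' hab
    rw [HolGerm.mk_eq_mk_iff] at h ⊢
    filter_upwards [fderiv_eventuallyEq_nhdsSet h] with x hx
    change fderiv ℂ (a : E → ℂ) x v = fderiv ℂ (b : E → ℂ) x v
    rw [hx])

theorem HolGerm.dirFun_mk {S : Set E} (v : E) (f : holFun S) :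
    HolGerm.dirFun v (HolGerm.mk S f) = HolGerm.mk S (holFunDeriv v f) := rfl

/-- The derivative in the constant direction `v`, as a derivation of the ring of germs. -/
def HolGerm.dir {S : Set E} (v : E) : Derivation ℂ (HolGerm S) (HolGerm S) :=
  Derivation.mk'
    { toFun := HolGerm.dirFun v
      map_add' := by
        intro a b
        obtain ⟨f, rfl⟩ := HolGerm.mk_surjective S a
        obtain ⟨g, rfl⟩ := HolGerm.mk_surjective S b
        rw [← map_add, dirFun_mk, dirFun_mk, dirFun_mk, ← map_add, mk_eq_mk_iff]
        filter_upwards [eventually_analyticAt_nhdsSet f, eventually_analyticAt_nhdsSet g]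
          with x hf hg
        change fderiv ℂ ((f : E → ℂ) + (g : E → ℂ)) x v =
          fderiv ℂ (f : E → ℂ) x v + fderiv ℂ (g : E → ℂ) x v
        rw [fderiv_add hf.differentiableAt hg.differentiableAt]; rfl
      map_smul' := by
        intro c a
        obtain ⟨f, rfl⟩ := HolGerm.mk_surjective S a
        rw [← map_smul, dirFun_mk, dirFun_mk, RingHom.id_apply, ← map_smul, mk_eq_mk_iff]
        filter_upwards [eventually_analyticAt_nhdsSet f] with x hf
        change fderiv ℂ (c • (f : E → ℂ)) x v = c • fderiv ℂ (f : E → ℂ) x v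
        rw [fderiv_const_smul hf.differentiableAt]; rfl }
    (by
      intro a b
      obtain ⟨f, rfl⟩ := HolGerm.mk_surjective S a
      obtain ⟨g, rfl⟩ := HolGerm.mk_surjective S b
      change HolGerm.dirFun v (HolGerm.mk S f * HolGerm.mk S g) =
        HolGerm.mk S f * HolGerm.dirFun v (HolGerm.mk S g) +
          HolGerm.mk S g * HolGerm.dirFun v (HolGerm.mk S f)
      rw [← map_mul, dirFun_mk, dirFun_mk, dirFun_mk, ← map_mul, ← map_mul, ← map_add,
        mk_eq_mk_iff]
      filter_upwards [eventually_analyticAt_nhdsSet f, eventually_analyticAt_nhdsSet g]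
        with x hf hg
      change fderiv ℂ ((f : E → ℂ) * (g : E → ℂ)) x v =
        (f : E → ℂ) x * fderiv ℂ (g : E → ℂ) x v + (g : E → ℂ) x * fderiv ℂ (f : E → ℂ) x v
      rw [fderiv_mul hf.differentiableAt hg.differentiableAt]; rfl)

theorem HolGerm.dir_mk {S : Set E} (v : E) (f : holFun S) :
    HolGerm.dir v (HolGerm.mk S f) = HolGerm.mk S (holFunDeriv v f) := rfl

theorem HolGerm.dir_comm {S : Set E} (u v : E) (a : HolGerm S) :
    HolGerm.dir u (HolGerm.dir v a) = HolGerm.dir v (HolGerm.dir u a) := by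
  obtain ⟨f, rfl⟩ := HolGerm.mk_surjective S a
  rw [dir_mk, dir_mk, dir_mk, dir_mk, mk_eq_mk_iff]
  filter_upwards [eventually_analyticAt_nhdsSet f] with x hf
  have hd : DifferentiableAt ℂ (fderiv ℂ (f : E → ℂ)) x := hf.fderiv.differentiableAt
  have hs : IsSymmSndFDerivAt ℂ (f : E → ℂ) x :=
    ContDiffAt.isSymmSndFDerivAt_of_omega hf.contDiffAt
  have key : ∀ p q : E, fderiv ℂ (fun y => fderiv ℂ (f : E → ℂ) y p) x q =
      fderiv ℂ (fderiv ℂ (f : E → ℂ)) x q p := by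
    intro p q
    rw [fderiv_clm_apply hd (differentiableAt_const p)]
    simp
  change fderiv ℂ (fun y => fderiv ℂ (f : E → ℂ) y v) x u =
    fderiv ℂ (fun y => fderiv ℂ (f : E → ℂ) y u) x v
  rw [key, key]
  exact hs.eq u v

/-- The value of a germ at a point of `S`. -/
def HolGerm.eval {S : Set E} (x : E) (hx : x ∈ S) : HolGerm S →ₐ[ℂ] ℂ :=
  Ideal.Quotient.liftₐ (nullFun S) ((Pi.evalAlgHom ℂ (fun _ : E => ℂ) x).comp (holFun S).val)
    (fun f hf => EventuallyEq.self_of_nhdsSet (show (f : E → ℂ) =ᶠ[𝓝ˢ S] 0 from hf) hx)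

end HolGerm

/-! ### The germ `(M, 0)`, the divisor `D`, logarithmic vector fields -/

/-- `𝒪_{M,0}`. The germ `(M, 0)` is identified with `(ℂ^m, 0)` by a chart. -/
abbrev BaseRing (m : ℕ) : Type := HolGerm ({0} : Set (Fin m → ℂ))

/-- A normal crossing divisor germ: local holomorphic coordinates `x_1, …, x_m` of `(M, 0)`
(functions vanishing at `0` with invertible Jacobian matrix there) and `r ≤ m`; the divisor is
`D = {x_1 ⋯ x_r = 0}`. For `r = 0` it is empty. -/
structure NormalCrossing (m : ℕ) where
  coord : Fin m → BaseRing m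
  coord_zero : ∀ i, HolGerm.eval 0 (mem_singleton 0) (coord i) = 0
  jacobian : Matrix.det (Matrix.of fun i j : Fin m =>
    HolGerm.eval 0 (mem_singleton 0) (HolGerm.dir (Pi.single j 1) (coord i))) ≠ 0
  r : ℕ
  r_le : r ≤ m

variable {m : ℕ}

/-- The defining equation `x_1 ⋯ x_r` of `D`. -/
def NormalCrossing.equation (D : NormalCrossing m) : BaseRing m :=
  ∏ i ∈ Finset.univ.filter (fun i : Fin m => i.val < D.r), D.coord i

/-- Germs of holomorphic vector fields `∑ X_i ∂/∂t_i` on `(M, 0)`. -/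
abbrev VecField (m : ℕ) : Type := Fin m → BaseRing m

/-- A vector field as a derivation of `𝒪_{M,0}`. -/
def VecField.act (X : VecField m) : Derivation ℂ (BaseRing m) (BaseRing m) :=
  ∑ i, X i • HolGerm.dir (Pi.single i 1)

theorem VecField.act_apply (X : VecField m) (f : BaseRing m) :
    VecField.act X f = ∑ i, X i * HolGerm.dir (Pi.single i 1) f := by
  have h := congrFun (map_sum (Derivation.coeFnAddMonoidHom (R := ℂ) (A := BaseRing m)
    (M := BaseRing m)) (fun i => X i • HolGerm.dir (Pi.single i 1)) Finset.univ) f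
  rw [Finset.sum_apply] at h
  exact h

/-- The Lie bracket of vector fields, in components. -/
def VecField.bracket (X Y : VecField m) : VecField m :=
  fun i => VecField.act X (Y i) - VecField.act Y (X i)

theorem VecField.bracket_act (X Y : VecField m) (f : BaseRing m) :
    VecField.act (VecField.bracket X Y) f =
      VecField.act X (VecField.act Y f) - VecField.act Y (VecField.act X f) := by
  have h : ∀ X Y : VecField m, VecField.act X (VecField.act Y f) =
      (∑ i, VecField.act X (Y i) * HolGerm.dir (Pi.single i 1) f) +
      ∑ i, ∑ j, Y i * (X j *
        HolGerm.dir (Pi.single j 1) (HolGerm.dir (Pi.single i 1) f)) := by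
    intro X Y
    rw [VecField.act_apply Y f, map_sum, ← Finset.sum_add_distrib]
    refine Finset.sum_congr rfl fun i _ => ?_
    rw [Derivation.leibniz, smul_eq_mul, smul_eq_mul, VecField.act_apply X (HolGerm.dir _ f),
      Finset.mul_sum]
    ring
  have h2 : (∑ i, ∑ j, Y i * (X j *
        HolGerm.dir (Pi.single j 1) (HolGerm.dir (Pi.single i 1) f))) =
      ∑ i, ∑ j, X i * (Y j *
        HolGerm.dir (Pi.single j 1) (HolGerm.dir (Pi.single i 1) f)) := by
    rw [Finset.sum_comm]
    refine Finset.sum_congr rfl fun i _ => Finset.sum_congr rfl fun j _ => ?_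
    rw [HolGerm.dir_comm]; ring
  rw [h X Y, h Y X, h2, VecField.act_apply, add_sub_add_right_eq_sub, ← Finset.sum_sub_distrib]
  exact Finset.sum_congr rfl fun i _ => sub_mul _ _ _

/-- `Der_M(log D)`: vector fields that preserve the ideal of `D`. -/
def logVF (D : NormalCrossing m) : Submodule (BaseRing m) (VecField m) where
  carrier := {X | ∀ h ∈ Ideal.span {D.equation}, VecField.act X h ∈ Ideal.span {D.equation}}
  zero_mem' h _ := by
    rw [VecField.act_apply]; simp
  add_mem' {X Y} hX hY h hh := by
    have e : VecField.act (X + Y) h = VecField.act X h + VecField.act Y h := by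
      simp only [VecField.act_apply, Pi.add_apply, add_mul, Finset.sum_add_distrib]
    rw [e]
    exact Ideal.add_mem _ (hX h hh) (hY h hh)
  smul_mem' f X hX h hh := by
    have e : VecField.act (f • X) h = f * VecField.act X h := by
      simp only [VecField.act_apply, Pi.smul_apply, smul_eq_mul, Finset.mul_sum, mul_assoc]
    rw [e]
    exact Ideal.mul_mem_left _ _ (hX h hh)

/-- The Lie bracket of logarithmic vector fields. -/
def logBracket {D : NormalCrossing m} (X Y : logVF D) : logVF D :=
  ⟨VecField.bracket X.1 Y.1, fun h hh => by
    rw [VecField.bracket_act]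
    exact Ideal.sub_mem _ (X.2 _ (Y.2 h hh)) (Y.2 _ (X.2 h hh))⟩

/-! ### Frobenius type structures with logarithmic poles -/

/-- A Frobenius type structure with logarithmic pole along `D` on the germ of a holomorphic vector
bundle over `(M, 0)` with module of sections `K`, a finite free `𝒪_{M,0}`-module. Forms with values
in `Ω¹_M(log D)`, the dual of the free module `Der_M(log D)`, are given by their
contractions with logarithmic vector fields. -/
structure FrobType (D : NormalCrossing m) (K : Type*) [AddCommGroup K]
    [Module (BaseRing m) K] where
  free : Module.Free (BaseRing m) K
  finite : Module.Finite (BaseRing m) K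
  /-- The connection `∇ʳ` with logarithmic pole along `D`. -/
  nabla : logVF D → K → K
  nabla_field_add : ∀ X Y a, nabla (X + Y) a = nabla X a + nabla Y a
  nabla_field_smul : ∀ (f : BaseRing m) X a, nabla (f • X) a = f • nabla X a
  nabla_add : ∀ X a b, nabla X (a + b) = nabla X a + nabla X b
  nabla_leibniz : ∀ X (f : BaseRing m) a,
    nabla X (f • a) = VecField.act X.1 f • a + f • nabla X a
  nabla_flat : ∀ X Y a, nabla X (nabla Y a) - nabla Y (nabla X a) = nabla (logBracket X Y) a
  /-- The logarithmic Higgs field. -/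
  C : logVF D →ₗ[BaseRing m] Module.End (BaseRing m) K
  higgs : ∀ X Y a, C X (C Y a) = C Y (C X a)
  U : Module.End (BaseRing m) K
  U_C : ∀ X a, U (C X a) = C X (U a)
  V : Module.End (BaseRing m) K
  V_flat : ∀ X a, nabla X (V a) = V (nabla X a)
  g : K →ₗ[BaseRing m] K →ₗ[BaseRing m] BaseRing m
  g_symm : ∀ a b, g a b = g b a
  g_nondegenerate : Function.Bijective g
  g_flat : ∀ X a b, VecField.act X.1 (g a b) = g (nabla X a) b + g a (nabla X b)
  /-- `∇ʳ_X(C_Y) - ∇ʳ_Y(C_X) - C_{[X,Y]} = 0`. -/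
  nabla_C : ∀ X Y a,
    (nabla X (C Y a) - C Y (nabla X a)) - (nabla Y (C X a) - C X (nabla Y a))
      - C (logBracket X Y) a = 0
  /-- `∇ʳ(U) - [C, V] + C = 0`. -/
  nabla_U : ∀ X a,
    (nabla X (U a) - U (nabla X a)) - (C X (V a) - V (C X a)) + C X a = 0
  g_C : ∀ X a b, g (C X a) b = g a (C X b)
  g_U : ∀ a b, g (U a) b = g a (U b)
  g_V : ∀ a b, g (V a) b = -g a (V b)

/-- Isomorphisms of Frobenius type structures (over the identity of `(M, 0)`). -/
structure FrobType.IsIso {D : NormalCrossing m} {K K' : Type*} [AddCommGroup K]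
    [Module (BaseRing m) K] [AddCommGroup K'] [Module (BaseRing m) K']
    (S : FrobType D K) (S' : FrobType D K') (e : K ≃ₗ[BaseRing m] K') : Prop where
  nabla : ∀ X a, e (S.nabla X a) = S'.nabla X (e a)
  C : ∀ X a, e (S.C X a) = S'.C X (e a)
  U : ∀ a, e (S.U a) = S'.U (e a)
  V : ∀ a, e (S.V a) = S'.V (e a)
  g : ∀ a b, S'.g (e a) (e b) = S.g a b

/-! ### Functions on `ℂ* × (M, 0)`, `ℂ × (M, 0)` and `(ℙ¹ ∖ {0}) × (M, 0)` -/

/-- `ℂ × {0}`, as a subset of `ℂ × M`. -/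
def affineLine (m : ℕ) : Set (ℂ × (Fin m → ℂ)) := univ ×ˢ {0}

/-- `ℂ* × {0}`, as a subset of `ℂ × M`. -/
def puncturedLine (m : ℕ) : Set (ℂ × (Fin m → ℂ)) := {0}ᶜ ×ˢ {0}

/-- Holomorphic functions on `ℂ* × (M, 0)`. -/
abbrev PuncRing (m : ℕ) : Type := HolGerm (puncturedLine m)

theorem analyticOnNhd_inv_puncturedLine (m : ℕ) :
    AnalyticOnNhd ℂ (fun p : ℂ × (Fin m → ℂ) => p.1⁻¹) (puncturedLine m) :=
  fun _ hp => analyticAt_fst.inv hp.1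

/-- Restriction of functions on `ℂ × (M, 0)` to `ℂ* × (M, 0)`. -/
def restrictZero (m : ℕ) : HolGerm (affineLine m) →ₐ[ℂ] PuncRing m :=
  HolGerm.comap (fun p => p) (fun _ _ => analyticAt_id) (fun _ hp => ⟨mem_univ _, hp.2⟩)

/-- Restriction of functions on `(ℙ¹ ∖ {0}) × (M, 0)`, with coordinate `1/z` on `ℙ¹ ∖ {0}`, to
`ℂ* × (M, 0)`. -/
def restrictInfty (m : ℕ) : HolGerm (affineLine m) →ₐ[ℂ] PuncRing m :=
  HolGerm.comap (fun p => (p.1⁻¹, p.2))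
    (fun p hp => (analyticOnNhd_inv_puncturedLine m p hp).prod analyticAt_snd)
    (fun _ hp => ⟨mem_univ _, hp.2⟩)

/-- The functions on `ℂ* × (M, 0)` that extend holomorphically to `ℂ × (M, 0)`. -/
def zeroRing (m : ℕ) : Subalgebra ℂ (PuncRing m) := (restrictZero m).range

/-- The functions on `ℂ* × (M, 0)` that extend holomorphically to `(ℙ¹ ∖ {0}) × (M, 0)`. -/
def inftyRing (m : ℕ) : Subalgebra ℂ (PuncRing m) := (restrictInfty m).range

/-- Pullback of functions along the projection `ℂ* × (M, 0) → (M, 0)`. -/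
def pull (m : ℕ) : BaseRing m →ₐ[ℂ] PuncRing m :=
  HolGerm.comap Prod.snd (fun _ _ => analyticAt_snd) (fun _ hp => hp.2)

/-- Pullback of functions along the projection `ℂ × (M, 0) → (M, 0)`. -/
def pullLine (m : ℕ) : BaseRing m →ₐ[ℂ] HolGerm (affineLine m) :=
  HolGerm.comap Prod.snd (fun _ _ => analyticAt_snd) (fun _ hp => hp.2)

theorem restrictZero_pullLine (f : BaseRing m) : restrictZero m (pullLine m f) = pull m f := by
  obtain ⟨f, rfl⟩ := HolGerm.mk_surjective _ f
  rfl

theorem restrictInfty_pullLine (f : BaseRing m) : restrictInfty m (pullLine m f) = pull m f := by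
  obtain ⟨f, rfl⟩ := HolGerm.mk_surjective _ f
  rfl

/-- `pull`, with values in the functions on `ℂ × (M, 0)`. -/
def pullZero (m : ℕ) : BaseRing m →ₐ[ℂ] zeroRing m :=
  (pull m).codRestrict (zeroRing m) fun f => ⟨pullLine m f, restrictZero_pullLine f⟩

/-- `pull`, with values in the functions on `(ℙ¹ ∖ {0}) × (M, 0)`. -/
def pullInfty (m : ℕ) : BaseRing m →ₐ[ℂ] inftyRing m :=
  (pull m).codRestrict (inftyRing m) fun f => ⟨pullLine m f, restrictInfty_pullLine f⟩

instance : Algebra (BaseRing m) (PuncRing m) := (pull m).toRingHom.toAlgebra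

/-- Pullback of functions along `(z, t) ↦ (-z, t)`. -/
def negZ (m : ℕ) : PuncRing m →ₐ[ℂ] PuncRing m :=
  HolGerm.comap (fun p => (-p.1, p.2)) (fun _ _ => analyticAt_fst.neg.prod analyticAt_snd)
    (fun _ hp => ⟨fun h => hp.1 (neg_eq_zero.1 h), hp.2⟩)

/-- The coordinate `z`, an invertible function on `ℂ* × (M, 0)`. -/
def zUnit (m : ℕ) : (PuncRing m)ˣ where
  val := HolGerm.of (fun p => p.1) (fun _ _ => analyticAt_fst)
  inv := HolGerm.of (fun p => p.1⁻¹) (analyticOnNhd_inv_puncturedLine m)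
  val_inv := by
    refine ((map_mul (HolGerm.mk (puncturedLine m)) _ _).symm.trans ?_).trans
      (map_one (HolGerm.mk (puncturedLine m)))
    refine HolGerm.mk_eq_mk_iff.2 (eventually_nhdsSet_iff_forall.2 fun p hp => ?_)
    filter_upwards [continuousAt_fst.eventually_ne hp.1] with q hq
    exact mul_inv_cancel₀ hq
  inv_val := by
    refine ((map_mul (HolGerm.mk (puncturedLine m)) _ _).symm.trans ?_).trans
      (map_one (HolGerm.mk (puncturedLine m)))
    refine HolGerm.mk_eq_mk_iff.2 (eventually_nhdsSet_iff_forall.2 fun p hp => ?_)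
    filter_upwards [continuousAt_fst.eventually_ne hp.1] with q hq
    exact inv_mul_cancel₀ hq

/-- The function `z ^ k` on `ℂ* × (M, 0)`, for an integer `k`. -/
def zPow (m : ℕ) (k : ℤ) : PuncRing m := ((zUnit m ^ k : (PuncRing m)ˣ) : PuncRing m)

/-- `z`, as a function on `ℂ × (M, 0)`. -/
def zAtZero (m : ℕ) : zeroRing m :=
  ⟨zPow m 1, HolGerm.of (fun p => p.1) (fun _ _ => analyticAt_fst), by
    rw [zPow, zpow_one]; rfl⟩

/-- `1/z`, as a function on `(ℙ¹ ∖ {0}) × (M, 0)`. -/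
def zInvAtInfty (m : ℕ) : inftyRing m :=
  ⟨zPow m (-1), HolGerm.of (fun p => p.1) (fun _ _ => analyticAt_fst), by
    rw [zPow, zpow_neg_one]; rfl⟩

/-- The derivation `z ∂/∂z`. -/
def zDz (m : ℕ) : Derivation ℂ (PuncRing m) (PuncRing m) :=
  zPow m 1 • HolGerm.dir ((1, 0) : ℂ × (Fin m → ℂ))

/-- The lift of a vector field on `(M, 0)` to `ℂ* × (M, 0)`, acting in the direction of `M`. -/
def VecField.lift (X : VecField m) : Derivation ℂ (PuncRing m) (PuncRing m) :=
  ∑ i, pull m (X i) • HolGerm.dir ((0, Pi.single i 1) : ℂ × (Fin m → ℂ))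

/-! ### `(logD-trTLEP(w))`-structures -/

/-- A `(logD-trTLEP(w))`-structure on a trivial holomorphic vector bundle over `ℙ¹ × (M, 0)`. The
bundle is given by its sections: `H` are the sections over `ℂ* × (M, 0)`, and `latZero` and
`latInfty` are the sections that extend to `ℂ × (M, 0)` and to `(ℙ¹ ∖ {0}) × (M, 0)`. The
logarithmic vector fields on `ℂ* × (M, 0)` along `ℂ* × D` are freely generated over
`Der_M(log D)` and `z ∂/∂z`, so that the connection is given by `∇_X` for `X` in `Der_M(log D)` and
by `∇_{z∂/∂z}`. -/
structure TrTLEP (D : NormalCrossing m) (w : ℤ) (H : Type*) [AddCommGroup H]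
    [Module (PuncRing m) H] where
  latZero : Submodule (zeroRing m) H
  latInfty : Submodule (inftyRing m) H
  /-- The bundle is trivial: some global sections are a frame everywhere on `ℙ¹ × (M, 0)`. -/
  trivial : ∃ (n : ℕ) (b : Module.Basis (Fin n) (PuncRing m) H),
    latZero = Submodule.span (zeroRing m) (range b) ∧
    latInfty = Submodule.span (inftyRing m) (range b)
  /-- `∇_X`, for `X` in `Der_M(log D)`. -/
  nabla : logVF D → H → H
  nabla_field_add : ∀ X Y a, nabla (X + Y) a = nabla X a + nabla Y a
  nabla_field_smul : ∀ (f : BaseRing m) X a, nabla (f • X) a = pull m f • nabla X a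
  nabla_add : ∀ X a b, nabla X (a + b) = nabla X a + nabla X b
  nabla_leibniz : ∀ X (f : PuncRing m) a,
    nabla X (f • a) = VecField.lift X.1 f • a + f • nabla X a
  /-- `∇_{z∂/∂z}`. -/
  nablaZ : H → H
  nablaZ_add : ∀ a b, nablaZ (a + b) = nablaZ a + nablaZ b
  nablaZ_leibniz : ∀ (f : PuncRing m) a, nablaZ (f • a) = zDz m f • a + f • nablaZ a
  flat : ∀ X Y a, nabla X (nabla Y a) - nabla Y (nabla X a) = nabla (logBracket X Y) a
  flatZ : ∀ X a, nabla X (nablaZ a) = nablaZ (nabla X a)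
  /-- At `z = 0` the connection maps sections to `(1/z) Ω¹(log({0} × M ∪ ℂ × D))`-valued ones. -/
  pole_zero : ∀ X, ∀ a ∈ latZero, zPow m 1 • nabla X a ∈ latZero
  pole_zeroZ : ∀ a ∈ latZero, zPow m 1 • nablaZ a ∈ latZero
  /-- The pole is logarithmic along `{∞} × M ∪ (ℙ¹ ∖ {0}) × D`. -/
  pole_infty : ∀ X, ∀ a ∈ latInfty, nabla X a ∈ latInfty
  pole_inftyZ : ∀ a ∈ latInfty, nablaZ a ∈ latInfty
  /-- The pairing: the value of `P a b` at `(z, t)` pairs `a (z, t)` with `b (-z, t)`. -/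
  P : H → H → PuncRing m
  P_add_left : ∀ a a' b, P (a + a') b = P a b + P a' b
  P_add_right : ∀ a b b', P a (b + b') = P a b + P a b'
  P_smul_left : ∀ (f : PuncRing m) a b, P (f • a) b = f * P a b
  P_smul_right : ∀ (f : PuncRing m) a b, P a (f • b) = negZ m f * P a b
  P_symm : ∀ a b, P b a = (-1 : ℂ) ^ w • negZ m (P a b)
  P_flat : ∀ X a b, VecField.lift X.1 (P a b) = P (nabla X a) b + P a (nabla X b)
  P_flatZ : ∀ a b, zDz m (P a b) = P (nablaZ a) b + P a (nablaZ b)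
  /-- On sections that extend to `z = 0` the pairing takes values in `z^w 𝒪`, and `z^(-w) P` is
  nondegenerate there: it induces an isomorphism onto the dual. -/
  P_zero : ∀ a ∈ latZero, ∀ b ∈ latZero, zPow m (-w) * P a b ∈ zeroRing m
  P_zero_nondegenerate : ∀ φ : latZero →ₗ[zeroRing m] zeroRing m,
    ∃! b : latZero, ∀ a : latZero, zPow m (-w) * P a b = φ a
  /-- The same near `z = ∞`. -/
  P_infty : ∀ a ∈ latInfty, ∀ b ∈ latInfty, zPow m (-w) * P a b ∈ inftyRing m
  P_infty_nondegenerate : ∀ φ : latInfty →ₗ[inftyRing m] inftyRing m,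
    ∃! b : latInfty, ∀ a : latInfty, zPow m (-w) * P a b = φ a

namespace TrTLEP

section

variable {D : NormalCrossing m} {w : ℤ} {H : Type*} [AddCommGroup H] [Module (PuncRing m) H]

/-- Isomorphisms of `(logD-trTLEP(w))`-structures (over the identity of `ℙ¹ × (M, 0)`). -/
structure IsIso {H' : Type*} [AddCommGroup H'] [Module (PuncRing m) H']
    (T : TrTLEP D w H) (T' : TrTLEP D w H') (e : H ≃ₗ[PuncRing m] H') : Prop where
  latZero : ∀ a, e a ∈ T'.latZero ↔ a ∈ T.latZero
  latInfty : ∀ a, e a ∈ T'.latInfty ↔ a ∈ T.latInfty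
  nabla : ∀ X a, e (T.nabla X a) = T'.nabla X (e a)
  nablaZ : ∀ a, e (T.nablaZ a) = T'.nablaZ (e a)
  P : ∀ a b, T'.P (e a) (e b) = T.P a b

/-- `z · latZero`: the sections that vanish at `z = 0`. -/
def subZero (T : TrTLEP D w H) : Submodule (zeroRing m) T.latZero :=
  LinearMap.range (LinearMap.lsmul (zeroRing m) T.latZero (zAtZero m))

/-- The sections of `H|_{{0} × (M, 0)}`: sections that extend to `z = 0`, modulo `z`. -/
def ZeroFibre (T : TrTLEP D w H) : Type _ := T.latZero ⧸ T.subZero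

instance (T : TrTLEP D w H) : AddCommGroup T.ZeroFibre :=
  inferInstanceAs (AddCommGroup (T.latZero ⧸ T.subZero))

instance (T : TrTLEP D w H) : Module (zeroRing m) T.ZeroFibre :=
  inferInstanceAs (Module (zeroRing m) (T.latZero ⧸ T.subZero))

instance (T : TrTLEP D w H) : Module (BaseRing m) T.ZeroFibre :=
  Module.compHom T.ZeroFibre (pullZero m).toRingHom

/-- The restriction `[a]` to `z = 0` of a section `a`. -/
def resZero (T : TrTLEP D w H) : T.latZero →ₗ[zeroRing m] T.ZeroFibre :=
  T.subZero.mkQ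

/-- `(1/z) · latInfty`: the sections that vanish at `z = ∞`. -/
def subInfty (T : TrTLEP D w H) : Submodule (inftyRing m) T.latInfty :=
  LinearMap.range (LinearMap.lsmul (inftyRing m) T.latInfty (zInvAtInfty m))

/-- The sections of `H|_{{∞} × (M, 0)}`: sections that extend to `z = ∞`, modulo `1/z`. -/
def InftyFibre (T : TrTLEP D w H) : Type _ := T.latInfty ⧸ T.subInfty

instance (T : TrTLEP D w H) : AddCommGroup T.InftyFibre :=
  inferInstanceAs (AddCommGroup (T.latInfty ⧸ T.subInfty))

instance (T : TrTLEP D w H) : Module (inftyRing m) T.InftyFibre :=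
  inferInstanceAs (Module (inftyRing m) (T.latInfty ⧸ T.subInfty))

instance (T : TrTLEP D w H) : Module (BaseRing m) T.InftyFibre :=
  Module.compHom T.InftyFibre (pullInfty m).toRingHom

/-- The restriction `[a]` to `z = ∞` of a section `a`. -/
def resInfty (T : TrTLEP D w H) : T.latInfty →ₗ[inftyRing m] T.InftyFibre :=
  T.subInfty.mkQ

/-- The canonical identification of `H|_{{∞} × (M, 0)}` with `H|_{{0} × (M, 0)}`: the values at
`∞` and at `0` of each global section correspond to each other. -/
def IsCanonical (T : TrTLEP D w H) (j : T.InftyFibre ≃ₗ[BaseRing m] T.ZeroFibre) : Prop :=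
  ∀ (s : H) (h0 : s ∈ T.latZero) (hinf : s ∈ T.latInfty),
    j (T.resInfty ⟨s, hinf⟩) = T.resZero ⟨s, h0⟩

/-- `S` is the Frobenius type structure on `K = H|_{{0} × (M, 0)}` given by the residues of `T`:
`C_X [a] = [z ∇_X a]`, `U [a] = [z ∇_{z∂/∂z} a]` and `g([a], [b]) = z^(-w) P(a, b) mod z` at `z = 0`;
at `z = ∞`, with `y = 1/z` and `y ∂/∂y = -z ∂/∂z`, the residual connection
`[a] ↦ [∇_X a]` and the residue endomorphism `[a] ↦ [∇_{y∂/∂y} a]`, shifted to `K` by the canonical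
identification `j`, are `∇ʳ` and `V - w/2`. -/
structure IsResidue (T : TrTLEP D w H) (j : T.InftyFibre ≃ₗ[BaseRing m] T.ZeroFibre)
    (S : FrobType D T.ZeroFibre) : Prop where
  canonical : T.IsCanonical j
  C : ∀ X (a : T.latZero),
    S.C X (T.resZero a) = T.resZero ⟨zPow m 1 • T.nabla X a, T.pole_zero X a a.2⟩
  U : ∀ a : T.latZero,
    S.U (T.resZero a) = T.resZero ⟨zPow m 1 • T.nablaZ a, T.pole_zeroZ a a.2⟩
  g : ∀ a b : T.latZero, ∃ c : zeroRing m,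
    zPow m (-w) * T.P a b = pull m (S.g (T.resZero a) (T.resZero b)) + (zAtZero m * c : zeroRing m)
  nabla : ∀ X (a : T.latInfty),
    S.nabla X (j (T.resInfty a)) = j (T.resInfty ⟨T.nabla X a, T.pole_infty X a a.2⟩)
  V : ∀ a : T.latInfty,
    S.V (j (T.resInfty a)) = j (-T.resInfty ⟨T.nablaZ a, T.pole_inftyZ a a.2⟩)
      + algebraMap ℂ (BaseRing m) (w / 2 : ℂ) • j (T.resInfty a)

end

section

variable {D : NormalCrossing m} {w : ℤ} {K : Type*} [AddCommGroup K] [Module (BaseRing m) K]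

/-- `T` is the structure on `H = π^* K` with
`∇ = ∇ʳ + C/z + (U/z - V + w/2) dz/z` and `P = z^w g`, where `π : ℙ¹ × (M, 0) → (M, 0)` is the
projection. The formulas are written out on the pulled back sections `1 ⊗ k`, which generate
`H`. -/
structure IsExplicit (S : FrobType D K) (T : TrTLEP D w (PuncRing m ⊗[BaseRing m] K)) :
    Prop where
  latZero : T.latZero =
    Submodule.span (zeroRing m) (range fun k : K => (1 : PuncRing m) ⊗ₜ[BaseRing m] k)
  latInfty : T.latInfty =
    Submodule.span (inftyRing m) (range fun k : K => (1 : PuncRing m) ⊗ₜ[BaseRing m] k)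
  nabla : ∀ X (k : K), T.nabla X (1 ⊗ₜ k) = 1 ⊗ₜ S.nabla X k + zPow m (-1) ⊗ₜ S.C X k
  nablaZ : ∀ k : K, T.nablaZ (1 ⊗ₜ k) = zPow m (-1) ⊗ₜ S.U k - 1 ⊗ₜ S.V k
    + algebraMap ℂ (PuncRing m) (w / 2 : ℂ) ⊗ₜ k
  P : ∀ k l : K, T.P (1 ⊗ₜ k) (1 ⊗ₜ l) = zPow m w * pull m (S.g k l)

end

end TrTLEP

/-! ### Isomorphism classes -/

/-- A Frobenius type structure together with its underlying bundle. -/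
structure FrobTypeObj.{u} (D : NormalCrossing m) where
  K : Type u
  [addCommGroup : AddCommGroup K]
  [module : Module (BaseRing m) K]
  str : FrobType D K

attribute [instance] FrobTypeObj.addCommGroup FrobTypeObj.module

/-- A `(logD-trTLEP(w))`-structure together with its underlying bundle. -/
structure TrTLEPObj.{u} (D : NormalCrossing m) (w : ℤ) where
  H : Type u
  [addCommGroup : AddCommGroup H]
  [module : Module (PuncRing m) H]
  str : TrTLEP D w H

attribute [instance] TrTLEPObj.addCommGroup TrTLEPObj.module

/-- Isomorphism classes of Frobenius type structures with logarithmic pole along `D`. -/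
def FrobTypeClass.{u} (D : NormalCrossing m) : Type (u + 1) :=
  Quot fun S S' : FrobTypeObj.{u} D => ∃ e, FrobType.IsIso S.str S'.str e

/-- Isomorphism classes of `(logD-trTLEP(w))`-structures. -/
def TrTLEPClass.{u} (D : NormalCrossing m) (w : ℤ) : Type (u + 1) :=
  Quot fun T T' : TrTLEPObj.{u} D w => ∃ e, TrTLEP.IsIso T.str T'.str e

/-- The isomorphism class of a Frobenius type structure. -/
def FrobType.cls.{u} {D : NormalCrossing m} {K : Type u} [AddCommGroup K]
    [Module (BaseRing m) K] (S : FrobType D K) : FrobTypeClass.{u} D := Quot.mk _ ⟨K, S⟩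

/-- The isomorphism class of a `(logD-trTLEP(w))`-structure. -/
def TrTLEP.cls.{u} {D : NormalCrossing m} {w : ℤ} {H : Type u} [AddCommGroup H]
    [Module (PuncRing m) H] (T : TrTLEP D w H) : TrTLEPClass.{u} D w := Quot.mk _ ⟨H, T⟩

end LogFrob

end

open LogFrob

universe u

/-!
A bundle `H` on `ℙ¹ × (M, 0)` that is trivial along `ℙ¹` is the pullback `π^* K` of a bundle `K` on
`(M, 0)`, and the sections of `K` are the global sections of `H`. The correspondence consists in
writing the structure of `H` in terms of these *constant* sections (`sec`).

By the theorem of Liouville with parameters (`exists_eq_pull`), a function that is holomorphic on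
`ℙ¹ × (M, 0)` comes from `(M, 0)`. Hence the global sections of `H` are precisely the constant
sections (`exists_eq_sec`), and a section that is holomorphic at `z = ∞` and has at most a simple
pole at `z = 0` is of the form `d + z⁻¹ c` with constant sections `c` and `d`
(`exists_eq_sec_add_zPow_smul_sec`). The pole conditions of a `(logD-trTLEP(w))`-structure therefore
say that on constant sections `∇_X = ∇ʳ_X + z⁻¹ C_X`, `∇_{z∂/∂z} = (w/2 - V) + z⁻¹ U` and
`P = z ^ w g`. Laurent polynomials in `z` with coefficients in `K` can be compared coefficient by
coefficient (`laurent_eq_zero`), and the coefficients of the equations of flatness, symmetry and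
compatibility of `∇` and `P` are exactly the equations of a Frobenius type structure. Read in one
direction this constructs a structure on `H` (`FrobType.toTrTLEP`), read in the other direction it
recovers the structure on `K` (`TrTLEP.exists_isExplicitAlong`). A connection or a pairing satisfies
an identity everywhere if it does so on constant sections, by the Leibniz rule and sesquilinearity.

The restriction of constant sections identifies `K` with `H|_{z = 0}` and with `H|_{z = ∞}`. This
uses that a holomorphic function that vanishes on `z = 0` is divisible by `z`
(`exists_analyticOnNhd_div`), which is proved with an explicit power series for the quotient.
Under the identification the coefficients of the expansions become the residues
(`TrTLEP.IsCanonicalTriv.isResidue_of_isExplicitAlong`). Finally, an isomorphism of bundles on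
`ℙ¹ × (M, 0)` maps global sections to global sections, so it is the pullback of an isomorphism of
bundles on `(M, 0)` (`exists_linearEquiv_sec`), and it respects the structures upstairs if and only
if it does so downstairs (`IsExplicitAlong.isIso_iff`).
-/

noncomputable section

namespace LogFrob

/-! ### Division of holomorphic functions by a coordinate -/

section Division

variable {E : Type*} [NormedAddCommGroup E] [NormedSpace ℂ E]

/-- The power series of the quotient `(f (y) - f (π y)) / ℓ (y)`, where `p` is a power series of `f`
and `y = π y + ℓ (y) • e`: replace the arguments of `p (n + 1)` by their projections one at a time,
and put `e` into the slot that changes. -/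
def quotSeries (p : FormalMultilinearSeries ℂ E ℂ) (π : E →L[ℂ] E) (e : E) :
    FormalMultilinearSeries ℂ E ℂ := fun n =>
  ∑ j : Fin (n + 1), ((p (n + 1)).curryMid j e).compContinuousLinearMap
    fun i : Fin n => if i.val < j.val then π else ContinuousLinearMap.id ℂ E

theorem smul_quotSeries_apply (p : FormalMultilinearSeries ℂ E ℂ) (π : E →L[ℂ] E) (e : E)
    (c : ℂ) (y : E) (hy : y = π y + c • e) (n : ℕ) :
    c * quotSeries p π e n (fun _ => y) =
      p (n + 1) (fun _ => y) - p (n + 1) (fun _ => π y) := by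
  -- the first `j` arguments are projected
  let h : ℕ → ℂ := fun j => p (n + 1) fun i => if i.val < j then π y else y
  have step : ∀ j : Fin (n + 1), c * (((p (n + 1)).curryMid j e).compContinuousLinearMap
      (fun i : Fin n => if i.val < j.val then π else ContinuousLinearMap.id ℂ E))
        (fun _ => y) = h j.val - h (j.val + 1) := by
    intro j
    rw [ContinuousMultilinearMap.compContinuousLinearMap_apply,
      ContinuousMultilinearMap.curryMid_apply]
    let v : Fin (n + 1) → E := fun i => if i.val < j.val then π y else y
    have e1 : j.insertNth e (fun i : Fin n =>
        (if i.val < j.val then π else ContinuousLinearMap.id ℂ E) y) = Function.update v j e := by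
      rw [Fin.insertNth_eq_iff]
      refine ⟨by simp, ?_⟩
      funext i
      simp only [Fin.removeNth, v]
      rw [Function.update_of_ne (Fin.succAbove_ne j i)]
      by_cases hij : i.val < j.val
      · rw [Fin.succAbove_of_castSucc_lt _ _ (by simpa [Fin.lt_def] using hij)]
        simp [hij]
      · rw [Fin.succAbove_of_le_castSucc _ _ (by simpa [Fin.le_def] using hij)]
        simp [hij, show ¬ i.val + 1 < j.val by omega]
    have e2 : (fun i : Fin (n + 1) => if i.val < j.val then π y else y) =
        Function.update v j y := by
      funext i
      by_cases hi : i = j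
      · subst hi; simp
      · rw [Function.update_of_ne hi]
    have e3 : (fun i : Fin (n + 1) => if i.val < j.val + 1 then π y else y) =
        Function.update v j (π y) := by
      funext i
      by_cases hi : i = j
      · subst hi; simp
      · rw [Function.update_of_ne hi]
        have : i.val ≠ j.val := fun h => hi (Fin.ext h)
        simp only [v]
        congr 1
        exact propext (by omega)
    simp only [h]
    rw [e1, e2, e3, ← ContinuousMultilinearMap.map_update_sub,
      show y - π y = c • e from sub_eq_iff_eq_add'.2 hy,
      ContinuousMultilinearMap.map_update_smul, smul_eq_mul]
  rw [quotSeries, _root_.sum_apply, Finset.mul_sum,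
    Finset.sum_congr rfl fun j _ => step j, Fin.sum_univ_eq_sum_range (fun j => h j - h (j + 1)),
    Finset.sum_range_sub']
  simp only [h]
  congr 2
  funext i
  simp [i.2]

theorem norm_quotSeries_le (p : FormalMultilinearSeries ℂ E ℂ) (π : E →L[ℂ] E) (hπ : ‖π‖ ≤ 1)
    (e : E) (n : ℕ) : ‖quotSeries p π e n‖ ≤ (n + 1) * (‖p (n + 1)‖ * ‖e‖) := by
  refine (norm_sum_le _ _).trans ((Finset.sum_le_card_nsmul _ _ (‖p (n + 1)‖ * ‖e‖) ?_).trans ?_)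
  · intro j _
    refine (ContinuousMultilinearMap.norm_compContinuousLinearMap_le _ _).trans ?_
    have h1 : ‖(p (n + 1)).curryMid j e‖ ≤ ‖p (n + 1)‖ * ‖e‖ := by
      refine (ContinuousLinearMap.le_opNorm _ _).trans ?_
      rw [ContinuousMultilinearMap.norm_curryMid]
    have h2 : ∏ i : Fin n, ‖if i.val < j.val then π else ContinuousLinearMap.id ℂ E‖ ≤ 1 := by
      refine Finset.prod_le_one (fun _ _ => norm_nonneg _) fun i _ => ?_
      split_ifs
      · exact hπ
      · exact ContinuousLinearMap.norm_id_le
    calc _ ≤ ‖p (n + 1)‖ * ‖e‖ * 1 := mul_le_mul h1 h2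
          (Finset.prod_nonneg fun _ _ => norm_nonneg _) (by positivity)
      _ = _ := mul_one _
  · simp

theorem quotSeries_radius_pos (p : FormalMultilinearSeries ℂ E ℂ) (hp : 0 < p.radius)
    (π : E →L[ℂ] E) (hπ : ‖π‖ ≤ 1) (e : E) : 0 < (quotSeries p π e).radius := by
  obtain ⟨C, r, hC, hr, hb⟩ := p.le_mul_pow_of_radius_pos hp
  -- the factor `2 ^ n` absorbs the number `n + 1` of summands of `quotSeries p π e n`
  let s : NNReal := ⟨(2 * r)⁻¹, by positivity⟩
  have hs : (0 : ENNReal) < s := by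
    rw [ENNReal.coe_pos, ← NNReal.coe_pos]
    change 0 < (2 * r)⁻¹
    positivity
  refine hs.trans_le ((quotSeries p π e).le_radius_of_bound (C * r * ‖e‖) fun n => ?_)
  have h2 : ((n : ℝ) + 1) ≤ 2 ^ n := by
    exact_mod_cast Nat.lt_two_pow_self (n := n)
  have hsn : (s : ℝ) ^ n = ((2 : ℝ) ^ n)⁻¹ * (r ^ n)⁻¹ := by
    change ((2 * r)⁻¹ : ℝ) ^ n = _
    rw [inv_pow, mul_pow, mul_inv]
  calc ‖quotSeries p π e n‖ * (s : ℝ) ^ n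
      ≤ 2 ^ n * (C * r ^ (n + 1) * ‖e‖) * (s : ℝ) ^ n := by
        gcongr
        refine (norm_quotSeries_le p π hπ e n).trans ?_
        gcongr
        exact hb (n + 1)
    _ = C * r * ‖e‖ := by
        rw [hsn, pow_succ]
        field_simp

/-- Local division: if `y = π y + ℓ (y) • e`, then `f (y) - f (π y)` is divisible by `ℓ (y)` in the
ring of germs of holomorphic functions at `0`. -/
theorem exists_analyticAt_mul_eq_sub {f : E → ℂ} (hf : AnalyticAt ℂ f 0) (π : E →L[ℂ] E)
    (hπ : ‖π‖ ≤ 1) (l : E → ℂ) (e : E) (hy : ∀ y, y = π y + l y • e) :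
    ∃ g : E → ℂ, AnalyticAt ℂ g 0 ∧ ∀ᶠ y in 𝓝 0, l y * g y = f y - f (π y) := by
  obtain ⟨p, R, hp⟩ := hf
  have hq := quotSeries_radius_pos p (hp.r_pos.trans_le hp.r_le) π hπ e
  refine ⟨(quotSeries p π e).sum, ((quotSeries p π e).hasFPowerSeriesOnBall hq).analyticAt, ?_⟩
  have hπ0 : Tendsto π (𝓝 0) (𝓝 0) := by simpa using π.continuous.tendsto 0
  filter_upwards [Metric.eball_mem_nhds (0 : E) hq, Metric.eball_mem_nhds (0 : E) hp.r_pos,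
    hπ0.eventually (Metric.eball_mem_nhds (0 : E) hp.r_pos)] with y h1 h2 h3
  have s1 := ((quotSeries p π e).hasSum h1).mul_left (l y)
  have s2 := (hp.hasSum h2).sub (hp.hasSum h3)
  rw [zero_add, zero_add] at s2
  simp only [smul_quotSeries_apply p π e (l y) y (hy y)] at s1
  have s3 := (hasSum_nat_add_iff' 1).2 s2
  have h0 : p 0 (fun _ => y) = p 0 (fun _ => π y) :=
    congrArg _ (Subsingleton.elim _ _)
  rw [Finset.sum_range_one, h0, sub_self, sub_zero] at s3
  exact s1.unique s3

end Division

/-! ### Functions on `ℂ × (M, 0)` and on `ℙ¹ × (M, 0)` -/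

variable {m : ℕ}

theorem mem_affineLine {p : ℂ × (Fin m → ℂ)} : p ∈ affineLine m ↔ p.2 = 0 := by
  simp [affineLine]

theorem mem_puncturedLine {p : ℂ × (Fin m → ℂ)} :
    p ∈ puncturedLine m ↔ p.1 ≠ 0 ∧ p.2 = 0 := by
  simp [puncturedLine]

/-- A function that is holomorphic near `ℂ × {0}` and vanishes on `{0} × (M, 0)` is divisible by
`z`. -/
theorem exists_analyticOnNhd_div {f : ℂ × (Fin m → ℂ) → ℂ}
    (hf : AnalyticOnNhd ℂ f (affineLine m)) :
    ∃ g : ℂ × (Fin m → ℂ) → ℂ, AnalyticOnNhd ℂ g (affineLine m) ∧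
      ∀ᶠ p in 𝓝ˢ (affineLine m), f p - f (0, p.2) = p.1 * g p := by
  let π : ℂ × (Fin m → ℂ) →L[ℂ] ℂ × (Fin m → ℂ) :=
    (ContinuousLinearMap.inr ℂ ℂ (Fin m → ℂ)).comp (ContinuousLinearMap.snd ℂ ℂ (Fin m → ℂ))
  have hπ : ‖π‖ ≤ 1 := by
    refine ContinuousLinearMap.opNorm_le_bound _ zero_le_one fun x => ?_
    rw [one_mul]
    simp only [π, ContinuousLinearMap.comp_apply, ContinuousLinearMap.coe_snd',
      ContinuousLinearMap.inr_apply, Prod.norm_def, norm_zero]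
    exact max_le (le_max_of_le_left (norm_nonneg _)) (le_max_right _ _)
  obtain ⟨g, hg, hfg⟩ := exists_analyticAt_mul_eq_sub
    (hf 0 (mem_affineLine.2 rfl)) π hπ Prod.fst ((1, 0) : ℂ × (Fin m → ℂ))
    (fun y => by ext <;> simp [π])
  have hfg' : ∀ᶠ p : ℂ × (Fin m → ℂ) in 𝓝 0, p.1 * g p = f p - f (0, p.2) := hfg
  classical
  let G : ℂ × (Fin m → ℂ) → ℂ := fun p => if p.1 = 0 then g p else (f p - f (0, p.2)) / p.1
  have hG : ∀ p : ℂ × (Fin m → ℂ), p.1 ≠ 0 → G p = (f p - f (0, p.2)) / p.1 :=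
    fun p hp => if_neg hp
  have hG0 : G =ᶠ[𝓝 0] g := by
    filter_upwards [hfg'] with p hp
    by_cases h : p.1 = 0
    · exact if_pos h
    · rw [hG p h, ← hp, mul_div_cancel_left₀ _ h]
  refine ⟨G, fun p hp => ?_, eventually_nhdsSet_iff_forall.2 fun p hp => ?_⟩
  · rw [mem_affineLine] at hp
    by_cases h : p.1 = 0
    · obtain rfl : p = 0 := Prod.ext h hp
      exact hg.congr hG0.symm
    · have h0 : AnalyticAt ℂ (fun q : ℂ × (Fin m → ℂ) => f (0, q.2)) p := by
        refine AnalyticAt.fun_comp (g := f) (hf (0, p.2) (mem_affineLine.2 hp)) ?_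
        exact analyticAt_const.prod analyticAt_snd
      refine (((hf p (mem_affineLine.2 hp)).sub h0).div analyticAt_fst h).congr ?_
      filter_upwards [continuousAt_fst.eventually_ne h] with q hq
      exact (hG q hq).symm
  · rw [mem_affineLine] at hp
    by_cases h : p.1 = 0
    · obtain rfl : p = 0 := Prod.ext h hp
      filter_upwards [hfg', hG0] with q hq hq'
      rw [hq', hq]
    · filter_upwards [continuousAt_fst.eventually_ne h] with q hq
      rw [hG q hq, mul_div_cancel₀ _ hq]

/-- A function that is holomorphic near `ℂ × {0}` and vanishes near `ℂ* × {0}` vanishes near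
`ℂ × {0}`. -/
theorem eventuallyEq_zero_of_puncturedLine {f : ℂ × (Fin m → ℂ) → ℂ}
    (hf : AnalyticOnNhd ℂ f (affineLine m)) (h : f =ᶠ[𝓝ˢ (puncturedLine m)] 0) :
    f =ᶠ[𝓝ˢ (affineLine m)] 0 := by
  refine eventually_nhdsSet_iff_forall.2 fun p hp => ?_
  rw [mem_affineLine] at hp
  have hpu : ∀ q : ℂ × (Fin m → ℂ), q.1 ≠ 0 → q.2 = 0 → f =ᶠ[𝓝 q] 0 := fun q h1 h2 =>
    eventually_nhdsSet_iff_forall.1 h q (mem_puncturedLine.2 ⟨h1, h2⟩)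
  by_cases h0 : p.1 = 0
  · obtain rfl : p = 0 := Prod.ext h0 hp
    obtain ⟨r, hr, hball⟩ := Metric.eventually_nhds_iff_ball.1
      (hf 0 (mem_affineLine.2 rfl)).eventually_analyticAt
    -- a point of the punctured line in the ball where `f` is holomorphic
    let q : ℂ × (Fin m → ℂ) := (((r / 2 : ℝ) : ℂ), 0)
    have hq : q ∈ Metric.ball (0 : ℂ × (Fin m → ℂ)) r := by
      rw [mem_ball_zero_iff, Prod.norm_def, norm_zero, Complex.norm_real, Real.norm_of_nonneg
        (by positivity)]
      exact max_lt (by linarith) hr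
    have hz := AnalyticOnNhd.eqOn_zero_of_preconnected_of_eventuallyEq_zero
      (U := Metric.ball (0 : ℂ × (Fin m → ℂ)) r) hball
      (convex_ball _ _).isPreconnected hq (hpu q (by simp [q, hr.ne']) rfl)
    exact hz.eventuallyEq_of_mem (Metric.ball_mem_nhds _ hr)
  · exact hpu p h0 hp

/-- The theorem of Liouville with parameters: if a holomorphic function near `ℂ × {0}` continues
holomorphically to a neighbourhood of `{∞} × {0}`, it does not depend on `z`. -/
theorem eventuallyEq_apply_zero_of_liouville {f g : ℂ × (Fin m → ℂ) → ℂ}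
    (hf : AnalyticOnNhd ℂ f (affineLine m)) (hg : AnalyticOnNhd ℂ g (affineLine m))
    (h : ∀ᶠ p in 𝓝ˢ (puncturedLine m), f p = g (p.1⁻¹, p.2)) :
    ∀ᶠ p in 𝓝ˢ (affineLine m), f p = f (0, p.2) := by
  refine eventually_nhdsSet_iff_forall.2 fun p hp => ?_
  rw [mem_affineLine] at hp
  obtain ⟨z₀, t₀⟩ := p
  obtain rfl : t₀ = 0 := hp
  let R : ℝ := ‖z₀‖ + 1
  have hR : 1 ≤ R := le_add_of_nonneg_left (norm_nonneg _)
  have swap : ∀ {P : ℂ × (Fin m → ℂ) → Prop} {z : ℂ}, (∀ᶠ p in 𝓝 (z, (0 : Fin m → ℂ)), P p) →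
      ∀ᶠ p in 𝓝 ((0 : Fin m → ℂ), z), P (p.2, p.1) := fun {P z} hP =>
    (continuous_swap.tendsto ((0 : Fin m → ℂ), z)).eventually hP
  have h1 : ∀ᶠ t in 𝓝 (0 : Fin m → ℂ), ∀ z ∈ Metric.closedBall (0 : ℂ) R,
      AnalyticAt ℂ f (z, t) :=
    (isCompact_closedBall _ _).eventually_forall_of_forall_eventually fun z _ =>
      swap (hf (z, 0) (mem_affineLine.2 rfl)).eventually_analyticAt
  have h2 : ∀ᶠ t in 𝓝 (0 : Fin m → ℂ), ∀ z ∈ Metric.closedBall (0 : ℂ) 2,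
      AnalyticAt ℂ g (z, t) :=
    (isCompact_closedBall _ _).eventually_forall_of_forall_eventually fun z _ =>
      swap (hg (z, 0) (mem_affineLine.2 rfl)).eventually_analyticAt
  have h3 : ∀ᶠ t in 𝓝 (0 : Fin m → ℂ), ∀ z ∈ Metric.closedBall (0 : ℂ) R \ Metric.ball 0 (1 / 2),
      f (z, t) = g (z⁻¹, t) := by
    refine ((isCompact_closedBall _ _).diff
      Metric.isOpen_ball).eventually_forall_of_forall_eventually fun z hz => ?_
    have hz0 : z ≠ 0 := by
      rintro rfl
      exact hz.2 (Metric.mem_ball_self (by norm_num))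
    exact swap (eventually_nhdsSet_iff_forall.1 h (z, 0) (mem_puncturedLine.2 ⟨hz0, rfl⟩))
  have key : ∀ᶠ t in 𝓝 (0 : Fin m → ℂ), ∀ z : ℂ, ‖z‖ < R → f (z, t) = f (0, t) := by
    filter_upwards [h1, h2, h3] with t ha hb hc
    have hfd : ∀ z : ℂ, ‖z‖ ≤ R → DifferentiableAt ℂ (fun z => f (z, t)) z := fun z hz =>
      ((ha z (mem_closedBall_zero_iff.2 hz)).comp₂ analyticAt_id
        analyticAt_const).differentiableAt
    have hgd : ∀ z : ℂ, ‖z‖ ≤ 2 → DifferentiableAt ℂ (fun z => g (z, t)) z := fun z hz =>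
      ((hb z (mem_closedBall_zero_iff.2 hz)).comp₂ analyticAt_id
        analyticAt_const).differentiableAt
    classical
    -- `f` and the continuation of `f` at infinity glue to an entire function
    let F : ℂ → ℂ := fun z => if ‖z‖ < R then f (z, t) else g (z⁻¹, t)
    have hFf : ∀ z, ‖z‖ < R → F z = f (z, t) := fun z hz => if_pos hz
    have hFg : ∀ z, 1 / 2 < ‖z‖ → F z = g (z⁻¹, t) := by
      intro z hz
      by_cases hzR : ‖z‖ < R
      · rw [hFf z hzR]
        exact hc z ⟨mem_closedBall_zero_iff.2 hzR.le, fun hm =>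
          absurd (mem_ball_zero_iff.1 hm) hz.not_gt⟩
      · exact if_neg hzR
    have hF : Differentiable ℂ F := by
      intro z
      by_cases hz : ‖z‖ < R
      · refine (hfd z hz.le).congr_of_eventuallyEq ?_
        filter_upwards [continuous_norm.continuousAt.eventually_lt continuousAt_const hz]
          with w hw using hFf w hw
      · have hz1 : 1 ≤ ‖z‖ := hR.trans (not_lt.1 hz)
        have hz0 : z ≠ 0 := norm_pos_iff.1 (zero_lt_one.trans_le hz1)
        have hinv : ‖z⁻¹‖ ≤ 2 := by
          rw [norm_inv]
          exact (inv_le_one_of_one_le₀ hz1).trans one_le_two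
        have hcomp : DifferentiableAt ℂ (fun z => g (z⁻¹, t)) z :=
          DifferentiableAt.comp (g := fun z => g (z, t)) z (hgd _ hinv)
            (differentiableAt_inv hz0)
        refine hcomp.congr_of_eventuallyEq ?_
        filter_upwards [continuousAt_const.eventually_lt continuous_norm.continuousAt
          (show (1 / 2 : ℝ) < ‖z‖ by linarith)] with w hw using hFg w hw
    have hlim : Tendsto F (cocompact ℂ) (𝓝 (g (0, t))) := by
      have h0 : Tendsto (fun z : ℂ => g (z⁻¹, t)) (cocompact ℂ) (𝓝 (g (0, t))) :=
        (hgd 0 (by simp)).continuousAt.tendsto.comp (Filter.tendsto_inv₀_cobounded.mono_left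
          (Metric.cobounded_eq_cocompact (α := ℂ)).ge)
      refine h0.congr' ?_
      filter_upwards [(tendsto_norm_cocompact_atTop (E := ℂ)).eventually_gt_atTop (1 / 2)]
        with z hz using (hFg z hz).symm
    have hconst := fun z => hF.apply_eq_of_tendsto_cocompact z hlim
    intro z hz
    rw [← hFf z hz, ← hFf 0 (by rw [norm_zero]; linarith), hconst, hconst]
  have hz : ∀ᶠ p in 𝓝 (z₀, (0 : Fin m → ℂ)), ‖p.1‖ < R :=
    (continuous_fst.norm).continuousAt.eventually_lt continuousAt_const
      (show ‖z₀‖ < R from lt_add_one _)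
  filter_upwards [hz, (continuous_snd.tendsto (z₀, (0 : Fin m → ℂ))).eventually key]
    with p hp1 hp2 using hp2 p.1 hp1

/-! ### The rings of functions on `ℂ* × (M, 0)`, `ℂ × (M, 0)` and `(ℙ¹ ∖ {0}) × (M, 0)` -/

section Rings

variable {m : ℕ}

theorem HolGerm.mk_eq_zero_iff {E : Type} [NormedAddCommGroup E] [NormedSpace ℂ E] {S : Set E}
    {f : holFun S} : HolGerm.mk S f = 0 ↔ (f : E → ℂ) =ᶠ[𝓝ˢ S] 0 :=
  Ideal.Quotient.eq_zero_iff_mem (I := nullFun S)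

/-- The coordinate of `ℂ`, as a function on `ℂ × (M, 0)`. -/
def lineCoord (m : ℕ) : HolGerm (affineLine m) :=
  HolGerm.of (fun p => p.1) (fun _ _ => analyticAt_fst)

/-- Restriction of functions on `ℂ × (M, 0)` to `{0} × (M, 0)`. -/
def atZero (m : ℕ) : HolGerm (affineLine m) →ₐ[ℂ] BaseRing m :=
  HolGerm.comap (fun t => ((0 : ℂ), t)) (fun _ _ => analyticAt_const.prod analyticAt_id)
    (fun _ ht => mem_affineLine.2 ht)

theorem atZero_pullLine (f : BaseRing m) : atZero m (pullLine m f) = f := by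
  obtain ⟨f, rfl⟩ := HolGerm.mk_surjective _ f
  rfl

theorem exists_eq_pullLine_add_mul (a : HolGerm (affineLine m)) :
    ∃ c, a = pullLine m (atZero m a) + lineCoord m * c := by
  obtain ⟨f, rfl⟩ := HolGerm.mk_surjective _ a
  obtain ⟨g, hg, h⟩ := exists_analyticOnNhd_div f.2
  refine ⟨HolGerm.of g hg, ?_⟩
  refine HolGerm.mk_eq_mk_iff.2 ?_
  filter_upwards [h] with p hp
  exact eq_add_of_sub_eq' hp

theorem atZero_lineCoord : atZero m (lineCoord m) = 0 :=
  map_zero (HolGerm.mk ({0} : Set (Fin m → ℂ)))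

theorem restrictZero_mk (f : holFun (affineLine m)) : restrictZero m (HolGerm.mk _ f) =
    HolGerm.mk _ (holFunComap (fun p => p) (fun _ _ => analyticAt_id)
      (fun _ hp => mem_affineLine.2 hp.2) f) := rfl

theorem restrictInfty_mk (f : holFun (affineLine m)) : restrictInfty m (HolGerm.mk _ f) =
    HolGerm.mk _ (holFunComap (fun p : ℂ × (Fin m → ℂ) => (p.1⁻¹, p.2))
      (fun p hp => (analyticOnNhd_inv_puncturedLine m p hp).prod analyticAt_snd)
      (fun _ hp => mem_affineLine.2 (mem_puncturedLine.1 hp).2) f) := rfl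

theorem restrictZero_injective : Function.Injective (restrictZero m) := by
  rw [injective_iff_map_eq_zero]
  intro a ha
  obtain ⟨f, rfl⟩ := HolGerm.mk_surjective _ a
  rw [restrictZero_mk, HolGerm.mk_eq_zero_iff] at ha
  rw [HolGerm.mk_eq_zero_iff]
  exact eventuallyEq_zero_of_puncturedLine f.2 ha

theorem restrictInfty_injective : Function.Injective (restrictInfty m) := by
  rw [injective_iff_map_eq_zero]
  intro a ha
  obtain ⟨f, rfl⟩ := HolGerm.mk_surjective _ a
  rw [restrictInfty_mk, HolGerm.mk_eq_zero_iff] at ha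
  rw [HolGerm.mk_eq_zero_iff]
  refine eventuallyEq_zero_of_puncturedLine f.2 ?_
  have h : ∀ᶠ p in 𝓝ˢ (puncturedLine m), (f : ℂ × (Fin m → ℂ) → ℂ) (p.1⁻¹, p.2) = 0 := ha
  have ht : Tendsto (fun p : ℂ × (Fin m → ℂ) => (p.1⁻¹, p.2)) (𝓝ˢ (puncturedLine m))
      (𝓝ˢ (puncturedLine m)) :=
    tendsto_nhdsSet_of_analytic
      (fun p hp => (analyticOnNhd_inv_puncturedLine m p hp).prod analyticAt_snd)
      (fun p hp => ⟨inv_ne_zero hp.1, hp.2⟩)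
  filter_upwards [ht.eventually h] with p hp
  simpa using hp

theorem mem_zeroRing {f : PuncRing m} : f ∈ zeroRing m ↔ ∃ a, restrictZero m a = f :=
  AlgHom.mem_range _

theorem mem_inftyRing {f : PuncRing m} : f ∈ inftyRing m ↔ ∃ a, restrictInfty m a = f :=
  AlgHom.mem_range _

/-- A function that is holomorphic on all of `ℙ¹ × (M, 0)` comes from `(M, 0)`. -/
theorem exists_eq_pull {a : PuncRing m} (h0 : a ∈ zeroRing m) (hinf : a ∈ inftyRing m) :
    ∃ r, a = pull m r := by
  obtain ⟨b, rfl⟩ := mem_zeroRing.1 h0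
  obtain ⟨c, hc⟩ := mem_inftyRing.1 hinf
  obtain ⟨f, rfl⟩ := HolGerm.mk_surjective _ b
  obtain ⟨g, rfl⟩ := HolGerm.mk_surjective _ c
  rw [restrictInfty_mk, restrictZero_mk] at hc
  refine ⟨atZero m (HolGerm.mk _ f), ?_⟩
  rw [← restrictZero_pullLine]
  refine congrArg (restrictZero m) (HolGerm.mk_eq_mk_iff.2 ?_)
  rw [HolGerm.mk_eq_mk_iff] at hc
  refine eventuallyEq_apply_zero_of_liouville f.2 g.2 ?_
  filter_upwards [hc] with p hp using hp.symm

theorem zPow_zero : zPow m 0 = 1 := by simp [zPow]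

theorem zPow_add (k l : ℤ) : zPow m (k + l) = zPow m k * zPow m l := by
  simp [zPow, zpow_add]

theorem zPow_mul_cancel {k l : ℤ} (h : k + l = 0) : zPow m k * zPow m l = 1 := by
  rw [← zPow_add, h, zPow_zero]

theorem restrictZero_lineCoord : restrictZero m (lineCoord m) = zPow m 1 := by
  rw [zPow, zpow_one]; rfl

theorem restrictInfty_lineCoord : restrictInfty m (lineCoord m) = zPow m (-1) := by
  rw [zPow, zpow_neg_one]; rfl

theorem pull_mem_zeroRing (r : BaseRing m) : pull m r ∈ zeroRing m :=
  ⟨pullLine m r, restrictZero_pullLine r⟩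

theorem pull_mem_inftyRing (r : BaseRing m) : pull m r ∈ inftyRing m :=
  ⟨pullLine m r, restrictInfty_pullLine r⟩

/-- The properties that the pairs `(zeroRing m, z)` and `(inftyRing m, 1/z)` have in common: `B`
consists of the functions that extend to a chart of `ℙ¹`, and `t` is the coordinate of this
chart. -/
structure IsChartRing (B : Subalgebra ℂ (PuncRing m)) (t : B) : Prop where
  pull_mem : ∀ r, pull m r ∈ B
  exists_eq : ∀ f ∈ B, ∃ r, ∃ c ∈ B, f = pull m r + t * c
  eq_zero : ∀ r, ∀ c ∈ B, pull m r = t * c → r = 0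
  lift_mem : ∀ (X : VecField m), ∀ f ∈ B, VecField.lift X f ∈ B
  zDz_mem : ∀ f ∈ B, zDz m f ∈ B
  negZ_mem : ∀ f ∈ B, negZ m f ∈ B

theorem VecField.lift_apply (X : VecField m) (f : PuncRing m) :
    VecField.lift X f = ∑ i, pull m (X i) * HolGerm.dir ((0, Pi.single i 1)) f := by
  have h := congrFun (map_sum (Derivation.coeFnAddMonoidHom (R := ℂ) (A := PuncRing m)
    (M := PuncRing m)) (fun i => pull m (X i) • HolGerm.dir ((0, Pi.single i 1))) Finset.univ) f
  rw [Finset.sum_apply] at h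
  exact h

theorem zDz_apply (f : PuncRing m) : zDz m f = zPow m 1 * HolGerm.dir (1, 0) f := rfl

/-- The chain rule for germs: if the differential of `φ` maps `v` to `c • u`, then
`∂_v (f ∘ φ) = c · (∂_u f) ∘ φ`. -/
theorem HolGerm.dir_comap {E F : Type} [NormedAddCommGroup E] [NormedSpace ℂ E]
    [NormedAddCommGroup F] [NormedSpace ℂ F] [CompleteSpace F] {S : Set E} {T : Set F} {φ : E → F}
    (hφ : AnalyticOnNhd ℂ φ S) (hm : MapsTo φ S T) {v : E} {u : F} (c : holFun S)
    (hv : ∀ᶠ y in 𝓝ˢ S, fderiv ℂ φ y v = (c : E → ℂ) y • u) (f : HolGerm T) :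
    HolGerm.dir v (HolGerm.comap φ hφ hm f) =
      HolGerm.mk S c * HolGerm.comap φ hφ hm (HolGerm.dir u f) := by
  obtain ⟨f, rfl⟩ := HolGerm.mk_surjective _ f
  have h1 : ∀ᶠ y in 𝓝ˢ S, AnalyticAt ℂ φ y :=
    eventually_nhdsSet_iff_forall.2 fun x hx => (hφ x hx).eventually_analyticAt
  have h2 := (tendsto_nhdsSet_of_analytic hφ hm).eventually (eventually_analyticAt_nhdsSet f)
  refine HolGerm.mk_eq_mk_iff.2 ?_
  filter_upwards [h1, h2, hv] with y hy1 hy2 hy3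
  change fderiv ℂ ((f : F → ℂ) ∘ φ) y v = (c : E → ℂ) y * fderiv ℂ (f : F → ℂ) (φ y) u
  rw [fderiv_comp y hy2.differentiableAt hy1.differentiableAt, ContinuousLinearMap.comp_apply,
    hy3, map_smul, smul_eq_mul]

theorem dir_restrictZero (v : ℂ × (Fin m → ℂ)) (f : HolGerm (affineLine m)) :
    HolGerm.dir v (restrictZero m f) = restrictZero m (HolGerm.dir v f) := by
  refine (HolGerm.dir_comap (u := v) _ _ 1 (Eventually.of_forall fun y => ?_) f).trans ?_
  · simp
  · rw [map_one, one_mul]; rfl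

theorem fderiv_mk_snd {g : ℂ → ℂ} {p v : ℂ × (Fin m → ℂ)} {g' : ℂ} (hg : HasDerivAt g g' p.1) :
    fderiv ℂ (fun p : ℂ × (Fin m → ℂ) => (g p.1, p.2)) p v = (v.1 * g', v.2) := by
  have h1 : HasFDerivAt (fun p : ℂ × (Fin m → ℂ) => g p.1) _ p :=
    hg.hasFDerivAt.comp p hasFDerivAt_fst
  rw [(h1.prodMk hasFDerivAt_snd).fderiv]
  simp

theorem dir_snd_restrictInfty (v : Fin m → ℂ) (f : HolGerm (affineLine m)) :
    HolGerm.dir (0, v) (restrictInfty m f) = restrictInfty m (HolGerm.dir (0, v) f) := by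
  refine (HolGerm.dir_comap (u := (0, v)) _ _ 1
    (eventually_nhdsSet_iff_forall.2 fun p hp => ?_) f).trans ?_
  · filter_upwards [continuousAt_fst.eventually_ne hp.1] with q hq
    rw [fderiv_mk_snd (hasDerivAt_inv hq)]
    simp
  · rw [map_one, one_mul]; rfl

theorem zDz_restrictInfty (f : HolGerm (affineLine m)) :
    zDz m (restrictInfty m f) = restrictInfty m (-(lineCoord m * HolGerm.dir (1, 0) f)) := by
  have h : HolGerm.dir (1, 0) (restrictInfty m f) =
      -(zPow m (-1) * zPow m (-1)) * restrictInfty m (HolGerm.dir (1, 0) f) := by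
    have hz : -(zPow m (-1) * zPow m (-1)) =
        HolGerm.mk (puncturedLine m) (-(⟨_, analyticOnNhd_inv_puncturedLine m⟩ *
          ⟨_, analyticOnNhd_inv_puncturedLine m⟩)) := by
      rw [map_neg, map_mul, zPow, zpow_neg_one]
      rfl
    rw [hz]
    refine HolGerm.dir_comap (u := (1, 0)) _ _ _
      (eventually_nhdsSet_iff_forall.2 fun p hp => ?_) f
    filter_upwards [continuousAt_fst.eventually_ne hp.1] with q hq
    rw [fderiv_mk_snd (hasDerivAt_inv hq)]
    change _ = (-(q.1⁻¹ * q.1⁻¹)) • ((1 : ℂ), (0 : Fin m → ℂ))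
    ext <;> simp [sq]
  rw [zDz_apply, h, map_neg, map_mul, restrictInfty_lineCoord]
  linear_combination (-zPow m (-1) * restrictInfty m (HolGerm.dir (1, 0) f)) *
    zPow_mul_cancel (m := m) (add_neg_cancel 1)

theorem dir_snd_negZ (v : Fin m → ℂ) (f : PuncRing m) :
    HolGerm.dir (0, v) (negZ m f) = negZ m (HolGerm.dir (0, v) f) := by
  refine (HolGerm.dir_comap (u := (0, v)) _ _ 1 (Eventually.of_forall fun p => ?_) f).trans ?_
  · rw [fderiv_mk_snd (hasDerivAt_neg _)]
    simp
  · rw [map_one, one_mul]; rfl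

theorem dir_fst_negZ (f : PuncRing m) :
    HolGerm.dir (1, 0) (negZ m f) = -negZ m (HolGerm.dir (1, 0) f) := by
  refine (HolGerm.dir_comap (u := (1, 0)) _ _ (-1) (Eventually.of_forall fun p => ?_) f).trans ?_
  · rw [fderiv_mk_snd (hasDerivAt_neg _)]
    change _ = (-1 : ℂ) • ((1 : ℂ), (0 : Fin m → ℂ))
    ext <;> simp
  · rw [map_neg, map_one, neg_one_mul]; rfl

theorem dir_pull (v : ℂ × (Fin m → ℂ)) (f : BaseRing m) :
    HolGerm.dir v (pull m f) = pull m (HolGerm.dir v.2 f) := by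
  refine (HolGerm.dir_comap (u := v.2) _ _ 1 (Eventually.of_forall fun p => ?_) f).trans ?_
  · rw [fderiv_snd]
    simp
  · rw [map_one, one_mul]; rfl

theorem negZ_pull (f : BaseRing m) : negZ m (pull m f) = pull m f := by
  obtain ⟨f, rfl⟩ := HolGerm.mk_surjective _ f
  rfl

theorem negZ_negZ (f : PuncRing m) : negZ m (negZ m f) = f := by
  obtain ⟨f, rfl⟩ := HolGerm.mk_surjective _ f
  refine congrArg (HolGerm.mk _) (Subtype.ext (funext fun p => ?_))
  change (f : ℂ × (Fin m → ℂ) → ℂ) (- -p.1, p.2) = _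
  rw [neg_neg]

theorem negZ_zPow_one : negZ m (zPow m 1) = -zPow m 1 := by
  rw [zPow, zpow_one, zUnit]
  exact map_neg (HolGerm.mk (puncturedLine m)) ⟨fun p => p.1, fun _ _ => analyticAt_fst⟩

theorem negZ_zPow (k : ℤ) : negZ m (zPow m k) = (-1 : ℂ) ^ k • zPow m k := by
  have hs : ∀ k : ℤ, negZ m (zPow m (k + 1)) = -(negZ m (zPow m k) * zPow m 1) := fun k => by
    rw [zPow_add, map_mul, negZ_zPow_one, mul_neg]
  have hz : ∀ k : ℤ, (-1 : ℂ) ^ (k + 1) = -(-1 : ℂ) ^ k := fun k => by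
    rw [zpow_add₀ (by norm_num), zpow_one, mul_neg_one]
  induction k with
  | zero => simp [zPow_zero]
  | succ k ih => rw [hs, ih, hz, zPow_add, neg_smul, smul_mul_assoc]
  | pred k ih =>
    have h1 := hs (-(k : ℤ) - 1)
    have h2 := hz (-(k : ℤ) - 1)
    have h3 := zPow_add (m := m) (-(k : ℤ) - 1) 1
    rw [sub_add_cancel] at h1 h2 h3
    rw [ih, h2, neg_smul, h3, neg_inj, ← smul_mul_assoc] at h1
    have hu : IsUnit (zPow m 1) := Units.isUnit _
    exact (hu.mul_right_cancel h1).symm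

theorem lift_pull (X : VecField m) (f : BaseRing m) :
    VecField.lift X (pull m f) = pull m (VecField.act X f) := by
  simp only [VecField.lift_apply, VecField.act_apply, dir_pull, map_sum, map_mul]

theorem zDz_pull (f : BaseRing m) : zDz m (pull m f) = 0 := by
  have h : HolGerm.dir (0 : Fin m → ℂ) f = 0 := by
    obtain ⟨f, rfl⟩ := HolGerm.mk_surjective _ f
    rw [HolGerm.dir_mk, ← map_zero (HolGerm.mk ({0} : Set (Fin m → ℂ)))]
    refine congrArg (HolGerm.mk _) (Subtype.ext (funext fun p => ?_))
    exact map_zero (fderiv ℂ (f : (Fin m → ℂ) → ℂ) p)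
  rw [zDz_apply, dir_pull, h, map_zero, mul_zero]

theorem lift_negZ (X : VecField m) (f : PuncRing m) :
    VecField.lift X (negZ m f) = negZ m (VecField.lift X f) := by
  simp only [VecField.lift_apply, map_sum, map_mul, negZ_pull, dir_snd_negZ]

theorem zDz_negZ (f : PuncRing m) : zDz m (negZ m f) = negZ m (zDz m f) := by
  simp only [zDz_apply, map_mul, negZ_zPow_one, dir_fst_negZ, neg_mul, mul_neg]

theorem dir_zPow_one (v : ℂ × (Fin m → ℂ)) :
    HolGerm.dir v (zPow m 1) = algebraMap ℂ (PuncRing m) v.1 := by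
  rw [zPow, zpow_one]
  refine congrArg (HolGerm.mk _) (Subtype.ext (funext fun p => ?_))
  change fderiv ℂ Prod.fst p v = v.1
  rw [fderiv_fst]; rfl

theorem derivation_zPow (δ : Derivation ℂ (PuncRing m) (PuncRing m)) {c : ℤ}
    (h : δ (zPow m 1) = c * zPow m 1) (k : ℤ) : δ (zPow m k) = (k * c) * zPow m k := by
  have hs : ∀ k : ℤ, δ (zPow m (k + 1)) = (δ (zPow m k) + c * zPow m k) * zPow m 1 := fun k => by
    rw [zPow_add, Derivation.leibniz, h, smul_eq_mul, smul_eq_mul]; ring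
  induction k with
  | zero => simp [zPow_zero]
  | succ k ih => rw [hs, ih, zPow_add]; push_cast; ring
  | pred k ih =>
    have h1 := hs (-(k : ℤ) - 1)
    have h3 := zPow_add (m := m) (-(k : ℤ) - 1) 1
    rw [sub_add_cancel] at h1 h3
    rw [ih, h3, ← mul_assoc] at h1
    have h4 := (Units.isUnit (zUnit m ^ (1 : ℤ))).mul_right_cancel h1
    push_cast at h4 ⊢
    linear_combination -h4

theorem lift_zPow (X : VecField m) (k : ℤ) : VecField.lift X (zPow m k) = 0 := by
  rw [derivation_zPow (c := 0), Int.cast_zero, mul_zero, zero_mul]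
  simp only [VecField.lift_apply, dir_zPow_one, map_zero, mul_zero, Finset.sum_const_zero,
    Int.cast_zero, zero_mul]

theorem zDz_zPow (k : ℤ) : zDz m (zPow m k) = k * zPow m k := by
  rw [derivation_zPow (c := 1), Int.cast_one, mul_one]
  rw [zDz_apply, dir_zPow_one, map_one, Int.cast_one, mul_one, one_mul]

theorem zDz_restrictZero (f : HolGerm (affineLine m)) :
    zDz m (restrictZero m f) = restrictZero m (lineCoord m * HolGerm.dir (1, 0) f) := by
  rw [zDz_apply, dir_restrictZero, map_mul, restrictZero_lineCoord]

theorem isChartRing_zeroRing : IsChartRing (zeroRing m) (zAtZero m) where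
  pull_mem := pull_mem_zeroRing
  exists_eq := by
    intro _ hf
    obtain ⟨a, rfl⟩ := mem_zeroRing.1 hf
    obtain ⟨c, hc⟩ := exists_eq_pullLine_add_mul a
    refine ⟨atZero m a, restrictZero m c, ⟨c, rfl⟩, (congrArg (restrictZero m) hc).trans ?_⟩
    rw [map_add, map_mul, restrictZero_lineCoord, restrictZero_pullLine]; rfl
  eq_zero := by
    intro r _ hf h
    obtain ⟨c, rfl⟩ := mem_zeroRing.1 hf
    have h' : restrictZero m (pullLine m r) = restrictZero m (lineCoord m * c) := by
      rw [restrictZero_pullLine, h, map_mul, restrictZero_lineCoord]; rfl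
    rw [← atZero_pullLine r, restrictZero_injective h', map_mul, atZero_lineCoord, zero_mul]
  lift_mem := by
    intro X _ hf
    obtain ⟨a, rfl⟩ := mem_zeroRing.1 hf
    rw [VecField.lift_apply]
    refine Subalgebra.sum_mem _ fun i _ => Subalgebra.mul_mem _ (pull_mem_zeroRing _) ?_
    rw [dir_restrictZero]
    exact ⟨_, rfl⟩
  zDz_mem := by
    intro _ hf
    obtain ⟨a, rfl⟩ := mem_zeroRing.1 hf
    exact ⟨_, (zDz_restrictZero a).symm⟩
  negZ_mem := by
    intro _ hf
    obtain ⟨a, rfl⟩ := mem_zeroRing.1 hf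
    refine mem_zeroRing.2 ⟨HolGerm.comap (fun p => (-p.1, p.2))
      (fun _ _ => analyticAt_fst.neg.prod analyticAt_snd)
      (fun _ hp => mem_affineLine.2 hp.2) a, ?_⟩
    obtain ⟨f, rfl⟩ := HolGerm.mk_surjective _ a
    rfl

theorem isChartRing_inftyRing : IsChartRing (inftyRing m) (zInvAtInfty m) where
  pull_mem := pull_mem_inftyRing
  exists_eq := by
    intro _ hf
    obtain ⟨a, rfl⟩ := mem_inftyRing.1 hf
    obtain ⟨c, hc⟩ := exists_eq_pullLine_add_mul a
    refine ⟨atZero m a, restrictInfty m c, ⟨c, rfl⟩, (congrArg (restrictInfty m) hc).trans ?_⟩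
    rw [map_add, map_mul, restrictInfty_lineCoord, restrictInfty_pullLine]; rfl
  eq_zero := by
    intro r _ hf h
    obtain ⟨c, rfl⟩ := mem_inftyRing.1 hf
    have h' : restrictInfty m (pullLine m r) = restrictInfty m (lineCoord m * c) := by
      rw [restrictInfty_pullLine, h, map_mul, restrictInfty_lineCoord]; rfl
    rw [← atZero_pullLine r, restrictInfty_injective h', map_mul, atZero_lineCoord, zero_mul]
  lift_mem := by
    intro X _ hf
    obtain ⟨a, rfl⟩ := mem_inftyRing.1 hf
    rw [VecField.lift_apply]
    refine Subalgebra.sum_mem _ fun i _ => Subalgebra.mul_mem _ (pull_mem_inftyRing _) ?_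
    rw [dir_snd_restrictInfty]
    exact ⟨_, rfl⟩
  zDz_mem := by
    intro _ hf
    obtain ⟨a, rfl⟩ := mem_inftyRing.1 hf
    exact ⟨_, (zDz_restrictInfty a).symm⟩
  negZ_mem := by
    intro _ hf
    obtain ⟨a, rfl⟩ := mem_inftyRing.1 hf
    refine mem_inftyRing.2 ⟨HolGerm.comap (fun p => (-p.1, p.2))
      (fun _ _ => analyticAt_fst.neg.prod analyticAt_snd)
      (fun _ hp => mem_affineLine.2 hp.2) a, ?_⟩
    obtain ⟨f, rfl⟩ := HolGerm.mk_surjective _ a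
    refine congrArg (HolGerm.mk _) (Subtype.ext (funext fun p => ?_))
    change (f : ℂ × (Fin m → ℂ) → ℂ) (-p.1⁻¹, p.2) = (f : ℂ × (Fin m → ℂ) → ℂ) ((-p.1)⁻¹, p.2)
    rw [inv_neg]

theorem pull_injective : Function.Injective (pull m) := by
  rw [injective_iff_map_eq_zero]
  intro r hr
  exact isChartRing_zeroRing.eq_zero r 0 (zero_mem _) (by rw [hr, mul_zero])

end Rings

/-! ### Constant sections of a trivialised bundle -/

section Sections

variable {m : ℕ} {K : Type*} [AddCommGroup K] [Module (BaseRing m) K]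
  {H : Type*} [AddCommGroup H] [Module (PuncRing m) H]

theorem algebraMap_eq_pull (r : BaseRing m) : algebraMap (BaseRing m) (PuncRing m) r = pull m r :=
  rfl

theorem smul_eq_pull_mul (r : BaseRing m) (f : PuncRing m) : r • f = pull m r * f := rfl

/-- The section of `H` that corresponds to the pullback of a section `k` of `K` under an
isomorphism `E : π^* K ≅ H`. -/
def sec (E : PuncRing m ⊗[BaseRing m] K ≃ₗ[PuncRing m] H) : K →+ H :=
  E.toLinearMap.toAddMonoidHom.comp (TensorProduct.mk (BaseRing m) (PuncRing m) K 1).toAddMonoidHom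

variable (E : PuncRing m ⊗[BaseRing m] K ≃ₗ[PuncRing m] H)

theorem sec_apply (k : K) : sec E k = E (1 ⊗ₜ k) := rfl

theorem apply_tmul (f : PuncRing m) (k : K) : E (f ⊗ₜ k) = f • sec E k := by
  rw [sec_apply, ← map_smul, TensorProduct.smul_tmul', smul_eq_mul, mul_one]

theorem sec_smul (r : BaseRing m) (k : K) : sec E (r • k) = pull m r • sec E k := by
  rw [sec_apply, ← TensorProduct.smul_tmul, smul_eq_pull_mul, mul_one, apply_tmul]

theorem sec_induction {p : H → Prop} (hadd : ∀ x y, p x → p y → p (x + y))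
    (hsec : ∀ (f : PuncRing m) k, p (f • sec E k)) (h : H) : p h := by
  obtain ⟨x, rfl⟩ := E.surjective h
  induction x with
  | zero => simpa using hsec 0 0
  | tmul f k => rw [apply_tmul]; exact hsec f k
  | add x y hx hy => rw [map_add]; exact hadd _ _ hx hy

/-- The sections of `H ≅ π^* K` that extend over a chart of `ℙ¹` with ring of functions `B`. -/
def lattice (B : Subalgebra ℂ (PuncRing m)) : Submodule B H := Submodule.span B (range (sec E))

variable {E} in
theorem sec_mem_lattice (B : Subalgebra ℂ (PuncRing m)) (k : K) : sec E k ∈ lattice E B :=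
  Submodule.subset_span ⟨k, rfl⟩

variable {E} in
theorem smul_mem_lattice {B : Subalgebra ℂ (PuncRing m)} {f : PuncRing m} (hf : f ∈ B) {x : H}
    (hx : x ∈ lattice E B) : f • x ∈ lattice E B :=
  (lattice E B).smul_mem ⟨f, hf⟩ hx

variable {E} in
theorem lattice_induction {B : Subalgebra ℂ (PuncRing m)} {p : (h : H) → h ∈ lattice E B → Prop}
    (hadd : ∀ x y hx hy, p x hx → p y hy → p (x + y) (add_mem hx hy))
    (hsec : ∀ f (hf : f ∈ B) k, p (f • sec E k) (smul_mem_lattice hf (sec_mem_lattice B k)))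
    {h : H} (hh : h ∈ lattice E B) : p h hh := by
  refine Submodule.closure_induction (p := p) ?_ hadd ?_ hh
  · have h0 := hsec 0 (zero_mem _) 0
    simp only [zero_smul] at h0
    exact h0
  · rintro f _ ⟨k, rfl⟩
    exact hsec f f.2 k

/-- The extension of a linear functional on `K` to `H ≅ π^* K`. -/
def extDual (ψ : K →ₗ[BaseRing m] BaseRing m) : H →ₗ[PuncRing m] PuncRing m :=
  (((Algebra.linearMap (BaseRing m) (PuncRing m)).comp ψ).liftBaseChange (PuncRing m)).comp
    E.symm.toLinearMap

theorem extDual_sec (ψ : K →ₗ[BaseRing m] BaseRing m) (k : K) :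
    extDual E ψ (sec E k) = pull m (ψ k) := by
  simp [extDual, sec_apply, algebraMap_eq_pull]

theorem extDual_mem {B : Subalgebra ℂ (PuncRing m)} (hB : ∀ r, pull m r ∈ B)
    (ψ : K →ₗ[BaseRing m] BaseRing m) {x : H} (hx : x ∈ lattice E B) : extDual E ψ x ∈ B := by
  induction hx using lattice_induction with
  | hadd x y _ _ hx hy => rw [map_add]; exact add_mem hx hy
  | hsec f hf k =>
    rw [map_smul, extDual_sec]
    exact mul_mem hf (hB _)

theorem sum_extDual_smul_sec {ι : Type*} [Fintype ι] (b : Module.Basis ι (BaseRing m) K) (h : H) :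
    ∑ i, extDual E (b.coord i) h • sec E (b i) = h := by
  induction h using sec_induction E with
  | hadd x y hx hy =>
    simp only [map_add, add_smul, Finset.sum_add_distrib]
    rw [hx, hy]
  | hsec f k =>
    simp only [map_smul, extDual_sec, smul_assoc, ← Finset.smul_sum, ← sec_smul, ← map_sum]
    congr 2
    exact b.sum_repr k

theorem eq_zero_of_extDual [Module.Free (BaseRing m) K] [Module.Finite (BaseRing m) K] {h : H}
    (hh : ∀ ψ : K →ₗ[BaseRing m] BaseRing m, extDual E ψ h = 0) : h = 0 := by
  rw [← sum_extDual_smul_sec E (Module.Free.chooseBasis (BaseRing m) K) h]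
  simp [hh]

section Chart

variable {B : Subalgebra ℂ (PuncRing m)} {t : B}

/-- Every section over a chart has the same value at the origin of the chart as a constant
section. -/
theorem exists_eq_sec_add_smul (hB : IsChartRing B t) {x : H} (hx : x ∈ lattice E B) :
    ∃ k, ∃ y ∈ lattice E B, x = sec E k + (t : PuncRing m) • y := by
  induction hx using lattice_induction with
  | hadd x y _ _ hx hy =>
    obtain ⟨k, x', hx', rfl⟩ := hx
    obtain ⟨l, y', hy', rfl⟩ := hy
    refine ⟨k + l, x' + y', add_mem hx' hy', ?_⟩
    rw [map_add, smul_add]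
    abel
  | hsec f hf k =>
    obtain ⟨r, c, hc, rfl⟩ := hB.exists_eq f hf
    exact ⟨r • k, c • sec E k, smul_mem_lattice hc (sec_mem_lattice B k), by
      rw [sec_smul, add_smul, mul_smul]⟩

/-- A constant section that vanishes at the origin of a chart is zero. -/
theorem eq_zero_of_sec_eq_smul (hB : IsChartRing B t) [Module.Free (BaseRing m) K] {k : K}
    {y : H} (hy : y ∈ lattice E B) (h : sec E k = (t : PuncRing m) • y) : k = 0 := by
  refine (Module.forall_dual_apply_eq_zero_iff (BaseRing m) k).1 fun ψ => ?_
  refine hB.eq_zero _ (extDual E ψ y) (extDual_mem E hB.pull_mem ψ hy) ?_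
  rw [← extDual_sec E, h, map_smul, smul_eq_mul]

end Chart

/-- The global sections of `H ≅ π^* K` are the pullbacks of the sections of `K`. -/
theorem exists_eq_sec [Module.Free (BaseRing m) K] [Module.Finite (BaseRing m) K] {h : H}
    (h0 : h ∈ lattice E (zeroRing m)) (hinf : h ∈ lattice E (inftyRing m)) :
    ∃ k, h = sec E k := by
  let b := Module.Free.chooseBasis (BaseRing m) K
  choose r hr using fun i => exists_eq_pull (extDual_mem E pull_mem_zeroRing (b.coord i) h0)
    (extDual_mem E pull_mem_inftyRing (b.coord i) hinf)
  refine ⟨∑ i, r i • b i, ?_⟩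
  rw [map_sum, ← sum_extDual_smul_sec E b h]
  exact Finset.sum_congr rfl fun i _ => by rw [hr, sec_smul]

variable {E}

theorem coe_zAtZero : (zAtZero m : PuncRing m) = zPow m 1 := rfl

theorem zPow_one_mem : zPow m 1 ∈ zeroRing m := (zAtZero m).2

theorem zPow_neg_one_mem : zPow m (-1) ∈ inftyRing m := (zInvAtInfty m).2

theorem zPow_smul_smul (k l : ℤ) (x : H) : zPow m k • zPow m l • x = zPow m (k + l) • x := by
  rw [zPow_add, mul_smul]

/-- A Laurent polynomial in `z` with coefficients in `K` that vanishes has vanishing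
coefficients. -/
theorem laurent_eq_zero [Module.Free (BaseRing m) K] {a b c : K}
    (h : sec E a + zPow m (-1) • sec E b + zPow m (-2) • sec E c = 0) :
    a = 0 ∧ b = 0 ∧ c = 0 := by
  have key : ∀ (k : K) (y : H), y ∈ lattice E (zeroRing m) → sec E k + zPow m 1 • y = 0 →
      k = 0 := fun k y hy hk =>
    eq_zero_of_sec_eq_smul E isChartRing_zeroRing (neg_mem hy)
      (by rw [smul_neg, coe_zAtZero]; exact eq_neg_of_add_eq_zero_left hk)
  have hs := fun k => sec_mem_lattice (E := E) (zeroRing m) k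
  have hc : c = 0 := by
    refine key c (sec E b + zPow m 1 • sec E a)
      (add_mem (hs b) (smul_mem_lattice zPow_one_mem (hs a))) ?_
    have h2 := congrArg (zPow m 2 • ·) h
    simp only [smul_add, zPow_smul_smul, smul_zero] at h2 ⊢
    norm_num [zPow_zero] at h2 ⊢
    rw [← h2]; abel
  subst hc
  have hb : b = 0 := by
    refine key b (sec E a) (hs a) ?_
    have h2 := congrArg (zPow m 1 • ·) h
    simp only [smul_add, zPow_smul_smul, smul_zero, map_zero] at h2 ⊢
    norm_num [zPow_zero] at h2 ⊢
    rw [← h2]; abel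
  subst hb
  refine ⟨key a 0 (zero_mem _) ?_, rfl, rfl⟩
  simpa using h

theorem sec_injective [Module.Free (BaseRing m) K] : Function.Injective (sec E) := by
  rw [injective_iff_map_eq_zero]
  intro k hk
  exact (laurent_eq_zero (E := E) (a := k) (b := 0) (c := 0) (by simp [hk])).1

theorem laurent_ext [Module.Free (BaseRing m) K] {d c d' c' : K}
    (h : sec E d + zPow m (-1) • sec E c = sec E d' + zPow m (-1) • sec E c') :
    d = d' ∧ c = c' := by
  have h2 := laurent_eq_zero (E := E) (a := d - d') (b := c - c') (c := 0) (by
    rw [map_sub, map_sub, map_zero, smul_zero, add_zero, smul_sub, sub_add_sub_comm, h, sub_self])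
  exact ⟨sub_eq_zero.1 h2.1, sub_eq_zero.1 h2.2.1⟩

/-- A section that is holomorphic at infinity and has at most a simple pole at zero is of the form
`d + z⁻¹ c`. -/
theorem exists_eq_sec_add_zPow_smul_sec [Module.Free (BaseRing m) K]
    [Module.Finite (BaseRing m) K] {h : H} (h0 : zPow m 1 • h ∈ lattice E (zeroRing m))
    (hinf : h ∈ lattice E (inftyRing m)) :
    ∃ p : K × K, h = sec E p.1 + zPow m (-1) • sec E p.2 := by
  obtain ⟨c, y, hy, hc⟩ := exists_eq_sec_add_smul E isChartRing_zeroRing h0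
  have hy' : h = y + zPow m (-1) • sec E c := by
    have h2 := congrArg (zPow m (-1) • ·) hc
    simp only [coe_zAtZero, smul_add, zPow_smul_smul] at h2
    norm_num [zPow_zero] at h2
    rw [h2]; abel
  obtain ⟨d, hd⟩ := exists_eq_sec E hy (by
    rw [eq_sub_of_add_eq hy'.symm]
    exact sub_mem hinf (smul_mem_lattice zPow_neg_one_mem (sec_mem_lattice _ c)))
  exact ⟨(d, c), by rw [hy', hd]⟩

end Sections

/-! ### Connections and pairings on a trivialised bundle -/

section Connections

variable {m : ℕ} {K : Type*} [AddCommGroup K] [Module (BaseRing m) K]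
  {H : Type*} [AddCommGroup H] [Module (PuncRing m) H]

/-- `D` is a covariant derivative on `H` in the direction of `δ`. -/
structure IsConnOver (δ : Derivation ℂ (PuncRing m) (PuncRing m)) (D : H → H) : Prop where
  add : ∀ a b, D (a + b) = D a + D b
  leibniz : ∀ (f : PuncRing m) a, D (f • a) = δ f • a + f • D a

variable {E : PuncRing m ⊗[BaseRing m] K ≃ₗ[PuncRing m] H}
  {δ δ' : Derivation ℂ (PuncRing m) (PuncRing m)} {D D' : H → H}

theorem IsConnOver.congr (h : IsConnOver δ D) (hδ : ∀ f, δ f = δ' f) : IsConnOver δ' D :=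
  ⟨h.add, fun f a => by rw [h.leibniz, hδ]⟩

/-- A covariant derivative is determined by its values on constant sections. -/
theorem IsConnOver.ext (h : IsConnOver δ D) (h' : IsConnOver δ D')
    (hD : ∀ k, D (sec E k) = D' (sec E k)) (x : H) : D x = D' x := by
  induction x using sec_induction E with
  | hadd x y hx hy => rw [h.add, h'.add, hx, hy]
  | hsec f k => rw [h.leibniz, h'.leibniz, hD]

theorem IsConnOver.commutator (h : IsConnOver δ D) (h' : IsConnOver δ' D') :
    IsConnOver ⁅δ, δ'⁆ fun x => D (D' x) - D' (D x) where
  add a b := by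
    rw [h'.add, h.add, h.add, h'.add]; abel
  leibniz f a := by
    rw [h'.leibniz, h.leibniz, h.add, h'.add, h.leibniz, h.leibniz, h'.leibniz, h'.leibniz,
      Derivation.commutator_apply]
    module

theorem IsConnOver.sum_add (h : IsConnOver δ D) (h' : IsConnOver δ' D') :
    IsConnOver (δ + δ') fun x => D x + D' x where
  add a b := by rw [h.add, h'.add]; abel
  leibniz f a := by
    rw [h.leibniz, h'.leibniz, Derivation.add_apply]
    module

/-- A bound for the pole of a covariant derivative may be checked on constant sections. -/
theorem IsConnOver.smul_mem {B : Subalgebra ℂ (PuncRing m)} (h : IsConnOver δ D) (u : PuncRing m)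
    (hu : u ∈ B) (hδ : ∀ f ∈ B, δ f ∈ B) (hs : ∀ k, u • D (sec E k) ∈ lattice E B) {x : H}
    (hx : x ∈ lattice E B) : u • D x ∈ lattice E B := by
  induction hx using lattice_induction with
  | hadd x y _ _ hx hy => rw [h.add, smul_add]; exact add_mem hx hy
  | hsec f hf k =>
    rw [h.leibniz, smul_add, smul_comm u f]
    exact add_mem (smul_mem_lattice hu (smul_mem_lattice (hδ f hf) (sec_mem_lattice B k)))
      (smul_mem_lattice hf (hs k))

/-- The covariant derivative on `π^* K` with given values on the constant sections. -/
def extConn (δ : Derivation ℂ (PuncRing m) (PuncRing m))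
    (N : K →+ PuncRing m ⊗[BaseRing m] K)
    (hN : ∀ (r : BaseRing m) k, N (r • k) = δ (pull m r) ⊗ₜ k + pull m r • N k) :
    PuncRing m ⊗[BaseRing m] K →+ PuncRing m ⊗[BaseRing m] K :=
  TensorProduct.liftAddHom
    { toFun := fun f =>
        { toFun := fun k => δ f ⊗ₜ k + f • N k
          map_zero' := by simp
          map_add' := fun k l => by rw [TensorProduct.tmul_add, map_add, smul_add]; abel }
      map_zero' := by ext; simp
      map_add' := fun f g => by
        ext k
        simp only [AddMonoidHom.coe_mk, ZeroHom.coe_mk, AddMonoidHom.add_apply, map_add,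
          TensorProduct.add_tmul, add_smul]
        abel }
    (fun r f k => by
      simp only [AddMonoidHom.coe_mk, ZeroHom.coe_mk]
      rw [hN, smul_eq_pull_mul, Derivation.leibniz, TensorProduct.add_tmul, smul_eq_mul,
        smul_eq_mul, ← TensorProduct.smul_tmul, smul_eq_pull_mul, smul_add,
        TensorProduct.smul_tmul', smul_eq_mul, mul_smul, smul_comm f (pull m r)]
      abel)

theorem extConn_tmul (N : K →+ PuncRing m ⊗[BaseRing m] K)
    (hN : ∀ (r : BaseRing m) k, N (r • k) = δ (pull m r) ⊗ₜ k + pull m r • N k)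
    (f : PuncRing m) (k : K) : extConn δ N hN (f ⊗ₜ k) = δ f ⊗ₜ k + f • N k := rfl

theorem extConn_one_tmul (N : K →+ PuncRing m ⊗[BaseRing m] K)
    (hN : ∀ (r : BaseRing m) k, N (r • k) = δ (pull m r) ⊗ₜ k + pull m r • N k)
    (k : K) : extConn δ N hN (1 ⊗ₜ k) = N k := by
  rw [extConn_tmul, Derivation.map_one_eq_zero, TensorProduct.zero_tmul, zero_add, one_smul]

theorem isConnOver_extConn (N : K →+ PuncRing m ⊗[BaseRing m] K)
    (hN : ∀ (r : BaseRing m) k, N (r • k) = δ (pull m r) ⊗ₜ k + pull m r • N k) :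
    IsConnOver δ (extConn δ N hN) where
  add := map_add _
  leibniz f x := by
    induction x with
    | zero => simp
    | tmul g k =>
      rw [TensorProduct.smul_tmul', extConn_tmul, extConn_tmul, smul_eq_mul, Derivation.leibniz,
        smul_add, TensorProduct.add_tmul, TensorProduct.smul_tmul', TensorProduct.smul_tmul',
        mul_smul, smul_eq_mul, smul_eq_mul, smul_eq_mul, mul_comm g]
      abel
    | add x y hx hy => rw [smul_add, map_add, hx, hy, map_add, smul_add, smul_add]; abel

/-- `P` is a `z`-sesquilinear pairing on `H`. -/
structure IsSesquilinear (P : H → H → PuncRing m) : Prop where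
  add_left : ∀ a a' b, P (a + a') b = P a b + P a' b
  add_right : ∀ a b b', P a (b + b') = P a b + P a b'
  smul_left : ∀ (f : PuncRing m) a b, P (f • a) b = f * P a b
  smul_right : ∀ (f : PuncRing m) a b, P a (f • b) = negZ m f * P a b

variable {P P' : H → H → PuncRing m}

/-- A sesquilinear pairing is determined by its values on constant sections. -/
theorem IsSesquilinear.ext (h : IsSesquilinear P) (h' : IsSesquilinear P')
    (hP : ∀ k l, P (sec E k) (sec E l) = P' (sec E k) (sec E l)) (x y : H) : P x y = P' x y := by
  induction x using sec_induction E with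
  | hadd x x' hx hx' => rw [h.add_left, h'.add_left, hx, hx']
  | hsec f k =>
    rw [h.smul_left, h'.smul_left]
    congr 1
    induction y using sec_induction E with
    | hadd y y' hy hy' => rw [h.add_right, h'.add_right, hy, hy']
    | hsec g l => rw [h.smul_right, h'.smul_right, hP]

theorem IsSesquilinear.mul_mem {B : Subalgebra ℂ (PuncRing m)} (h : IsSesquilinear P)
    (u : PuncRing m) (hn : ∀ f ∈ B, negZ m f ∈ B)
    (hs : ∀ k l, u * P (sec E k) (sec E l) ∈ B) {x y : H} (hx : x ∈ lattice E B)
    (hy : y ∈ lattice E B) : u * P x y ∈ B := by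
  induction hx using lattice_induction with
  | hadd x x' _ _ hx hx' => rw [h.add_left, mul_add]; exact add_mem hx hx'
  | hsec f hf k =>
    rw [h.smul_left, mul_left_comm]
    refine Subalgebra.mul_mem _ hf ?_
    induction hy using lattice_induction with
    | hadd y y' _ _ hy hy' => rw [h.add_right, mul_add]; exact add_mem hy hy'
    | hsec g hg l =>
      rw [h.smul_right, mul_left_comm]
      exact Subalgebra.mul_mem _ (hn g hg) (hs k l)

/-- Flatness of a pairing may be checked on constant sections. -/
theorem IsSesquilinear.flat (h : IsSesquilinear P) (hD : IsConnOver δ D)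
    (hδ : ∀ f, δ (negZ m f) = negZ m (δ f))
    (hs : ∀ k l, δ (P (sec E k) (sec E l)) =
      P (D (sec E k)) (sec E l) + P (sec E k) (D (sec E l))) (x y : H) :
    δ (P x y) = P (D x) y + P x (D y) := by
  induction x using sec_induction E with
  | hadd x x' hx hx' =>
    rw [h.add_left, map_add, hD.add, h.add_left, hx, hx', h.add_left]; abel
  | hsec f k =>
    induction y using sec_induction E with
    | hadd y y' hy hy' =>
      rw [h.add_right, map_add, hD.add, h.add_right, hy, hy', h.add_right]; abel
    | hsec g l =>
      rw [hD.leibniz, hD.leibniz, h.add_left, h.add_right, h.smul_left, h.smul_left, h.smul_left,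
        h.smul_left, h.smul_left, h.smul_right, h.smul_right, h.smul_right, h.smul_right,
        Derivation.leibniz, Derivation.leibniz, hs, hδ]
      simp only [smul_eq_mul]
      ring

/-- A pairing that comes from a perfect pairing on `K` is perfect over each chart of `ℙ¹`. -/
theorem IsSesquilinear.nondegenerate [Module.Free (BaseRing m) K] [Module.Finite (BaseRing m) K]
    {B : Subalgebra ℂ (PuncRing m)} {t : B} (hB : IsChartRing B t) (h : IsSesquilinear P)
    (u : PuncRing m) {g : K →ₗ[BaseRing m] K →ₗ[BaseRing m] BaseRing m}
    (hsymm : ∀ a b, g a b = g b a) (hg : Function.Bijective g)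
    (hs : ∀ k l, u * P (sec E k) (sec E l) = pull m (g k l)) (φ : lattice E B →ₗ[B] B) :
    ∃! b : lattice E B, ∀ a : lattice E B, u * P a b = φ a := by
  let b := Module.Free.chooseBasis (BaseRing m) K
  choose e he using fun j => hg.2 (b.coord j)
  have hkey : ∀ k y, u * P (sec E k) y = negZ m (extDual E (g k) y) := by
    intro k y
    induction y using sec_induction E with
    | hadd y y' hy hy' => rw [h.add_right, mul_add, hy, hy', map_add, map_add]
    | hsec f l =>
      rw [h.smul_right, mul_left_comm, hs, map_smul, smul_eq_mul, extDual_sec, map_mul, negZ_pull]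
  let s : K → lattice E B := fun k => ⟨sec E k, sec_mem_lattice B k⟩
  -- `e` is the basis of `K` that is dual to `b`, and `y₀` has the coefficients of `φ` in this basis
  let y₀ : H := ∑ j, negZ m (φ (s (b j))) • sec E (e j)
  have hy₀ : y₀ ∈ lattice E B := Submodule.sum_mem _ fun j _ =>
    smul_mem_lattice (hB.negZ_mem _ (φ (s (b j))).2) (sec_mem_lattice B _)
  have hsec : ∀ k, (φ (s k) : PuncRing m) = ∑ j, pull m (b.coord j k) * φ (s (b j)) := by
    intro k
    have hk : s k = ∑ j, (⟨_, hB.pull_mem (b.coord j k)⟩ : B) • s (b j) := by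
      refine Subtype.ext ?_
      rw [Submodule.coe_sum]
      change sec E k = ∑ j, pull m (b.coord j k) • sec E (b j)
      rw [← sum_extDual_smul_sec E b (sec E k)]
      exact Finset.sum_congr rfl fun j _ => by rw [extDual_sec]
    rw [hk, map_sum]
    simp only [map_smul, AddSubmonoidClass.coe_finsetSum, smul_eq_mul, MulMemClass.coe_mul]
  have hgen : ∀ a (ha : a ∈ lattice E B), u * P a y₀ = φ ⟨a, ha⟩ := by
    intro a ha
    induction ha using lattice_induction with
    | hadd x y hx hy hx' hy' =>
      rw [h.add_left, mul_add, hx', hy']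
      exact (congrArg Subtype.val (map_add φ ⟨x, hx⟩ ⟨y, hy⟩)).symm
    | hsec f hf k =>
      refine Eq.trans ?_ (congrArg Subtype.val (map_smul φ ⟨f, hf⟩ (s k))).symm
      change u * P (f • sec E k) _ = f * (φ (s k) : PuncRing m)
      rw [h.smul_left, mul_left_comm, hkey, map_sum, map_sum, hsec]
      congr 1
      refine Finset.sum_congr rfl fun j _ => ?_
      rw [map_smul, smul_eq_mul, map_mul, negZ_negZ, extDual_sec, negZ_pull, hsymm, he, mul_comm]
  refine ⟨⟨y₀, hy₀⟩, fun a => hgen a a.2, fun y hy => ?_⟩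
  refine Subtype.ext (sub_eq_zero.1 (eq_zero_of_extDual E fun ψ => ?_))
  obtain ⟨k, rfl⟩ := hg.2 ψ
  have h1 : negZ m (extDual E (g k) y) = negZ m (extDual E (g k) y₀) := by
    rw [← hkey, ← hkey, hgen _ (sec_mem_lattice B k)]
    exact hy (s k)
  rw [map_sub, sub_eq_zero, ← negZ_negZ (extDual E (g k) y), h1, negZ_negZ]

end Connections

/-! ### Laurent expansion of the structure equations -/

section Expansion

variable {m : ℕ}

theorem VecField.lift_bracket (X Y : VecField m) (f : PuncRing m) :
    VecField.lift (VecField.bracket X Y) f =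
      VecField.lift X (VecField.lift Y f) - VecField.lift Y (VecField.lift X f) := by
  have h : ∀ X Y : VecField m, VecField.lift X (VecField.lift Y f) =
      (∑ i, pull m (VecField.act X (Y i)) * HolGerm.dir ((0, Pi.single i 1)) f) +
      ∑ i, ∑ j, pull m (Y i) * (pull m (X j) *
        HolGerm.dir ((0, Pi.single j 1)) (HolGerm.dir ((0, Pi.single i 1)) f)) := by
    intro X Y
    rw [VecField.lift_apply Y f, map_sum, ← Finset.sum_add_distrib]
    refine Finset.sum_congr rfl fun i _ => ?_
    rw [Derivation.leibniz, smul_eq_mul, smul_eq_mul, lift_pull,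
      VecField.lift_apply X (HolGerm.dir _ f), Finset.mul_sum]
    ring
  have h2 : (∑ i, ∑ j, pull m (Y i) * (pull m (X j) *
        HolGerm.dir ((0, Pi.single j 1)) (HolGerm.dir ((0, Pi.single i 1)) f))) =
      ∑ i, ∑ j, pull m (X i) * (pull m (Y j) *
        HolGerm.dir ((0, Pi.single j 1)) (HolGerm.dir ((0, Pi.single i 1)) f)) := by
    rw [Finset.sum_comm]
    refine Finset.sum_congr rfl fun i _ => Finset.sum_congr rfl fun j _ => ?_
    rw [HolGerm.dir_comm]; ring
  rw [h X Y, h Y X, h2, VecField.lift_apply, add_sub_add_right_eq_sub, ← Finset.sum_sub_distrib]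
  refine Finset.sum_congr rfl fun i _ => ?_
  rw [VecField.bracket, map_sub, sub_mul]

theorem lift_zDz (X : VecField m) (f : PuncRing m) :
    VecField.lift X (zDz m f) = zDz m (VecField.lift X f) := by
  have h0 : ∀ v : Fin m → ℂ, HolGerm.dir ((0 : ℂ), v) (zPow m 1) = 0 := fun v => by
    rw [dir_zPow_one, map_zero]
  have h1 : ∀ r : BaseRing m, HolGerm.dir ((1 : ℂ), (0 : Fin m → ℂ)) (pull m r) = 0 := fun r => by
    have h := zDz_pull r
    rw [zDz_apply] at h
    exact (Units.isUnit (zUnit m ^ (1 : ℤ))).mul_right_eq_zero.1 h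
  simp only [VecField.lift_apply, zDz_apply, map_sum, Derivation.leibniz, h0, h1, smul_eq_mul,
    Finset.mul_sum, mul_zero, add_zero, Finset.sum_const_zero]
  refine Finset.sum_congr rfl fun i _ => ?_
  rw [HolGerm.dir_comm]; ring

theorem pull_laurent_ext {a b a' b' : BaseRing m}
    (h : pull m a + zPow m (-1) * pull m b = pull m a' + zPow m (-1) * pull m b') :
    a = a' ∧ b = b' := by
  let E : PuncRing m ⊗[BaseRing m] BaseRing m ≃ₗ[PuncRing m] PuncRing m :=
    TensorProduct.AlgebraTensorModule.rid (BaseRing m) (PuncRing m) (PuncRing m)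
  have hs : ∀ r : BaseRing m, sec E r = pull m r := fun r => by
    rw [sec_apply, TensorProduct.AlgebraTensorModule.rid_tmul, smul_eq_pull_mul, mul_one]
  refine laurent_ext (E := E) ?_
  simpa only [hs, smul_eq_mul] using h

variable {K : Type*} [AddCommGroup K] [Module (BaseRing m) K]
  {H : Type*} [AddCommGroup H] [Module (PuncRing m) H]
  {E : PuncRing m ⊗[BaseRing m] K ≃ₗ[PuncRing m] H}
  {δ δ' : Derivation ℂ (PuncRing m) (PuncRing m)} {D D' : H → H}

/-- The covariant derivative over `δ` is `N + z⁻¹ C` on the constant sections. -/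
def HasExpansion (E : PuncRing m ⊗[BaseRing m] K ≃ₗ[PuncRing m] H) (D : H → H) (N C : K → K) :
    Prop := ∀ k, D (sec E k) = sec E (N k) + zPow m (-1) • sec E (C k)

/-- The expansion of a composition. The correction `c • C'` arises because `D` also differentiates
the factor `z⁻¹` in the expansion of `D'`. -/
theorem HasExpansion.comp_sec {N C N' C' : K → K} (hD : IsConnOver δ D) {c : ℤ}
    (hc : δ (zPow m (-1)) = c * zPow m (-1)) (h : HasExpansion E D N C)
    (h' : HasExpansion E D' N' C') (k : K) :
    D (D' (sec E k)) = sec E (N (N' k)) +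
      zPow m (-1) • sec E (C (N' k) + N (C' k) + c • C' k) + zPow m (-2) • sec E (C (C' k)) := by
  rw [h', hD.add, hD.leibniz, hc, h, h, smul_add, zPow_smul_smul, map_add, map_add, map_zsmul,
    mul_smul, smul_add, smul_add, Int.cast_smul_eq_zsmul, smul_comm (zPow m (-1)) c]
  norm_num
  abel

/-- The expansion of the right hand side of the flatness equation of a pairing. In the second
argument `z⁻¹` is replaced by `-z⁻¹`, whence the sign in the coefficient of `z ^ (w - 1)`. -/
theorem HasExpansion.pairing_add {N C : K → K} {P : H → H → PuncRing m} {w : ℤ}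
    {g : K → K → BaseRing m} (hP : IsSesquilinear P)
    (hs : ∀ k l, P (sec E k) (sec E l) = zPow m w * pull m (g k l))
    (h : HasExpansion E D N C) (k l : K) :
    P (D (sec E k)) (sec E l) + P (sec E k) (D (sec E l)) =
      zPow m w * (pull m (g (N k) l + g k (N l)) +
        zPow m (-1) * pull m (g (C k) l - g k (C l))) := by
  rw [h, h, hP.add_left, hP.add_right, hP.smul_left, hP.smul_right, hs, hs, hs, hs, negZ_zPow,
    map_add, map_sub]
  norm_num
  ring

variable (m K) in
/-- The tautological isomorphism of `π^* K` with itself. -/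
abbrev pullEquiv : PuncRing m ⊗[BaseRing m] K ≃ₗ[PuncRing m] PuncRing m ⊗[BaseRing m] K :=
  LinearEquiv.refl _ _

/-- The covariant derivative on `π^* K` which is `N + z⁻¹ C` on the constant sections. -/
def laurentConn (δ : Derivation ℂ (PuncRing m) (PuncRing m)) (d : BaseRing m → BaseRing m)
    (hd : ∀ r, δ (pull m r) = pull m (d r)) (N : K →+ K)
    (hN : ∀ (r : BaseRing m) k, N (r • k) = d r • k + r • N k) (C : K →ₗ[BaseRing m] K) :
    PuncRing m ⊗[BaseRing m] K →+ PuncRing m ⊗[BaseRing m] K :=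
  extConn δ
    ((sec (pullEquiv m K)).comp N +
      ((DistribSMul.toAddMonoidHom _ (zPow m (-1))).comp (sec (pullEquiv m K))).comp
        C.toAddMonoidHom)
    (fun r k => by
      have h1 : δ (pull m r) ⊗ₜ[BaseRing m] k = pull m (d r) • sec (pullEquiv m K) k := by
        rw [hd, ← apply_tmul]; rfl
      rw [h1]
      simp only [AddMonoidHom.add_apply, AddMonoidHom.comp_apply, hN, map_add, sec_smul,
        LinearMap.toAddMonoidHom_coe, map_smul, DistribSMul.toAddMonoidHom_apply, smul_add,
        smul_comm (zPow m (-1))]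
      abel)

variable (d : BaseRing m → BaseRing m)
    (hd : ∀ r, δ (pull m r) = pull m (d r)) (N : K →+ K)
    (hN : ∀ (r : BaseRing m) k, N (r • k) = d r • k + r • N k) (C : K →ₗ[BaseRing m] K)

theorem isConnOver_laurentConn : IsConnOver δ (laurentConn δ d hd N hN C) :=
  isConnOver_extConn _ _

theorem hasExpansion_laurentConn :
    HasExpansion (pullEquiv m K) (laurentConn δ d hd N hN C) N C :=
  fun k => extConn_one_tmul _ _ k

/-- `negZ`, as a linear map over the functions on `(M, 0)`. -/
def negZLinear (m : ℕ) : PuncRing m →ₗ[BaseRing m] PuncRing m where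
  toFun := negZ m
  map_add' := map_add _
  map_smul' r f := by
    rw [smul_eq_pull_mul, map_mul, negZ_pull, RingHom.id_apply, smul_eq_pull_mul]

theorem negZLinear_apply (f : PuncRing m) : negZLinear m f = negZ m f := rfl

theorem rTensor_negZLinear_smul (f : PuncRing m) (x : PuncRing m ⊗[BaseRing m] K) :
    LinearMap.rTensor K (negZLinear m) (f • x) =
      negZ m f • LinearMap.rTensor K (negZLinear m) x := by
  induction x with
  | zero => simp
  | tmul h k =>
    rw [TensorProduct.smul_tmul', LinearMap.rTensor_tmul, LinearMap.rTensor_tmul,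
      TensorProduct.smul_tmul', negZLinear_apply, negZLinear_apply, smul_eq_mul, map_mul,
      smul_eq_mul]
  | add x y hx hy => rw [smul_add, map_add, hx, hy, map_add, smul_add]

/-- The `z`-sesquilinear pairing on `π^* K` which is `z ^ w g` on the constant sections. -/
def sesqui (w : ℤ) (g : K →ₗ[BaseRing m] K →ₗ[BaseRing m] BaseRing m)
    (x y : PuncRing m ⊗[BaseRing m] K) : PuncRing m :=
  zPow m w * LinearMap.BilinForm.baseChange (PuncRing m) g x
    (LinearMap.rTensor K (negZLinear m) y)

theorem isSesquilinear_sesqui (w : ℤ) (g : K →ₗ[BaseRing m] K →ₗ[BaseRing m] BaseRing m) :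
    IsSesquilinear (sesqui w g) where
  add_left a a' b := by simp only [sesqui, map_add, LinearMap.add_apply, mul_add]
  add_right a b b' := by simp only [sesqui, map_add, mul_add]
  smul_left f a b := by
    simp only [sesqui, map_smul, LinearMap.smul_apply, smul_eq_mul]; ring
  smul_right f a b := by
    rw [sesqui, rTensor_negZLinear_smul, map_smul, smul_eq_mul, sesqui]; ring

theorem sesqui_sec (w : ℤ) (g : K →ₗ[BaseRing m] K →ₗ[BaseRing m] BaseRing m) (k l : K) :
    sesqui w g (sec (pullEquiv m K) k) (sec (pullEquiv m K) l) =
      zPow m w * pull m (g k l) := by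
  simp [sesqui, sec_apply, smul_eq_pull_mul, negZLinear_apply]

/-- A basis of `K` generates the sections of `π^* K` over each chart. -/
theorem lattice_eq_span {ι : Type*} [Fintype ι] (b : Module.Basis ι (BaseRing m) K)
    {B : Subalgebra ℂ (PuncRing m)} (hB : ∀ r, pull m r ∈ B) :
    lattice E B = Submodule.span B (range fun i => sec E (b i)) := by
  refine le_antisymm (Submodule.span_le.2 ?_) (Submodule.span_mono ?_)
  · rintro _ ⟨k, rfl⟩
    rw [← sum_extDual_smul_sec E b (sec E k)]
    refine Submodule.sum_mem _ fun i _ => ?_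
    rw [extDual_sec]
    exact Submodule.smul_mem _ (⟨_, hB _⟩ : B) (Submodule.subset_span ⟨i, rfl⟩)
  · rintro _ ⟨i, rfl⟩
    exact ⟨b i, rfl⟩

end Expansion

/-! ### From Frobenius type structures to `(logD-trTLEP(w))`-structures -/

section Construction

variable {m : ℕ} {D : NormalCrossing m} {w : ℤ} {K : Type*} [AddCommGroup K]
  [Module (BaseRing m) K] {H : Type*} [AddCommGroup H] [Module (PuncRing m) H]

/-- The isomorphism `E : π^* K ≅ H` carries the structure constructed from `S` to `T`. -/
structure IsExplicitAlong (E : PuncRing m ⊗[BaseRing m] K ≃ₗ[PuncRing m] H)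
    (S : FrobType D K) (T : TrTLEP D w H) : Prop where
  latZero : T.latZero = lattice E (zeroRing m)
  latInfty : T.latInfty = lattice E (inftyRing m)
  nabla : ∀ X, HasExpansion E (T.nabla X) (S.nabla X) (S.C X)
  nablaZ : HasExpansion E T.nablaZ
    (fun k => algebraMap ℂ (BaseRing m) (w / 2 : ℂ) • k - S.V k) S.U
  P : ∀ k l, T.P (sec E k) (sec E l) = zPow m w * pull m (S.g k l)

theorem isExplicit_iff {S : FrobType D K} {T : TrTLEP D w (PuncRing m ⊗[BaseRing m] K)} :
    TrTLEP.IsExplicit S T ↔ IsExplicitAlong (pullEquiv m K) S T := by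
  have hz : ∀ (f : PuncRing m) (k : K), f ⊗ₜ[BaseRing m] k =
      f • sec (pullEquiv m K) k :=
    fun f k => apply_tmul (pullEquiv m K) _ _
  have hV : ∀ k : K, zPow m (-1) ⊗ₜ[BaseRing m] S.U k - 1 ⊗ₜ S.V k
      + algebraMap ℂ (PuncRing m) (w / 2 : ℂ) ⊗ₜ k =
      sec (pullEquiv m K)
        (algebraMap ℂ (BaseRing m) (w / 2 : ℂ) • k - S.V k) + zPow m (-1) •
      sec (pullEquiv m K) (S.U k) := by
    intro k
    rw [hz, hz, hz, map_sub, sec_smul, AlgHom.commutes, one_smul]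
    abel
  constructor
  · intro h
    exact ⟨h.latZero, h.latInfty, fun X k => (h.nabla X k).trans (by rw [hz, hz, one_smul]),
      fun k => (h.nablaZ k).trans (hV k), h.P⟩
  · intro h
    exact ⟨h.latZero, h.latInfty, fun X k => (h.nabla X k).trans (by rw [hz, hz, one_smul]),
      fun k => (h.nablaZ k).trans (hV k).symm, h.P⟩

theorem TrTLEP.isConnOver_nabla (T : TrTLEP D w H) (X : logVF D) :
    IsConnOver (VecField.lift X.1) (T.nabla X) := ⟨T.nabla_add X, T.nabla_leibniz X⟩

theorem TrTLEP.isConnOver_nablaZ (T : TrTLEP D w H) : IsConnOver (zDz m) T.nablaZ :=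
  ⟨T.nablaZ_add, T.nablaZ_leibniz⟩

theorem TrTLEP.isSesquilinear_P (T : TrTLEP D w H) : IsSesquilinear T.P :=
  ⟨T.P_add_left, T.P_add_right, T.P_smul_left, T.P_smul_right⟩

theorem neg_one_zpow_mul_self (w : ℤ) : (-1 : ℂ) ^ w * (-1 : ℂ) ^ w = 1 := by
  rw [← mul_zpow]; norm_num

theorem act_algebraMap (X : VecField m) (c : ℂ) :
    VecField.act X (algebraMap ℂ (BaseRing m) c) = 0 := Derivation.map_algebraMap _ _

attribute [ext] FrobType TrTLEP

variable (S : FrobType D K) (w)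

/-- The covariant derivative `∇ʳ_X + z⁻¹ C_X` on `π^* K`. -/
def FrobType.conn (X : logVF D) :
    PuncRing m ⊗[BaseRing m] K →+ PuncRing m ⊗[BaseRing m] K :=
  laurentConn (VecField.lift X.1) (VecField.act X.1) (lift_pull X.1)
    (AddMonoidHom.mk' (S.nabla X) (S.nabla_add X)) (S.nabla_leibniz X) (S.C X)

/-- The covariant derivative `z⁻¹ U - V + w/2` on `π^* K` in the direction of `z ∂/∂z`. -/
def FrobType.connZ : PuncRing m ⊗[BaseRing m] K →+ PuncRing m ⊗[BaseRing m] K :=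
  laurentConn (zDz m) (fun _ => 0) (fun r => by rw [zDz_pull, map_zero])
    (algebraMap ℂ (BaseRing m) (w / 2 : ℂ) • LinearMap.id - S.V :
      K →ₗ[BaseRing m] K).toAddMonoidHom
    (fun r k => by
      rw [zero_smul, zero_add]
      exact map_smul (algebraMap ℂ (BaseRing m) (w / 2 : ℂ) • LinearMap.id - S.V :
        K →ₗ[BaseRing m] K) r k) S.U

theorem FrobType.isConnOver_conn (X : logVF D) : IsConnOver (VecField.lift X.1) (S.conn X) :=
  isConnOver_laurentConn _ _ _ _ _

theorem FrobType.isConnOver_connZ : IsConnOver (zDz m) (S.connZ w) :=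
  isConnOver_laurentConn _ _ _ _ _

theorem FrobType.hasExpansion_conn (X : logVF D) :
    HasExpansion (pullEquiv m K) (S.conn X) (S.nabla X) (S.C X) :=
  hasExpansion_laurentConn _ _ _ _ _

theorem FrobType.hasExpansion_connZ : HasExpansion (pullEquiv m K) (S.connZ w)
    (fun k => algebraMap ℂ (BaseRing m) (w / 2 : ℂ) • k - S.V k) S.U :=
  hasExpansion_laurentConn _ _ _ _ _

theorem FrobType.exists_basis (S : FrobType D K) : ∃ (n : ℕ)
    (b : Module.Basis (Fin n) (PuncRing m) (PuncRing m ⊗[BaseRing m] K)),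
    lattice (pullEquiv m K) (zeroRing m) =
      Submodule.span (zeroRing m) (range b) ∧
    lattice (pullEquiv m K) (inftyRing m) =
      Submodule.span (inftyRing m) (range b) := by
  have := S.free
  have := S.finite
  let b := (Module.Free.chooseBasis (BaseRing m) K).reindex (Fintype.equivFin _)
  have hb : (fun i => sec (pullEquiv m K) (b i)) =
    b.baseChange (PuncRing m) := funext fun i => (Module.Basis.baseChange_apply _ _ _).symm
  refine ⟨_, b.baseChange (PuncRing m), ?_, ?_⟩
  · rw [lattice_eq_span b pull_mem_zeroRing, hb]
  · rw [lattice_eq_span b pull_mem_inftyRing, hb]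

theorem FrobType.zPow_mul_sesqui_sec (k l : K) : zPow m (-w) *
    sesqui w S.g (sec (pullEquiv m K) k) (sec (pullEquiv m K) l) =
      pull m (S.g k l) := by
  rw [sesqui_sec, ← mul_assoc, zPow_mul_cancel (neg_add_cancel w), one_mul]

theorem FrobType.conn_add (X Y : logVF D) (a : PuncRing m ⊗[BaseRing m] K) :
    S.conn (X + Y) a = S.conn X a + S.conn Y a := by
  refine (S.isConnOver_conn (X + Y)).ext (E := pullEquiv m K)
    (((S.isConnOver_conn X).sum_add (S.isConnOver_conn Y)).congr fun f => ?_) ?_ a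
  · simp only [Derivation.add_apply, VecField.lift_apply, Submodule.coe_add, Pi.add_apply,
      map_add, add_mul, Finset.sum_add_distrib]
  · intro k
    rw [S.hasExpansion_conn, S.hasExpansion_conn, S.hasExpansion_conn, S.nabla_field_add,
      map_add, map_add, LinearMap.add_apply, map_add,
      smul_add]
    abel

theorem FrobType.conn_smul (f : BaseRing m) (X : logVF D) (a : PuncRing m ⊗[BaseRing m] K) :
    S.conn (f • X) a = pull m f • S.conn X a := by
  induction a using sec_induction (pullEquiv m K) with
  | hadd x y hx hy => rw [map_add, map_add, hx, hy, smul_add]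
  | hsec h k =>
    rw [(S.isConnOver_conn _).leibniz, (S.isConnOver_conn _).leibniz, S.hasExpansion_conn,
      S.hasExpansion_conn, S.nabla_field_smul, LinearMap.map_smul,
      LinearMap.smul_apply, sec_smul, sec_smul]
    have : VecField.lift (f • X).1 h = pull m f * VecField.lift X.1 h := by
      simp only [VecField.lift_apply, Submodule.coe_smul, Pi.smul_apply, smul_eq_mul, map_mul,
        Finset.mul_sum, mul_assoc]
    rw [this]
    module

theorem FrobType.conn_flat (X Y : logVF D) (a : PuncRing m ⊗[BaseRing m] K) :
    S.conn X (S.conn Y a) - S.conn Y (S.conn X a) = S.conn (logBracket X Y) a := by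
  refine IsConnOver.ext (E := pullEquiv m K)
    ((S.isConnOver_conn X).commutator (S.isConnOver_conn Y))
    ((S.isConnOver_conn _).congr fun f => ?_) ?_ a
  · rw [Derivation.commutator_apply]
    exact VecField.lift_bracket X.1 Y.1 f
  · intro k
    have hX := (S.hasExpansion_conn X).comp_sec (S.isConnOver_conn X)
      (c := 0) (by rw [lift_zPow]; simp) (S.hasExpansion_conn Y) k
    have hY := (S.hasExpansion_conn Y).comp_sec (S.isConnOver_conn Y)
      (c := 0) (by rw [lift_zPow]; simp) (S.hasExpansion_conn X) k
    -- the coefficients of `1`, `z⁻¹` and `z⁻²` are `nabla_flat`, `nabla_C` and `higgs`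
    have hC : S.C (logBracket X Y) k = (S.C X (S.nabla Y k) + S.nabla X (S.C Y k)) -
        (S.C Y (S.nabla X k) + S.nabla Y (S.C X k)) := by
      rw [← sub_eq_zero, ← neg_eq_zero, ← S.nabla_C X Y k]; abel
    rw [hX, hY, S.hasExpansion_conn, hC, ← S.nabla_flat, S.higgs]
    simp only [map_add, map_sub, smul_add, smul_sub, zero_smul, map_zero, smul_zero]
    abel

theorem FrobType.conn_connZ (X : logVF D) (a : PuncRing m ⊗[BaseRing m] K) :
    S.conn X (S.connZ w a) = S.connZ w (S.conn X a) := by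
  have h0 : IsConnOver 0 fun x => S.conn X (S.connZ w x) - S.connZ w (S.conn X x) :=
    ((S.isConnOver_conn X).commutator (S.isConnOver_connZ w)).congr fun f => by
      rw [Derivation.commutator_apply, lift_zDz, sub_self]; rfl
  have hz : IsConnOver (0 : Derivation ℂ (PuncRing m) (PuncRing m))
      fun _ : PuncRing m ⊗[BaseRing m] K => 0 :=
    ⟨fun _ _ => (add_zero _).symm, fun f a => by simp⟩
  refine sub_eq_zero.1 (h0.ext (E := pullEquiv m K) hz (fun k => ?_) a)
  have hX := (S.hasExpansion_conn X).comp_sec (S.isConnOver_conn X)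
    (c := 0) (by rw [lift_zPow]; simp) (S.hasExpansion_connZ w) k
  have hY := (S.hasExpansion_connZ w).comp_sec (S.isConnOver_connZ w)
    (c := -1) (by rw [zDz_zPow]) (S.hasExpansion_conn X) k
  have hU : S.nabla X (S.U k) = S.U (S.nabla X k) + (S.C X (S.V k) - S.V (S.C X k))
      - S.C X k := by
    rw [← sub_eq_zero, ← S.nabla_U X k]; abel
  let c : BaseRing m := algebraMap ℂ (BaseRing m) (w / 2 : ℂ)
  have hcdef : algebraMap ℂ (BaseRing m) (w / 2 : ℂ) = c := rfl
  have hcn : ∀ k, S.nabla X (c • k - S.V k) = c • S.nabla X k - S.V (S.nabla X k) := by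
    intro k
    have h1 := map_sub (AddMonoidHom.mk' (S.nabla X) (S.nabla_add X)) (c • k) (S.V k)
    simp only [AddMonoidHom.mk'_apply] at h1
    rw [h1, S.nabla_leibniz, act_algebraMap, zero_smul, zero_add, S.V_flat]
  rw [hcdef] at hX hY
  rw [hX, hY, hcn, hU, S.U_C]
  simp only [map_add, map_sub, map_smul, zero_smul, add_zero, neg_smul, one_smul, map_neg,
    smul_add, smul_sub, smul_neg]
  abel

/-- The structure on `π^* K` constructed from a Frobenius type structure on `K`. -/
def FrobType.toTrTLEP : TrTLEP D w (PuncRing m ⊗[BaseRing m] K) where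
  latZero := lattice (pullEquiv m K) (zeroRing m)
  latInfty := lattice (pullEquiv m K) (inftyRing m)
  trivial := S.exists_basis
  nabla X := S.conn X
  nabla_field_add := S.conn_add
  nabla_field_smul := S.conn_smul
  nabla_add X := (S.isConnOver_conn X).add
  nabla_leibniz X := (S.isConnOver_conn X).leibniz
  nablaZ := S.connZ w
  nablaZ_add := (S.isConnOver_connZ w).add
  nablaZ_leibniz := (S.isConnOver_connZ w).leibniz
  flat := S.conn_flat
  flatZ := S.conn_connZ w
  pole_zero := fun X a ha => (S.isConnOver_conn X).smul_mem _ zPow_one_mem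
    (isChartRing_zeroRing.lift_mem X.1) (fun k => by
      rw [S.hasExpansion_conn, smul_add, zPow_smul_smul, add_neg_cancel, zPow_zero, one_smul]
      exact add_mem (smul_mem_lattice zPow_one_mem (sec_mem_lattice _ _))
        (sec_mem_lattice _ _)) ha
  pole_zeroZ := fun a ha => (S.isConnOver_connZ w).smul_mem _ zPow_one_mem
    isChartRing_zeroRing.zDz_mem (fun k => by
      rw [S.hasExpansion_connZ w, smul_add, zPow_smul_smul, add_neg_cancel, zPow_zero, one_smul]
      exact add_mem (smul_mem_lattice zPow_one_mem (sec_mem_lattice _ _))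
        (sec_mem_lattice _ _)) ha
  pole_infty := fun X a ha => by
    rw [← one_smul (PuncRing m) (S.conn X a)]
    refine (S.isConnOver_conn X).smul_mem _ (one_mem _)
      (isChartRing_inftyRing.lift_mem X.1) (fun k => ?_) ha
    rw [S.hasExpansion_conn, one_smul]
    exact add_mem (sec_mem_lattice _ _)
      (smul_mem_lattice zPow_neg_one_mem (sec_mem_lattice _ _))
  pole_inftyZ := fun a ha => by
    rw [← one_smul (PuncRing m) (S.connZ w a)]
    refine (S.isConnOver_connZ w).smul_mem _ (one_mem _)
      isChartRing_inftyRing.zDz_mem (fun k => ?_) ha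
    rw [S.hasExpansion_connZ w, one_smul]
    exact add_mem (sec_mem_lattice _ _)
      (smul_mem_lattice zPow_neg_one_mem (sec_mem_lattice _ _))
  P := sesqui w S.g
  P_add_left := (isSesquilinear_sesqui w S.g).add_left
  P_add_right := (isSesquilinear_sesqui w S.g).add_right
  P_smul_left := (isSesquilinear_sesqui w S.g).smul_left
  P_smul_right := (isSesquilinear_sesqui w S.g).smul_right
  P_symm := fun a b => by
    have h' : IsSesquilinear fun b a => (-1 : ℂ) ^ w • negZ m (sesqui w S.g a b) :=
      ⟨fun a a' b => by rw [(isSesquilinear_sesqui w S.g).add_right, map_add, smul_add],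
        fun a b b' => by rw [(isSesquilinear_sesqui w S.g).add_left, map_add, smul_add],
        fun f a b => by
          rw [(isSesquilinear_sesqui w S.g).smul_right, map_mul, negZ_negZ, mul_smul_comm],
        fun f a b => by rw [(isSesquilinear_sesqui w S.g).smul_left, map_mul, mul_smul_comm]⟩
    refine (isSesquilinear_sesqui w S.g).ext (E := pullEquiv m K) h' (fun k l => ?_) b a
    rw [sesqui_sec, sesqui_sec, map_mul, negZ_pull, negZ_zPow, smul_mul_assoc, smul_smul,
      neg_one_zpow_mul_self, one_smul, S.g_symm]
  P_flat := fun X => (isSesquilinear_sesqui w S.g).flat (E := pullEquiv m K)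
      (S.isConnOver_conn X) (lift_negZ X.1) fun k l => by
    rw [(S.hasExpansion_conn X).pairing_add (isSesquilinear_sesqui w S.g)
      (g := fun k l => S.g k l) (sesqui_sec w S.g), sesqui_sec, Derivation.leibniz, lift_zPow,
      smul_zero, add_zero,
      lift_pull, S.g_flat, S.g_C, sub_self, map_zero, mul_zero, add_zero, smul_eq_mul]
  P_flatZ := (isSesquilinear_sesqui w S.g).flat (E := pullEquiv m K)
      (S.isConnOver_connZ w) zDz_negZ fun k l => by
    rw [(S.hasExpansion_connZ w).pairing_add (isSesquilinear_sesqui w S.g)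
      (g := fun k l => S.g k l) (sesqui_sec w S.g), sesqui_sec, Derivation.leibniz, zDz_zPow,
      zDz_pull, smul_zero,
      zero_add, S.g_U, sub_self, map_zero, mul_zero, add_zero, smul_eq_mul]
    let c : BaseRing m := algebraMap ℂ (BaseRing m) (w / 2 : ℂ)
    have hw : S.g (c • k - S.V k) l + S.g k (c • l - S.V l) = (w : BaseRing m) * S.g k l := by
      have hc : c + c = (w : BaseRing m) := by
        rw [← map_add, add_halves, map_intCast]
      rw [map_sub, map_sub, LinearMap.sub_apply, S.g_V, map_smul, map_smul,
        LinearMap.smul_apply, ← hc, smul_eq_mul]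
      ring
    rw [hw, map_mul, map_intCast]
    ring
  P_zero := fun a ha b hb => (isSesquilinear_sesqui w S.g).mul_mem _ isChartRing_zeroRing.negZ_mem
    (fun k l => by rw [S.zPow_mul_sesqui_sec w]; exact pull_mem_zeroRing _) ha hb
  P_zero_nondegenerate :=
    haveI := S.free
    haveI := S.finite
    (isSesquilinear_sesqui w S.g).nondegenerate isChartRing_zeroRing (zPow m (-w))
      S.g_symm S.g_nondegenerate (S.zPow_mul_sesqui_sec w)
  P_infty := fun a ha b hb => (isSesquilinear_sesqui w S.g).mul_mem _ isChartRing_inftyRing.negZ_mem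
    (fun k l => by rw [S.zPow_mul_sesqui_sec w]; exact pull_mem_inftyRing _) ha hb
  P_infty_nondegenerate :=
    haveI := S.free
    haveI := S.finite
    (isSesquilinear_sesqui w S.g).nondegenerate isChartRing_inftyRing (zPow m (-w))
      S.g_symm S.g_nondegenerate (S.zPow_mul_sesqui_sec w)

theorem isExplicitAlong_toTrTLEP :
    IsExplicitAlong (pullEquiv m K) S (S.toTrTLEP w) where
  latZero := rfl
  latInfty := rfl
  nabla _ := hasExpansion_laurentConn _ _ _ _ _
  nablaZ := hasExpansion_laurentConn _ _ _ _ _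
  P := sesqui_sec w S.g

theorem IsExplicitAlong.trTLEP_eq {E : PuncRing m ⊗[BaseRing m] K ≃ₗ[PuncRing m] H}
    {S : FrobType D K} {w : ℤ} {T T' : TrTLEP D w H} (h : IsExplicitAlong E S T)
    (h' : IsExplicitAlong E S T') : T = T' := by
  refine TrTLEP.ext (h.latZero.trans h'.latZero.symm) (h.latInfty.trans h'.latInfty.symm) ?_ ?_ ?_
  · exact funext fun X => funext <| (T.isConnOver_nabla X).ext (E := E) (T'.isConnOver_nabla X)
      fun k => (h.nabla X k).trans (h'.nabla X k).symm
  · exact funext <| T.isConnOver_nablaZ.ext (E := E) T'.isConnOver_nablaZ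
      fun k => (h.nablaZ k).trans (h'.nablaZ k).symm
  · exact funext fun x => funext fun y => T.isSesquilinear_P.ext (E := E) T'.isSesquilinear_P
      (fun k l => (h.P k l).trans (h'.P k l).symm) x y

end Construction

/-! ### From `(logD-trTLEP(w))`-structures to Frobenius type structures -/

section Deconstruction

variable {m : ℕ} {D : NormalCrossing m} {w : ℤ} {K : Type*} [AddCommGroup K]
  [Module (BaseRing m) K] {H : Type*} [AddCommGroup H] [Module (PuncRing m) H]
  {E : PuncRing m ⊗[BaseRing m] K ≃ₗ[PuncRing m] H}

theorem HasExpansion.ext [Module.Free (BaseRing m) K] {D : H → H} {N C N' C' : K → K}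
    (h : HasExpansion E D N C) (h' : HasExpansion E D N' C') : N = N' ∧ C = C' := by
  have := fun k => laurent_ext ((h k).symm.trans (h' k))
  exact ⟨funext fun k => (this k).1, funext fun k => (this k).2⟩

theorem IsExplicitAlong.frobType_eq {S S' : FrobType D K} {T : TrTLEP D w H}
    (h : IsExplicitAlong E S T) (h' : IsExplicitAlong E S' T) : S = S' := by
  have := S.free
  have hX := fun X => (h.nabla X).ext (h'.nabla X)
  have hZ := h.nablaZ.ext h'.nablaZ
  refine FrobType.ext (funext fun X => (hX X).1) (LinearMap.ext fun X => LinearMap.ext fun k =>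
    congrFun (hX X).2 k) (LinearMap.ext fun k => congrFun hZ.2 k)
    (LinearMap.ext fun k => sub_right_injective (congrFun hZ.1 k))
    (LinearMap.ext fun k => LinearMap.ext fun l => pull_injective ?_)
  have hP := (h.P k l).symm.trans (h'.P k l)
  exact (Units.isUnit (zUnit m ^ w)).mul_left_cancel hP

/-- The expansion of a covariant derivative on `H` that is holomorphic at infinity with a simple
pole at zero, together with the Leibniz rules for its two coefficients. -/
theorem IsConnOver.exists_expansion [Module.Free (BaseRing m) K] [Module.Finite (BaseRing m) K]
    {δ : Derivation ℂ (PuncRing m) (PuncRing m)} {D : H → H} (hD : IsConnOver δ D)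
    (d : BaseRing m → BaseRing m) (hd : ∀ r, δ (pull m r) = pull m (d r))
    (h0 : ∀ a ∈ lattice E (zeroRing m), zPow m 1 • D a ∈ lattice E (zeroRing m))
    (hinf : ∀ a ∈ lattice E (inftyRing m), D a ∈ lattice E (inftyRing m)) :
    ∃ (N : K → K) (C : K →ₗ[BaseRing m] K), HasExpansion E D N C ∧
      (∀ k l, N (k + l) = N k + N l) ∧ ∀ (r : BaseRing m) k, N (r • k) = d r • k + r • N k := by
  choose p hp using fun k => exists_eq_sec_add_zPow_smul_sec
    (h0 _ (sec_mem_lattice (E := E) _ k)) (hinf _ (sec_mem_lattice (E := E) _ k))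
  have hadd : ∀ k l, (p (k + l)).1 = (p k).1 + (p l).1 ∧ (p (k + l)).2 = (p k).2 + (p l).2 := by
    intro k l
    refine laurent_ext (E := E) ?_
    rw [← hp, map_add, hD.add, hp, hp, map_add, map_add, smul_add]
    abel
  have hsmul : ∀ (r : BaseRing m) k, (p (r • k)).1 = d r • k + r • (p k).1 ∧
      (p (r • k)).2 = r • (p k).2 := by
    intro r k
    refine laurent_ext (E := E) ?_
    rw [← hp, sec_smul, hD.leibniz, hp, hd, map_add, sec_smul, sec_smul, sec_smul, smul_add,
      smul_comm (zPow m (-1))]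
    abel
  exact ⟨fun k => (p k).1, { toFun := fun k => (p k).2
                             map_add' := fun k l => (hadd k l).2
                             map_smul' := fun r k => (hsmul r k).2 }, hp,
    fun k l => (hadd k l).1, fun r k => (hsmul r k).1⟩

/-- The pairing of constant sections, divided by `z ^ w`, is constant in `z`. -/
theorem TrTLEP.exists_pairing [Module.Free (BaseRing m) K] {T : TrTLEP D w H}
    (h0 : T.latZero = lattice E (zeroRing m)) (hinf : T.latInfty = lattice E (inftyRing m)) :
    ∃ g : K →ₗ[BaseRing m] K →ₗ[BaseRing m] BaseRing m,
      ∀ k l, T.P (sec E k) (sec E l) = zPow m w * pull m (g k l) := by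
  have hz : ∀ k, sec E k ∈ T.latZero := fun k => by rw [h0]; exact sec_mem_lattice _ k
  have hi : ∀ k, sec E k ∈ T.latInfty := fun k => by rw [hinf]; exact sec_mem_lattice _ k
  choose g hg using fun k l => exists_eq_pull (T.P_zero _ (hz k) _ (hz l))
    (T.P_infty _ (hi k) _ (hi l))
  refine ⟨LinearMap.mk₂ (BaseRing m) g ?_ ?_ ?_ ?_, fun k l => ?_⟩
  · intro k k' l
    refine pull_injective ?_
    rw [← hg, map_add, map_add, T.P_add_left, mul_add, hg, hg]
  · intro r k l
    refine pull_injective ?_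
    rw [← hg, sec_smul, T.P_smul_left, mul_left_comm, hg, smul_eq_mul, map_mul]
  · intro k l l'
    refine pull_injective ?_
    rw [← hg, map_add, map_add, T.P_add_right, mul_add, hg, hg]
  · intro r k l
    refine pull_injective ?_
    rw [← hg, sec_smul, T.P_smul_right, mul_left_comm, hg, smul_eq_mul, map_mul, negZ_pull]
  · rw [LinearMap.mk₂_apply, ← hg, ← mul_assoc, zPow_mul_cancel (add_neg_cancel w), one_mul]

/-- The pairing on `K` is perfect because the pairing near `z = 0` is. -/
theorem TrTLEP.pairing_bijective [Module.Free (BaseRing m) K] {T : TrTLEP D w H}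
    (h0 : T.latZero = lattice E (zeroRing m)) (g : K →ₗ[BaseRing m] K →ₗ[BaseRing m] BaseRing m)
    (hg : ∀ k l, T.P (sec E k) (sec E l) = zPow m w * pull m (g k l))
    (hsymm : ∀ k l, g k l = g l k) : Function.Bijective g := by
  have hsurj : Function.Surjective g := by
    intro ψ
    have hmem : ∀ a : T.latZero, extDual E ψ a ∈ zeroRing m := fun a =>
      extDual_mem E pull_mem_zeroRing ψ (by rw [← h0]; exact a.2)
    let φ : T.latZero →ₗ[zeroRing m] zeroRing m :=
      { toFun := fun a => ⟨extDual E ψ a, hmem a⟩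
        map_add' := fun a b => Subtype.ext (map_add (extDual E ψ) (a : H) b)
        map_smul' := fun f a => Subtype.ext (map_smul (extDual E ψ) (f : PuncRing m) (a : H)) }
    obtain ⟨b, hb, -⟩ := T.P_zero_nondegenerate φ
    obtain ⟨l, y, hy, hly⟩ := exists_eq_sec_add_smul E isChartRing_zeroRing
      (show (b : H) ∈ lattice E (zeroRing m) by rw [← h0]; exact b.2)
    refine ⟨l, LinearMap.ext fun k => ?_⟩
    have hk : sec E k ∈ T.latZero := by rw [h0]; exact sec_mem_lattice _ k
    have h1 : zPow m (-w) * T.P (sec E k) b = extDual E ψ (sec E k) := hb ⟨sec E k, hk⟩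
    have h2 := T.P_zero (sec E k) hk y (by rw [h0]; exact hy)
    rw [hly, T.P_add_right, T.P_smul_right, hg, extDual_sec, coe_zAtZero, negZ_zPow_one] at h1
    rw [hsymm, ← sub_eq_zero]
    refine isChartRing_zeroRing.eq_zero _ _ h2 ?_
    rw [map_sub, ← h1, coe_zAtZero]
    linear_combination (-pull m (g k l)) * zPow_mul_cancel (m := m) (neg_add_cancel w)
  refine ⟨(injective_iff_map_eq_zero g).2 fun k hk => ?_, hsurj⟩
  refine (Module.forall_dual_apply_eq_zero_iff (BaseRing m) k).1 fun ψ => ?_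
  obtain ⟨l, rfl⟩ := hsurj ψ
  rw [hsymm, hk, LinearMap.zero_apply]

/-- A trivialisation of a `(logD-trTLEP(w))`-structure over `ℙ¹` carries it to the structure that is
constructed from a Frobenius type structure. -/
theorem TrTLEP.exists_isExplicitAlong [Module.Free (BaseRing m) K] [Module.Finite (BaseRing m) K]
    (T : TrTLEP D w H) (h0 : T.latZero = lattice E (zeroRing m))
    (hinf : T.latInfty = lattice E (inftyRing m)) :
    ∃ S : FrobType D K, IsExplicitAlong E S T := by
  -- `∇_X = N X + z⁻¹ C X` and `∇_{z∂/∂z} = N₀ + z⁻¹ U` on constant sections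
  choose N C hNC hadd hleib using fun X => (T.isConnOver_nabla X).exists_expansion (E := E)
    (VecField.act X.1) (lift_pull X.1) (by rw [← h0]; exact T.pole_zero X)
    (by rw [← hinf]; exact T.pole_infty X)
  obtain ⟨N₀, U, hZ, haddZ, hleibZ⟩ := T.isConnOver_nablaZ.exists_expansion (E := E)
    (fun _ => 0) (fun r => by rw [zDz_pull, map_zero]) (by rw [← h0]; exact T.pole_zeroZ)
    (by rw [← hinf]; exact T.pole_inftyZ)
  obtain ⟨g, hg⟩ := T.exists_pairing h0 hinf
  have hsymm : ∀ k l, g l k = g k l := by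
    intro k l
    refine pull_injective ((Units.isUnit (zUnit m ^ w)).mul_left_cancel ?_)
    change zPow m w * _ = zPow m w * _
    rw [← hg, T.P_symm, hg, map_mul, negZ_pull, negZ_zPow, smul_mul_assoc, smul_smul,
      neg_one_zpow_mul_self, one_smul]
  let c : BaseRing m := algebraMap ℂ (BaseRing m) (w / 2 : ℂ)
  have hc : c + c = (w : BaseRing m) := by rw [← map_add, add_halves, map_intCast]
  let V : Module.End (BaseRing m) K :=
    { toFun := fun k => c • k - N₀ k
      map_add' := fun k l => by rw [haddZ, smul_add]; abel
      map_smul' := fun r k => by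
        rw [hleibZ, zero_smul, zero_add, RingHom.id_apply, smul_sub, smul_comm] }
  have hV : ∀ k, V k = c • k - N₀ k := fun _ => rfl
  have hN₀ : ∀ k, N₀ k = c • k - V k := fun k => by rw [hV]; abel
  have hfield : ∀ X Y k, N (X + Y) k = N X k + N Y k ∧ C (X + Y) k = C X k + C Y k := by
    intro X Y k
    refine laurent_ext (E := E) ?_
    rw [← hNC, T.nabla_field_add, hNC, hNC, map_add, map_add, smul_add]
    abel
  have hfield' : ∀ (f : BaseRing m) X k, N (f • X) k = f • N X k ∧ C (f • X) k = f • C X k := by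
    intro f X k
    refine laurent_ext (E := E) ?_
    rw [← hNC, T.nabla_field_smul, hNC, sec_smul, sec_smul, smul_add, smul_comm (zPow m (-1))]
  -- the flatness equations of the connection and of the pairing, split by powers of `z`
  have hflat : ∀ X Y k, N X (N Y k) - N Y (N X k) - N (logBracket X Y) k = 0 ∧
      (C X (N Y k) + N X (C Y k)) - (C Y (N X k) + N Y (C X k)) - C (logBracket X Y) k = 0 ∧
      C X (C Y k) - C Y (C X k) = 0 := by
    intro X Y k
    refine laurent_eq_zero (E := E) ?_
    have h1 := (hNC X).comp_sec (T.isConnOver_nabla X) (c := 0) (by rw [lift_zPow]; simp) (hNC Y) k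
    have h2 := (hNC Y).comp_sec (T.isConnOver_nabla Y) (c := 0) (by rw [lift_zPow]; simp) (hNC X) k
    have h3 := T.flat X Y (sec E k)
    rw [h1, h2, hNC, ← sub_eq_zero] at h3
    rw [← h3]
    simp only [map_add, map_sub, smul_add, smul_sub, zero_smul, add_zero]
    abel
  have hflatZ : ∀ X k, N X (N₀ k) - N₀ (N X k) = 0 ∧
      (C X (N₀ k) + N X (U k)) - (U (N X k) + N₀ (C X k) - C X k) = 0 ∧
      C X (U k) - U (C X k) = 0 := by
    intro X k
    refine laurent_eq_zero (E := E) ?_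
    have h1 := (hNC X).comp_sec (T.isConnOver_nabla X) (c := 0) (by rw [lift_zPow]; simp) hZ k
    have h2 := hZ.comp_sec T.isConnOver_nablaZ (c := -1) (by rw [zDz_zPow]) (hNC X) k
    have h3 := T.flatZ X (sec E k)
    rw [h1, h2, ← sub_eq_zero] at h3
    rw [← h3]
    simp only [map_add, map_sub, smul_add, smul_sub, zero_smul, add_zero, neg_smul, one_smul,
      map_neg, smul_neg]
    abel
  have hPflat : ∀ X k l, VecField.act X.1 (g k l) = g (N X k) l + g k (N X l) ∧
      0 = g (C X k) l - g k (C X l) := by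
    intro X k l
    refine pull_laurent_ext ((Units.isUnit (zUnit m ^ w)).mul_left_cancel ?_)
    have h1 := T.P_flat X (sec E k) (sec E l)
    rw [(hNC X).pairing_add T.isSesquilinear_P (g := fun k l => g k l) hg, hg, Derivation.leibniz,
      lift_zPow, smul_zero, add_zero, lift_pull, smul_eq_mul] at h1
    rw [map_zero, mul_zero, add_zero]
    exact h1
  have hPflatZ : ∀ k l, (w : BaseRing m) * g k l = g (N₀ k) l + g k (N₀ l) ∧
      0 = g (U k) l - g k (U l) := by
    intro k l
    refine pull_laurent_ext ((Units.isUnit (zUnit m ^ w)).mul_left_cancel ?_)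
    have h1 := T.P_flatZ (sec E k) (sec E l)
    rw [hZ.pairing_add T.isSesquilinear_P (g := fun k l => g k l) hg, hg, Derivation.leibniz,
      zDz_zPow, zDz_pull, smul_zero, zero_add, smul_eq_mul] at h1
    rw [map_zero, mul_zero, add_zero, map_mul, map_intCast]
    refine Eq.trans ?_ h1
    change zPow m w * _ = _
    ring
  have hN_smul : ∀ X k, N X (c • k) = c • N X k := fun X k => by
    rw [hleib, act_algebraMap, zero_smul, zero_add]
  have hN_sub : ∀ X k l, N X (k - l) = N X k - N X l := fun X =>
    map_sub (AddMonoidHom.mk' (N X) (hadd X))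
  refine ⟨{
    free := inferInstance
    finite := inferInstance
    nabla := N
    nabla_field_add := fun X Y k => (hfield X Y k).1
    nabla_field_smul := fun f X k => (hfield' f X k).1
    nabla_add := hadd
    nabla_leibniz := hleib
    nabla_flat := fun X Y k => sub_eq_zero.1 (hflat X Y k).1
    C := LinearMap.mk₂ (BaseRing m) (fun X k => C X k) (fun X Y k => (hfield X Y k).2)
      (fun f X k => (hfield' f X k).2) (fun X => map_add (C X)) (fun r X => map_smul (C X) r)
    higgs := fun X Y k => sub_eq_zero.1 (hflat X Y k).2.2
    U := U
    U_C := fun X k => (sub_eq_zero.1 (hflatZ X k).2.2).symm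
    V := V
    V_flat := fun X k => by
      rw [hV, hV, hN_sub, hN_smul, sub_eq_zero.1 (hflatZ X k).1]
    g := g
    g_symm := fun k l => hsymm l k
    g_nondegenerate := T.pairing_bijective h0 g hg fun k l => hsymm l k
    g_flat := fun X k l => (hPflat X k l).1
    nabla_C := fun X Y k => by
      refine Eq.trans ?_ (hflat X Y k).2.1
      change (N X (C Y k) - C Y (N X k)) - (N Y (C X k) - C X (N Y k)) - C (logBracket X Y) k = _
      abel
    nabla_U := fun X k => by
      refine Eq.trans ?_ (hflatZ X k).2.1
      change (N X (U k) - U (N X k)) - (C X (V k) - V (C X k)) + C X k = _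
      rw [hN₀, hN₀, map_sub, map_smul]
      abel
    g_C := fun X k l => sub_eq_zero.1 (hPflat X k l).2.symm
    g_U := fun k l => sub_eq_zero.1 (hPflatZ k l).2.symm
    g_V := fun k l => by
      have h1 := (hPflatZ k l).1
      rw [hN₀, hN₀, map_sub, map_sub, LinearMap.sub_apply, map_smul, map_smul,
        LinearMap.smul_apply, smul_eq_mul, ← hc] at h1
      linear_combination h1 }, h0, hinf, hNC, fun k => ?_, hg⟩
  rw [hZ, hN₀]

end Deconstruction

/-! ### Isomorphisms -/

section Isomorphisms

variable {m : ℕ} {D : NormalCrossing m} {w : ℤ}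
  {K : Type*} [AddCommGroup K] [Module (BaseRing m) K]
  {H : Type*} [AddCommGroup H] [Module (PuncRing m) H]
  {K' : Type*} [AddCommGroup K'] [Module (BaseRing m) K']
  {H' : Type*} [AddCommGroup H'] [Module (PuncRing m) H']
  {E : PuncRing m ⊗[BaseRing m] K ≃ₗ[PuncRing m] H}
  {E' : PuncRing m ⊗[BaseRing m] K' ≃ₗ[PuncRing m] H'}

theorem map_mem_lattice {e : K → K'} {F : H ≃ₗ[PuncRing m] H'}
    (hF : ∀ k, F (sec E k) = sec E' (e k)) (B : Subalgebra ℂ (PuncRing m)) {x : H}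
    (hx : x ∈ lattice E B) : F x ∈ lattice E' B := by
  induction hx using lattice_induction with
  | hadd x y _ _ hx hy => rw [map_add]; exact add_mem hx hy
  | hsec f hf k =>
    rw [map_smul, hF]
    exact smul_mem_lattice hf (sec_mem_lattice B _)

theorem map_mem_lattice_iff {e : K ≃ₗ[BaseRing m] K'} {F : H ≃ₗ[PuncRing m] H'}
    (hF : ∀ k, F (sec E k) = sec E' (e k)) (B : Subalgebra ℂ (PuncRing m)) (x : H) :
    F x ∈ lattice E' B ↔ x ∈ lattice E B := by
  refine ⟨fun h => ?_, map_mem_lattice hF B⟩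
  have h1 := map_mem_lattice (E := E') (E' := E) (F := F.symm) (e := e.symm) (fun k => by
    rw [LinearEquiv.symm_apply_eq, hF, LinearEquiv.apply_symm_apply]) B h
  rwa [LinearEquiv.symm_apply_apply] at h1

theorem IsConnOver.map {δ : Derivation ℂ (PuncRing m) (PuncRing m)} {D : H → H} {D' : H' → H'}
    (h : IsConnOver δ D) (h' : IsConnOver δ D') {F : H ≃ₗ[PuncRing m] H'}
    (hs : ∀ k, F (D (sec E k)) = D' (F (sec E k))) (x : H) : F (D x) = D' (F x) := by
  induction x using sec_induction E with
  | hadd x y hx hy => rw [h.add, map_add, hx, hy, map_add, h'.add]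
  | hsec f k =>
    rw [h.leibniz, map_add, map_smul, map_smul, hs, map_smul, h'.leibniz]

theorem HasExpansion.map_iff [Module.Free (BaseRing m) K'] {e : K → K'} {F : H ≃ₗ[PuncRing m] H'}
    (hF : ∀ k, F (sec E k) = sec E' (e k)) {D : H → H} {D' : H' → H'} {N C : K → K}
    {N' C' : K' → K'} (h : HasExpansion E D N C) (h' : HasExpansion E' D' N' C') (k : K) :
    F (D (sec E k)) = D' (F (sec E k)) ↔ e (N k) = N' (e k) ∧ e (C k) = C' (e k) := by
  rw [h, hF, h', map_add, map_smul, hF, hF]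
  refine ⟨fun h => laurent_ext h, fun h => by rw [h.1, h.2]⟩

/-- An isomorphism of the bundles `K` and `K'` respects two Frobenius type structures if and only if
its pullback respects the structures constructed from them. -/
theorem IsExplicitAlong.isIso_iff {S : FrobType D K} {S' : FrobType D K'} {T : TrTLEP D w H}
    {T' : TrTLEP D w H'} (h : IsExplicitAlong E S T) (h' : IsExplicitAlong E' S' T')
    {e : K ≃ₗ[BaseRing m] K'} {F : H ≃ₗ[PuncRing m] H'}
    (hF : ∀ k, F (sec E k) = sec E' (e k)) :
    FrobType.IsIso S S' e ↔ TrTLEP.IsIso T T' F := by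
  have := S'.free
  have hX := fun X k => HasExpansion.map_iff (e := e) hF (h.nabla X) (h'.nabla X) k
  have hZ := fun k => HasExpansion.map_iff (e := e) hF h.nablaZ h'.nablaZ k
  constructor
  · intro he
    refine ⟨fun a => ?_, fun a => ?_, fun X => ?_, ?_, fun a b => ?_⟩
    · rw [h.latZero, h'.latZero]; exact map_mem_lattice_iff hF _ a
    · rw [h.latInfty, h'.latInfty]; exact map_mem_lattice_iff hF _ a
    · exact (T.isConnOver_nabla X).map (T'.isConnOver_nabla X)
        fun k => (hX X k).2 ⟨he.nabla X k, he.C X k⟩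
    · exact T.isConnOver_nablaZ.map T'.isConnOver_nablaZ fun k => (hZ k).2
        ⟨by rw [map_sub, map_smul, he.V], he.U k⟩
    · have hP : IsSesquilinear fun a b => T'.P (F a) (F b) :=
        ⟨fun a a' b => by rw [map_add, T'.P_add_left],
          fun a b b' => by rw [map_add, T'.P_add_right],
          fun f a b => by rw [map_smul, T'.P_smul_left],
          fun f a b => by rw [map_smul, T'.P_smul_right]⟩
      refine hP.ext (E := E) T.isSesquilinear_P (fun k l => ?_) a b
      rw [hF, hF, h.P, h'.P, he.g]
  · intro hT
    refine ⟨fun X k => ((hX X k).1 (hT.nabla X _)).1, fun X k => ((hX X k).1 (hT.nabla X _)).2,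
      fun k => ((hZ k).1 (hT.nablaZ _)).2, fun k => ?_, fun k l => pull_injective ?_⟩
    · have h1 := ((hZ k).1 (hT.nablaZ _)).1
      rw [map_sub, map_smul] at h1
      exact sub_right_injective h1
    · have h1 := hT.P (sec E k) (sec E l)
      rw [hF, hF, h.P, h'.P] at h1
      exact (Units.isUnit (zUnit m ^ w)).mul_left_cancel h1

/-- An isomorphism of bundles over `ℙ¹ × (M, 0)` is the pullback of an isomorphism of bundles over
`(M, 0)`, because it maps global sections to global sections. -/
theorem exists_linearEquiv_sec [Module.Free (BaseRing m) K] [Module.Finite (BaseRing m) K]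
    [Module.Free (BaseRing m) K'] [Module.Finite (BaseRing m) K'] (F : H ≃ₗ[PuncRing m] H')
    (h0 : ∀ x, F x ∈ lattice E' (zeroRing m) ↔ x ∈ lattice E (zeroRing m))
    (hinf : ∀ x, F x ∈ lattice E' (inftyRing m) ↔ x ∈ lattice E (inftyRing m)) :
    ∃ e : K ≃ₗ[BaseRing m] K', ∀ k, F (sec E k) = sec E' (e k) := by
  choose e he using fun k => exists_eq_sec E' ((h0 _).2 (sec_mem_lattice (E := E) _ k))
    ((hinf _).2 (sec_mem_lattice (E := E) _ k))
  let e' : K →ₗ[BaseRing m] K' :=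
    { toFun := e
      map_add' := fun k l => sec_injective (E := E') (by
        rw [← he, map_add, map_add, he, he, map_add])
      map_smul' := fun r k => sec_injective (E := E') (by
        rw [← he, sec_smul, map_smul, he, RingHom.id_apply, sec_smul]) }
  refine ⟨LinearEquiv.ofBijective e' ⟨fun k l hkl => ?_, fun l => ?_⟩, he⟩
  · refine sec_injective (E := E) (F.injective ?_)
    rw [he, he]
    exact congrArg (sec E') hkl
  · have hl : F (F.symm (sec E' l)) = sec E' l := F.apply_symm_apply _
    obtain ⟨k, hk⟩ := exists_eq_sec E (h := F.symm (sec E' l))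
      ((h0 _).1 (by rw [hl]; exact sec_mem_lattice _ l))
      ((hinf _).1 (by rw [hl]; exact sec_mem_lattice _ l))
    refine ⟨k, sec_injective (E := E') ?_⟩
    exact (he k).symm.trans ((congrArg F hk).symm.trans hl)

end Isomorphisms

/-! ### Restriction to `z = 0` and to `z = ∞` -/

section Fibres

variable {m : ℕ} {D : NormalCrossing m} {w : ℤ} {K : Type*} [AddCommGroup K]
  [Module (BaseRing m) K] {H : Type*} [AddCommGroup H] [Module (PuncRing m) H]
  {E : PuncRing m ⊗[BaseRing m] K ≃ₗ[PuncRing m] H} {T : TrTLEP D w H}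

namespace TrTLEP

theorem resZero_eq_zero_iff {a : T.latZero} :
    T.resZero a = 0 ↔ ∃ y ∈ T.latZero, (a : H) = zPow m 1 • y := by
  refine (Submodule.Quotient.mk_eq_zero T.subZero).trans ?_
  constructor
  · rintro ⟨y, rfl⟩
    exact ⟨y, y.2, rfl⟩
  · rintro ⟨y, hy, h⟩
    exact ⟨⟨y, hy⟩, Subtype.ext h.symm⟩

theorem resInfty_eq_zero_iff {a : T.latInfty} :
    T.resInfty a = 0 ↔ ∃ y ∈ T.latInfty, (a : H) = zPow m (-1) • y := by
  refine (Submodule.Quotient.mk_eq_zero T.subInfty).trans ?_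
  constructor
  · rintro ⟨y, rfl⟩
    exact ⟨y, y.2, rfl⟩
  · rintro ⟨y, hy, h⟩
    exact ⟨⟨y, hy⟩, Subtype.ext h.symm⟩

theorem resZero_surjective : Function.Surjective T.resZero := Submodule.mkQ_surjective _

theorem resInfty_surjective : Function.Surjective T.resInfty := Submodule.mkQ_surjective _

/-- The values of the constant sections identify `K` with `H|_{z = 0}`. -/
theorem exists_zeroFibreEquiv [Module.Free (BaseRing m) K]
    (h0 : T.latZero = lattice E (zeroRing m)) :
    ∃ q : K ≃ₗ[BaseRing m] T.ZeroFibre,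
      ∀ k (hk : sec E k ∈ T.latZero), q k = T.resZero ⟨sec E k, hk⟩ := by
  have hs : ∀ k, sec E k ∈ T.latZero := fun k => by rw [h0]; exact sec_mem_lattice _ k
  let q : K →ₗ[BaseRing m] T.ZeroFibre :=
    { toFun := fun k => T.resZero ⟨sec E k, hs k⟩
      map_add' := fun k l => by
        rw [← map_add]; exact congrArg T.resZero (Subtype.ext (map_add _ k l))
      map_smul' := fun r k => (congrArg T.resZero (Subtype.ext (sec_smul E r k))).trans
        (map_smul T.resZero (pullZero m r) ⟨sec E k, hs k⟩) }
  refine ⟨LinearEquiv.ofBijective q ⟨(injective_iff_map_eq_zero q).2 fun k hk => ?_, fun x => ?_⟩,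
    fun k _ => rfl⟩
  · obtain ⟨y, hy, hk⟩ := resZero_eq_zero_iff.1 hk
    exact eq_zero_of_sec_eq_smul E isChartRing_zeroRing (by rw [← h0]; exact hy) hk
  · obtain ⟨a, rfl⟩ := resZero_surjective x
    obtain ⟨k, y, hy, hk⟩ := exists_eq_sec_add_smul E isChartRing_zeroRing
      (show (a : H) ∈ lattice E (zeroRing m) by rw [← h0]; exact a.2)
    refine ⟨k, (sub_eq_zero.1 ?_).symm⟩
    change T.resZero a - T.resZero ⟨sec E k, hs k⟩ = 0
    rw [← map_sub]
    exact resZero_eq_zero_iff.2 ⟨y, by rw [h0]; exact hy, sub_eq_of_eq_add' hk⟩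

/-- The values of the constant sections identify `K` with `H|_{z = ∞}`. -/
theorem exists_inftyFibreEquiv [Module.Free (BaseRing m) K]
    (hinf : T.latInfty = lattice E (inftyRing m)) :
    ∃ q : K ≃ₗ[BaseRing m] T.InftyFibre,
      ∀ k (hk : sec E k ∈ T.latInfty), q k = T.resInfty ⟨sec E k, hk⟩ := by
  have hs : ∀ k, sec E k ∈ T.latInfty := fun k => by rw [hinf]; exact sec_mem_lattice _ k
  let q : K →ₗ[BaseRing m] T.InftyFibre :=
    { toFun := fun k => T.resInfty ⟨sec E k, hs k⟩
      map_add' := fun k l => by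
        rw [← map_add]; exact congrArg T.resInfty (Subtype.ext (map_add _ k l))
      map_smul' := fun r k => (congrArg T.resInfty (Subtype.ext (sec_smul E r k))).trans
        (map_smul T.resInfty (pullInfty m r) ⟨sec E k, hs k⟩) }
  refine ⟨LinearEquiv.ofBijective q ⟨(injective_iff_map_eq_zero q).2 fun k hk => ?_, fun x => ?_⟩,
    fun k _ => rfl⟩
  · obtain ⟨y, hy, hk⟩ := resInfty_eq_zero_iff.1 hk
    exact eq_zero_of_sec_eq_smul E isChartRing_inftyRing (by rw [← hinf]; exact hy) hk
  · obtain ⟨a, rfl⟩ := resInfty_surjective x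
    obtain ⟨k, y, hy, hk⟩ := exists_eq_sec_add_smul E isChartRing_inftyRing
      (show (a : H) ∈ lattice E (inftyRing m) by rw [← hinf]; exact a.2)
    refine ⟨k, (sub_eq_zero.1 ?_).symm⟩
    change T.resInfty a - T.resInfty ⟨sec E k, hs k⟩ = 0
    rw [← map_sub]
    exact resInfty_eq_zero_iff.2 ⟨y, by rw [hinf]; exact hy, sub_eq_of_eq_add' hk⟩

/-- `E` is the isomorphism `π^* (H|_{z = 0}) ≅ H` that extends the values at `z = 0` of global
sections. -/
structure IsCanonicalTriv (T : TrTLEP D w H)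
    (E : PuncRing m ⊗[BaseRing m] T.ZeroFibre ≃ₗ[PuncRing m] H) : Prop where
  free : Module.Free (BaseRing m) T.ZeroFibre
  finite : Module.Finite (BaseRing m) T.ZeroFibre
  latZero : T.latZero = lattice E (zeroRing m)
  latInfty : T.latInfty = lattice E (inftyRing m)
  resZero_sec : ∀ k (hk : sec E k ∈ T.latZero), T.resZero ⟨sec E k, hk⟩ = k

theorem exists_isCanonicalTriv (T : TrTLEP D w H) : ∃ E, T.IsCanonicalTriv E := by
  obtain ⟨n, B, hB0, hBinf⟩ := T.trivial
  let b := Pi.basisFun (BaseRing m) (Fin n)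
  let E₀ : PuncRing m ⊗[BaseRing m] (Fin n → BaseRing m) ≃ₗ[PuncRing m] H :=
    (b.baseChange (PuncRing m)).equiv B (Equiv.refl _)
  have hE₀ : (fun i => sec E₀ (b i)) = B := funext fun i => by
    rw [sec_apply, ← Module.Basis.baseChange_apply]
    exact Module.Basis.equiv_apply _ _ _ _
  have h0 : T.latZero = lattice E₀ (zeroRing m) := by
    rw [hB0, lattice_eq_span b pull_mem_zeroRing, hE₀]
  have hinf : T.latInfty = lattice E₀ (inftyRing m) := by
    rw [hBinf, lattice_eq_span b pull_mem_inftyRing, hE₀]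
  obtain ⟨q, hq⟩ := exists_zeroFibreEquiv h0
  let E := (q.symm.baseChange (BaseRing m) (PuncRing m) _ _).trans E₀
  have hE : ∀ k, sec E k = sec E₀ (q.symm k) := fun k => by
    rw [sec_apply, LinearEquiv.trans_apply, LinearEquiv.baseChange_tmul]; rfl
  have hr : range (sec E) = range (sec E₀) := by
    rw [show (sec E : T.ZeroFibre → H) = sec E₀ ∘ q.symm from funext hE,
      q.symm.surjective.range_comp]
  refine ⟨E, Module.Free.of_equiv q, Module.Finite.equiv q, ?_, ?_, fun k => ?_⟩
  · rw [h0, lattice, lattice, hr]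
  · rw [hinf, lattice, lattice, hr]
  · rw [hE]
    exact fun hk => (hq _ hk).symm.trans (q.apply_symm_apply k)

namespace IsCanonicalTriv

variable {E : PuncRing m ⊗[BaseRing m] T.ZeroFibre ≃ₗ[PuncRing m] H}
  {j : T.InftyFibre ≃ₗ[BaseRing m] T.ZeroFibre}

theorem sec_mem_latZero (hE : T.IsCanonicalTriv E) (k : T.ZeroFibre) : sec E k ∈ T.latZero := by
  rw [hE.latZero]; exact sec_mem_lattice _ k

theorem sec_mem_latInfty (hE : T.IsCanonicalTriv E) (k : T.ZeroFibre) : sec E k ∈ T.latInfty := by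
  rw [hE.latInfty]; exact sec_mem_lattice _ k

theorem eq_sec (hE : T.IsCanonicalTriv E) {s : H} (h0 : s ∈ T.latZero) (hinf : s ∈ T.latInfty) :
    s = sec E (T.resZero ⟨s, h0⟩) := by
  have := hE.free
  have := hE.finite
  obtain ⟨k, rfl⟩ := exists_eq_sec E (hE.latZero ▸ h0) (hE.latInfty ▸ hinf)
  rw [hE.resZero_sec]

theorem existsUnique_isCanonical (hE : T.IsCanonicalTriv E) :
    ∃! j : T.InftyFibre ≃ₗ[BaseRing m] T.ZeroFibre, T.IsCanonical j := by
  have := hE.free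
  have := hE.finite
  obtain ⟨q, hq⟩ := exists_inftyFibreEquiv hE.latInfty
  refine ⟨q.symm, fun s h0 hinf => ?_, fun j hj => ?_⟩
  · rw [LinearEquiv.symm_apply_eq, hq _ (hE.sec_mem_latInfty _)]
    exact congrArg T.resInfty (Subtype.ext (hE.eq_sec h0 hinf))
  · refine LinearEquiv.ext fun x => ?_
    obtain ⟨k, rfl⟩ := q.surjective x
    rw [LinearEquiv.symm_apply_apply, hq k (hE.sec_mem_latInfty k),
      hj _ (hE.sec_mem_latZero k), hE.resZero_sec]

theorem resZero_eq (hE : T.IsCanonicalTriv E) {a : T.latZero} {k : T.ZeroFibre}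
    {y : H} (hy : y ∈ T.latZero)
    (h : (a : H) = sec E k + zPow m 1 • y) : T.resZero a = k := by
  rw [← hE.resZero_sec k (hE.sec_mem_latZero k), ← sub_eq_zero, ← map_sub]
  exact resZero_eq_zero_iff.2 ⟨y, hy, sub_eq_of_eq_add' h⟩

theorem resInfty_eq (hE : T.IsCanonicalTriv E) (hj : T.IsCanonical j)
    {a : T.latInfty} {k : T.ZeroFibre} {y : H}
    (hy : y ∈ T.latInfty) (h : (a : H) = sec E k + zPow m (-1) • y) : j (T.resInfty a) = k := by
  rw [← hE.resZero_sec k (hE.sec_mem_latZero k), ← hj _ _ (hE.sec_mem_latInfty k),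
    ← sub_eq_zero, ← map_sub, ← map_sub]
  refine (congrArg j ?_).trans (map_zero j)
  exact resInfty_eq_zero_iff.2 ⟨y, hy, sub_eq_of_eq_add' h⟩

theorem exists_eq_sec_resZero_add (hE : T.IsCanonicalTriv E) (a : T.latZero) :
    ∃ y ∈ T.latZero, (a : H) = sec E (T.resZero a) + zPow m 1 • y := by
  obtain ⟨k, y, hy, h⟩ := exists_eq_sec_add_smul E isChartRing_zeroRing
    (show (a : H) ∈ lattice E (zeroRing m) from hE.latZero ▸ a.2)
  rw [← hE.latZero] at hy
  exact ⟨y, hy, by rw [hE.resZero_eq hy h]; exact h⟩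

theorem exists_eq_sec_resInfty_add (hE : T.IsCanonicalTriv E) (hj : T.IsCanonical j)
    (a : T.latInfty) :
    ∃ y ∈ T.latInfty, (a : H) = sec E (j (T.resInfty a)) + zPow m (-1) • y := by
  obtain ⟨k, y, hy, h⟩ := exists_eq_sec_add_smul E isChartRing_inftyRing
    (show (a : H) ∈ lattice E (inftyRing m) from hE.latInfty ▸ a.2)
  rw [← hE.latInfty] at hy
  exact ⟨y, hy, by rw [hE.resInfty_eq hj hy h]; exact h⟩

/-- The coefficients of the expansion of the structure on `H` are its residues. -/
theorem isResidue_of_isExplicitAlong (hE : T.IsCanonicalTriv E) (hj : T.IsCanonical j)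
    {S : FrobType D T.ZeroFibre}
    (hS : IsExplicitAlong E S T) : T.IsResidue j S := by
  have hzm : ∀ {y}, y ∈ T.latZero → zPow m 1 • y ∈ T.latZero := fun hy =>
    T.latZero.smul_mem (zAtZero m) hy
  refine ⟨hj, fun X a => ?_, fun a => ?_, fun a b => ?_, fun X a => ?_, fun a => ?_⟩
  · obtain ⟨y, hy, ha⟩ := hE.exists_eq_sec_resZero_add a
    refine (hE.resZero_eq (add_mem (hE.sec_mem_latZero (S.nabla X (T.resZero a)))
      (T.pole_zero X y hy)) ?_).symm
    change zPow m 1 • T.nabla X a = _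
    rw [ha, T.nabla_add, T.nabla_leibniz, lift_zPow, zero_smul, zero_add, hS.nabla,
      smul_add, smul_add, smul_add, zPow_smul_smul 1 (-1), add_neg_cancel, zPow_zero, one_smul]
    abel
  · obtain ⟨y, hy, ha⟩ := hE.exists_eq_sec_resZero_add a
    refine (hE.resZero_eq (add_mem (hE.sec_mem_latZero
      (algebraMap ℂ (BaseRing m) (w / 2 : ℂ) • T.resZero a - S.V (T.resZero a)))
      (add_mem (hzm hy) (T.pole_zeroZ y hy))) ?_).symm
    change zPow m 1 • T.nablaZ a = _
    rw [ha, T.nablaZ_add, T.nablaZ_leibniz, zDz_zPow, Int.cast_one, one_mul, hS.nablaZ,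
      smul_add, smul_add, smul_add, smul_add, smul_add, zPow_smul_smul 1 (-1), add_neg_cancel,
      zPow_zero, one_smul]
    abel
  · obtain ⟨y, hy, ha⟩ := hE.exists_eq_sec_resZero_add a
    obtain ⟨y', hy', hb⟩ := hE.exists_eq_sec_resZero_add b
    have hk := hE.sec_mem_latZero (T.resZero a)
    -- the sign comes from the substitution `z ↦ -z` in the second argument of `P`
    refine ⟨⟨_, sub_mem (T.P_zero y hy b b.2) (T.P_zero _ hk y' hy')⟩, ?_⟩
    have h1 : T.P a b = zPow m w * pull m (S.g (T.resZero a) (T.resZero b)) +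
        (zPow m 1 * T.P y b - zPow m 1 * T.P (sec E (T.resZero a)) y') := by
      conv_lhs => rw [ha, T.P_add_left, T.P_smul_left]
      nth_rewrite 1 [hb]
      rw [T.P_add_right, T.P_smul_right, hS.P, negZ_zPow_one]
      ring
    change _ = _ + zPow m 1 * (zPow m (-w) * _ - zPow m (-w) * _)
    rw [h1]
    linear_combination pull m (S.g (T.resZero a) (T.resZero b)) *
      zPow_mul_cancel (m := m) (neg_add_cancel w)
  · obtain ⟨y, hy, ha⟩ := hE.exists_eq_sec_resInfty_add hj a
    refine (hE.resInfty_eq hj (add_mem (hE.sec_mem_latInfty (S.C X (j (T.resInfty a))))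
      (T.pole_infty X y hy)) ?_).symm
    change T.nabla X a = _
    conv_lhs => rw [ha, T.nabla_add, T.nabla_leibniz, lift_zPow, zero_smul, zero_add, hS.nabla]
    rw [smul_add]
    abel
  · obtain ⟨y, hy, ha⟩ := hE.exists_eq_sec_resInfty_add hj a
    have h1 : j (T.resInfty ⟨T.nablaZ a, T.pole_inftyZ a a.2⟩) =
        algebraMap ℂ (BaseRing m) (w / 2 : ℂ) • j (T.resInfty a) - S.V (j (T.resInfty a)) := by
      refine hE.resInfty_eq hj (add_mem (hE.sec_mem_latInfty (S.U (j (T.resInfty a))))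
        (sub_mem (T.pole_inftyZ y hy) hy)) ?_
      change T.nablaZ a = _
      conv_lhs => rw [ha, T.nablaZ_add, T.nablaZ_leibniz, zDz_zPow, hS.nablaZ]
      push_cast
      rw [smul_add, smul_sub, neg_one_mul, neg_smul]
      abel
    rw [map_neg, h1]
    abel

end IsCanonicalTriv

/-- The residues determine the Frobenius type structure. -/
theorem IsResidue.frobType_eq {j : T.InftyFibre ≃ₗ[BaseRing m] T.ZeroFibre}
    {S S' : FrobType D T.ZeroFibre} (h : T.IsResidue j S) (h' : T.IsResidue j S') : S = S' := by
  refine FrobType.ext (funext fun X => funext fun x => ?_)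
    (LinearMap.ext fun X => LinearMap.ext fun x => ?_) (LinearMap.ext fun x => ?_)
    (LinearMap.ext fun x => ?_) (LinearMap.ext fun x => LinearMap.ext fun y => ?_)
  · obtain ⟨y, rfl⟩ := j.surjective x
    obtain ⟨a, rfl⟩ := resInfty_surjective y
    rw [h.nabla, h'.nabla]
  · obtain ⟨a, rfl⟩ := resZero_surjective x
    rw [h.C, h'.C]
  · obtain ⟨a, rfl⟩ := resZero_surjective x
    rw [h.U, h'.U]
  · obtain ⟨y, rfl⟩ := j.surjective x
    obtain ⟨a, rfl⟩ := resInfty_surjective y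
    rw [h.V, h'.V]
  · obtain ⟨a, rfl⟩ := resZero_surjective x
    obtain ⟨b, rfl⟩ := resZero_surjective y
    obtain ⟨c, hc⟩ := h.g a b
    obtain ⟨c', hc'⟩ := h'.g a b
    refine sub_eq_zero.1 (isChartRing_zeroRing.eq_zero _ (c' - c : zeroRing m) (c' - c).2 ?_)
    have hc2 := hc.symm.trans hc'
    rw [map_sub]
    push_cast at hc2 ⊢
    linear_combination hc2

theorem IsCanonicalTriv.exists_isResidue
    {E : PuncRing m ⊗[BaseRing m] T.ZeroFibre ≃ₗ[PuncRing m] H} (hE : T.IsCanonicalTriv E)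
    {j : T.InftyFibre ≃ₗ[BaseRing m] T.ZeroFibre} (hj : T.IsCanonical j) :
    ∃ S : FrobType D T.ZeroFibre, T.IsResidue j S ∧ IsExplicitAlong E S T := by
  have := hE.free
  have := hE.finite
  obtain ⟨S, hS⟩ := T.exists_isExplicitAlong hE.latZero hE.latInfty
  exact ⟨S, hE.isResidue_of_isExplicitAlong hj hS, hS⟩

theorem IsCanonicalTriv.isExplicitAlong
    {E : PuncRing m ⊗[BaseRing m] T.ZeroFibre ≃ₗ[PuncRing m] H} (hE : T.IsCanonicalTriv E)
    {j : T.InftyFibre ≃ₗ[BaseRing m] T.ZeroFibre} {S : FrobType D T.ZeroFibre}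
    (h : T.IsResidue j S) : IsExplicitAlong E S T := by
  obtain ⟨S', hS', hS⟩ := hE.exists_isResidue h.canonical
  rwa [h.frobType_eq hS']

end TrTLEP

end Fibres

/-! ### The correspondence -/

section Correspondence

variable {m : ℕ} {D : NormalCrossing m} {w : ℤ}

/-- Isomorphisms between two constructed structures come from isomorphisms of the Frobenius type
structures. -/
theorem IsExplicitAlong.exists_frobIso {K : Type*} [AddCommGroup K] [Module (BaseRing m) K]
    {H : Type*} [AddCommGroup H] [Module (PuncRing m) H]
    {K' : Type*} [AddCommGroup K'] [Module (BaseRing m) K']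
    {H' : Type*} [AddCommGroup H'] [Module (PuncRing m) H']
    {E : PuncRing m ⊗[BaseRing m] K ≃ₗ[PuncRing m] H}
    {E' : PuncRing m ⊗[BaseRing m] K' ≃ₗ[PuncRing m] H'}
    {S : FrobType D K} {S' : FrobType D K'} {T : TrTLEP D w H} {T' : TrTLEP D w H'}
    (h : IsExplicitAlong E S T) (h' : IsExplicitAlong E' S' T') {F : H ≃ₗ[PuncRing m] H'}
    (hF : TrTLEP.IsIso T T' F) :
    ∃ e : K ≃ₗ[BaseRing m] K', FrobType.IsIso S S' e ∧ ∀ k, F (sec E k) = sec E' (e k) := by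
  have := S.free
  have := S.finite
  have := S'.free
  have := S'.finite
  obtain ⟨e, he⟩ := exists_linearEquiv_sec (E := E) (E' := E') F
    (by rw [← h.latZero, ← h'.latZero]; exact hF.latZero)
    (by rw [← h.latInfty, ← h'.latInfty]; exact hF.latInfty)
  exact ⟨e, (h.isIso_iff h' he).2 hF, he⟩

theorem TrTLEP.IsIso.refl {H : Type*} [AddCommGroup H] [Module (PuncRing m) H]
    (T : TrTLEP D w H) : TrTLEP.IsIso T T (LinearEquiv.refl _ _) :=
  ⟨fun _ => Iff.rfl, fun _ => Iff.rfl, fun _ _ => rfl, fun _ => rfl, fun _ _ => rfl⟩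

theorem ext_pull {K : Type*} [AddCommGroup K] [Module (BaseRing m) K]
    {H : Type*} [AddCommGroup H] [Module (PuncRing m) H]
    {F F' : PuncRing m ⊗[BaseRing m] K ≃ₗ[PuncRing m] H}
    (h : ∀ k, F (1 ⊗ₜ k) = F' (1 ⊗ₜ k)) : F = F' := by
  refine LinearEquiv.ext fun x => ?_
  induction x using sec_induction (pullEquiv m K) with
  | hadd x y hx hy => rw [map_add, map_add, hx, hy]
  | hsec f k => rw [map_smul, map_smul]; exact congrArg (f • ·) (h k)

theorem baseChange_sec {K K' : Type*} [AddCommGroup K] [Module (BaseRing m) K] [AddCommGroup K']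
    [Module (BaseRing m) K'] (e : K ≃ₗ[BaseRing m] K') (k : K) :
    e.baseChange (BaseRing m) (PuncRing m) K K' (sec (pullEquiv m K) k) =
      sec (pullEquiv m K') (e k) := LinearEquiv.baseChange_tmul _ _ _ _ _ _

/-- A Frobenius type structure is canonically isomorphic to the residues of the structure that is
constructed from it. -/
theorem TrTLEP.IsExplicit.existsUnique_isIso {K : Type*} [AddCommGroup K] [Module (BaseRing m) K]
    {S : FrobType D K} {T : TrTLEP D w (PuncRing m ⊗[BaseRing m] K)} (hT : TrTLEP.IsExplicit S T)
    {j : T.InftyFibre ≃ₗ[BaseRing m] T.ZeroFibre} {S' : FrobType D T.ZeroFibre}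
    (h : T.IsResidue j S') :
    ∃! e : K ≃ₗ[BaseRing m] T.ZeroFibre,
      (∀ (k : K) (hk : (1 : PuncRing m) ⊗ₜ[BaseRing m] k ∈ T.latZero),
        e k = T.resZero ⟨1 ⊗ₜ k, hk⟩) ∧ FrobType.IsIso S S' e := by
  obtain ⟨E, hE⟩ := T.exists_isCanonicalTriv
  obtain ⟨e, he, hs⟩ := (isExplicit_iff.1 hT).exists_frobIso (hE.isExplicitAlong h)
    (TrTLEP.IsIso.refl T)
  have hek : ∀ (k : K) (hk : (1 : PuncRing m) ⊗ₜ[BaseRing m] k ∈ T.latZero),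
      e k = T.resZero ⟨1 ⊗ₜ k, hk⟩ := fun k hk => by
    rw [← hE.resZero_sec (e k) (hE.sec_mem_latZero _)]
    exact congrArg T.resZero (Subtype.ext (hs k).symm)
  refine ⟨e, ⟨hek, he⟩, fun e' he' => LinearEquiv.ext fun k => ?_⟩
  have hk : (1 : PuncRing m) ⊗ₜ[BaseRing m] k ∈ T.latZero := by
    rw [hT.latZero]; exact Submodule.subset_span ⟨k, rfl⟩
  rw [he'.1 k hk, hek k hk]

/-- A `(logD-trTLEP(w))`-structure is canonically isomorphic to the structure that is constructed
from its residues. -/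
theorem TrTLEP.IsResidue.existsUnique_isIso {H : Type*} [AddCommGroup H] [Module (PuncRing m) H]
    {T : TrTLEP D w H} {j : T.InftyFibre ≃ₗ[BaseRing m] T.ZeroFibre}
    {S : FrobType D T.ZeroFibre} (h : T.IsResidue j S)
    {T' : TrTLEP D w (PuncRing m ⊗[BaseRing m] T.ZeroFibre)} (hT' : TrTLEP.IsExplicit S T') :
    ∃! e : PuncRing m ⊗[BaseRing m] T.ZeroFibre ≃ₗ[PuncRing m] H,
      (∀ (s : H) (h0 : s ∈ T.latZero), s ∈ T.latInfty → e (1 ⊗ₜ T.resZero ⟨s, h0⟩) = s) ∧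
      TrTLEP.IsIso T' T e := by
  obtain ⟨E, hE⟩ := T.exists_isCanonicalTriv
  refine ⟨E, ⟨fun s h0 hinf => (hE.eq_sec h0 hinf).symm, ?_⟩, fun e he => ext_pull fun k => ?_⟩
  · exact ((isExplicit_iff.1 hT').isIso_iff (hE.isExplicitAlong h)
      (e := LinearEquiv.refl _ _) (F := E) fun k => rfl).1
      ⟨fun _ _ => rfl, fun _ _ => rfl, fun _ => rfl, fun _ => rfl, fun _ _ => rfl⟩
  · have h1 := he.1 _ (hE.sec_mem_latZero k) (hE.sec_mem_latInfty k)
    rw [hE.resZero_sec] at h1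
    exact h1

theorem TrTLEP.exists_isResidue {H : Type*} [AddCommGroup H] [Module (PuncRing m) H]
    (T : TrTLEP D w H) : ∃ S : FrobType D T.ZeroFibre, ∃ j, T.IsResidue j S := by
  obtain ⟨E, hE⟩ := T.exists_isCanonicalTriv
  obtain ⟨j, hj, -⟩ := hE.existsUnique_isCanonical
  obtain ⟨S, hS, -⟩ := hE.exists_isResidue hj
  exact ⟨S, j, hS⟩

/-- The Frobenius type structure of the residues of a `(logD-trTLEP(w))`-structure. -/
def TrTLEP.residue {H : Type*} [AddCommGroup H] [Module (PuncRing m) H]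
    (T : TrTLEP D w H) : FrobType D T.ZeroFibre := T.exists_isResidue.choose

theorem TrTLEP.IsResidue.eq_residue {H : Type*} [AddCommGroup H] [Module (PuncRing m) H]
    {T : TrTLEP D w H} {j : T.InftyFibre ≃ₗ[BaseRing m] T.ZeroFibre}
    {S : FrobType D T.ZeroFibre} (h : T.IsResidue j S) : S = T.residue := by
  obtain ⟨E, hE⟩ := T.exists_isCanonicalTriv
  obtain ⟨j', h'⟩ : ∃ j', T.IsResidue j' T.residue := T.exists_isResidue.choose_spec
  exact (hE.isExplicitAlong h).frobType_eq (hE.isExplicitAlong h')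

/-- The bijection between isomorphism classes induced by `FrobType.toTrTLEP` and
`TrTLEP.residue`. -/
def classEquiv (D : NormalCrossing m) (w : ℤ) : FrobTypeClass.{u} D ≃ TrTLEPClass.{u} D w where
  toFun := Quot.lift (fun O => (O.str.toTrTLEP w).cls) (by
    rintro O O' ⟨e, he⟩
    refine Quot.sound ⟨e.baseChange (BaseRing m) (PuncRing m) _ _, ?_⟩
    exact ((isExplicitAlong_toTrTLEP w O.str).isIso_iff (isExplicitAlong_toTrTLEP w O'.str)
      (baseChange_sec e)).1 he)
  invFun := Quot.lift (fun O => O.str.residue.cls) (by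
    rintro O O' ⟨F, hF⟩
    obtain ⟨E, hE⟩ := O.str.exists_isCanonicalTriv
    obtain ⟨E', hE'⟩ := O'.str.exists_isCanonicalTriv
    obtain ⟨j, h⟩ : ∃ j, O.str.IsResidue j O.str.residue := O.str.exists_isResidue.choose_spec
    obtain ⟨j', h'⟩ : ∃ j, O'.str.IsResidue j O'.str.residue := O'.str.exists_isResidue.choose_spec
    obtain ⟨e, he, -⟩ := (hE.isExplicitAlong h).exists_frobIso (hE'.isExplicitAlong h') hF
    exact Quot.sound ⟨e, he⟩)
  left_inv := by
    rintro ⟨O⟩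
    obtain ⟨j, h⟩ : ∃ j, (O.str.toTrTLEP w).IsResidue j (O.str.toTrTLEP w).residue :=
      (O.str.toTrTLEP w).exists_isResidue.choose_spec
    obtain ⟨e, he, -⟩ :=
      (isExplicit_iff.2 (isExplicitAlong_toTrTLEP w O.str)).existsUnique_isIso h
    exact (Quot.sound ⟨e, he.2⟩).symm
  right_inv := by
    rintro ⟨O⟩
    obtain ⟨j, h⟩ : ∃ j, O.str.IsResidue j O.str.residue := O.str.exists_isResidue.choose_spec
    obtain ⟨e, he, -⟩ := h.existsUnique_isIso
      (isExplicit_iff.2 (isExplicitAlong_toTrTLEP w O.str.residue))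
    exact Quot.sound ⟨e, he.2⟩

end Correspondence

end LogFrob

end

theorem mainTheorem6 {m : ℕ} (D : NormalCrossing m) (w : ℤ) :
    -- from Frobenius type structures to (logD-trTLEP(w))-structures
    (∀ (K : Type u) [AddCommGroup K] [Module (BaseRing m) K] (S : FrobType D K),
      ∃! T : TrTLEP D w (PuncRing m ⊗[BaseRing m] K), TrTLEP.IsExplicit S T) ∧
    -- from (logD-trTLEP(w))-structures to Frobenius type structures
    (∀ (H : Type u) [AddCommGroup H] [Module (PuncRing m) H] (T : TrTLEP D w H),
      (∃! j : T.InftyFibre ≃ₗ[BaseRing m] T.ZeroFibre, T.IsCanonical j) ∧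
      ∀ j : T.InftyFibre ≃ₗ[BaseRing m] T.ZeroFibre, T.IsCanonical j →
        ∃! S : FrobType D T.ZeroFibre, T.IsResidue j S) ∧
    -- the first construction followed by the second one is canonically isomorphic to the identity
    (∀ (K : Type u) [AddCommGroup K] [Module (BaseRing m) K] (S : FrobType D K)
      (T : TrTLEP D w (PuncRing m ⊗[BaseRing m] K)), TrTLEP.IsExplicit S T →
      ∀ (j : T.InftyFibre ≃ₗ[BaseRing m] T.ZeroFibre) (S' : FrobType D T.ZeroFibre),
        T.IsResidue j S' →
        ∃! e : K ≃ₗ[BaseRing m] T.ZeroFibre,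
          (∀ (k : K) (hk : (1 : PuncRing m) ⊗ₜ[BaseRing m] k ∈ T.latZero),
            e k = T.resZero ⟨1 ⊗ₜ k, hk⟩) ∧
          FrobType.IsIso S S' e) ∧
    -- the second construction followed by the first one is canonically isomorphic to the identity
    (∀ (H : Type u) [AddCommGroup H] [Module (PuncRing m) H] (T : TrTLEP D w H)
      (j : T.InftyFibre ≃ₗ[BaseRing m] T.ZeroFibre) (S : FrobType D T.ZeroFibre),
      T.IsResidue j S →
      ∀ T' : TrTLEP D w (PuncRing m ⊗[BaseRing m] T.ZeroFibre), TrTLEP.IsExplicit S T' →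
        ∃! e : PuncRing m ⊗[BaseRing m] T.ZeroFibre ≃ₗ[PuncRing m] H,
          (∀ (s : H) (h0 : s ∈ T.latZero), s ∈ T.latInfty →
            e (1 ⊗ₜ T.resZero ⟨s, h0⟩) = s) ∧
          TrTLEP.IsIso T' T e) ∧
    -- isomorphisms correspond to isomorphisms
    (∀ (K K' : Type u) [AddCommGroup K] [Module (BaseRing m) K] [AddCommGroup K']
      [Module (BaseRing m) K'] (S : FrobType D K) (S' : FrobType D K')
      (T : TrTLEP D w (PuncRing m ⊗[BaseRing m] K))
      (T' : TrTLEP D w (PuncRing m ⊗[BaseRing m] K')),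
      TrTLEP.IsExplicit S T → TrTLEP.IsExplicit S' T' →
        (∀ e : K ≃ₗ[BaseRing m] K', FrobType.IsIso S S' e →
          TrTLEP.IsIso T T' (e.baseChange (BaseRing m) (PuncRing m) K K')) ∧
        (∀ E, TrTLEP.IsIso T T' E → ∃! e : K ≃ₗ[BaseRing m] K',
          FrobType.IsIso S S' e ∧ E = e.baseChange (BaseRing m) (PuncRing m) K K')) ∧
    -- hence the two constructions are mutually inverse bijections of isomorphism classes
    (∃ Φ : FrobTypeClass.{u} D ≃ TrTLEPClass.{u} D w,
      (∀ (K : Type u) [AddCommGroup K] [Module (BaseRing m) K] (S : FrobType D K)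
        (T : TrTLEP D w (PuncRing m ⊗[BaseRing m] K)), TrTLEP.IsExplicit S T →
          Φ S.cls = T.cls) ∧
      (∀ (H : Type u) [AddCommGroup H] [Module (PuncRing m) H] (T : TrTLEP D w H)
        (j : T.InftyFibre ≃ₗ[BaseRing m] T.ZeroFibre) (S : FrobType D T.ZeroFibre),
          T.IsResidue j S → Φ.symm T.cls = S.cls)) := by
  refine ⟨fun K _ _ S => ?_, fun H _ _ T => ?_, fun K _ _ S T hT j S' h => hT.existsUnique_isIso h,
    fun H _ _ T j S h T' hT' => h.existsUnique_isIso hT', fun K K' _ _ _ _ S S' T T' hT hT' => ?_,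
    classEquiv D w, fun K _ _ S T hT => ?_, fun H _ _ T j S h => ?_⟩
  · exact ⟨S.toTrTLEP w, isExplicit_iff.2 (isExplicitAlong_toTrTLEP w S), fun T hT =>
      (isExplicit_iff.1 hT).trTLEP_eq (isExplicitAlong_toTrTLEP w S)⟩
  · obtain ⟨E, hE⟩ := T.exists_isCanonicalTriv
    refine ⟨hE.existsUnique_isCanonical, fun j hj => ?_⟩
    obtain ⟨S, hS, -⟩ := hE.exists_isResidue hj
    exact ⟨S, hS, fun S' hS' => hS'.frobType_eq hS⟩
  · have h := isExplicit_iff.1 hT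
    have h' := isExplicit_iff.1 hT'
    refine ⟨fun e he => (h.isIso_iff h' (baseChange_sec e)).1 he,
      fun E hE => ?_⟩
    obtain ⟨e, he, hs⟩ := h.exists_frobIso h' hE
    refine ⟨e, ⟨he, ext_pull fun k => ?_⟩, fun e' he' => LinearEquiv.ext fun k => ?_⟩
    · exact (hs k).trans (baseChange_sec e k).symm
    · have := S'.free
      refine sec_injective (E := pullEquiv m K') (Eq.trans ?_ (hs k))
      rw [he'.2]
      exact (baseChange_sec e' k).symm
  · exact congrArg TrTLEP.cls
      ((isExplicitAlong_toTrTLEP w S).trTLEP_eq (isExplicit_iff.1 hT))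
  · exact (congrArg FrobType.cls h.eq_residue).symm
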